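/- Let $\Omega$ be either $\mathbb{R}^3$ or a regular open subset of $\mathbb{R}^3$. Regular means: near each of its boundary points $\Omega$ is the strict sublevel set $\{\varphi<0\}$ of a $C^1$ function $\varphi$ without critical points; the outer unit normal $n=\nabla\varphi/|\nabla\varphi|$ on $\partial\Omega$ extends to a $C^1$ function on $\mathbb{R}^3$; and the curvature is bounded, i.e. the tangential derivative of $n$ is bounded on $\partial\Omega$. For $x\in\partial\Omega$ put $R_x(v)=v-2(v\cdot n(x))n(x)$. For $(x,v)\in\Omega\times\mathbb{R}^3$ let $t\mapsto\Psi^t(x,v)$, $t\ge 0$, be the phase-space trajectory of the point which starts at $(x,v)$, moves in a straight line with constant velocity, and, each time its position meets $\partial\Omega$ at a point $y$, changes its velocity $w$ into $R_y(w)$; $\Psi^t$ is taken right-continuous in $t$ at the reflection times. (At points and times where infinitely many reflections have occurred, $\Psi^t$ is given the conventional value $(x+tv,v)$. If $\Omega=\mathbb{R}^3$, then $\Psi^t(x,v)=(x+tv,v)$.) For a function $f$ of $(t,x,v)$ write $f^\sharp(t,x,v)=f(t,\Psi^t(x,v))$. Let $b\in L^1(\mathbb{R}^3\times S^2)$ with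 $b\ge0$ a.e., and for a function $f$ of $(t,x,v)$ let $$Q(f)(t,x,v)=\int_{S^2}\int_{\mathbb{R}^3}b(v-v_*,\omega)\bigl(f'f'_*(1-f)(1-f_*)-ff_*(1-f')(1-f'_*)\bigr)\,dv_*\,d\omega,$$ where $f_*=f(t,x,v_*)$, $f'=f(t,x,v')$, $f'_*=f(t,x,v'_*)$, $v'=v-((v-v_*)\cdot\omega)\,\omega$, $v'_*=v_*+((v-v_*)\cdot\omega)\,\omega$. Let $f_0\in L^\infty(\Omega\times\mathbb{R}^3)$ with $0\le f_0\le1$ a.e. A function $f$ is called a solution of the initial-boundary value problem for the Boltzmann–Fermi–Dirac equation with specular reflection if, for a suitable representative of $f$: 1. the integral $Q(f)$ converges absolutely a.e., $f$ and $Q(f)$ are locally integrable on $(0,\infty)\times\Omega\times\mathbb{R}^3$, and $\partial_tf+v\cdot\nabla_xf=Q(f)$ in $\mathcal{D}'((0,\infty)\times\Omega\times\mathbb{R}^3)$; 2. $f(0,x,v)=f_0(x,v)$ for a.e. $(x,v)\in\Omega\times\mathbb{R}^3$; 3. (specular reflection) for a.e. $(x,v)\in\Omega\times\mathbb{R}^3$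 the function $t\mapsto f^\sharp(t,x,v)$ is continuous on $[0,\infty)$. Then there is a solution $f$ with $f\in L^\infty(\mathbb{R}_+\times\Omega\times\mathbb{R}^3)$ and $0\le f\le1$ a.e., and it is unique: any two such solutions coincide a.e. on $\mathbb{R}_+\times\Omega\times\mathbb{R}^3$. Moreover, $f$ is absolutely continuous in $t$ along the reflected characteristics: for a.e. $(x,v)\in\Omega\times\mathbb{R}^3$, the function $t\mapsto f^\sharp(t,x,v)$ is absolutely continuous on $[0,T]$ for every $T\ge 0$. -/

import Mathlib

open MeasureTheory Set
open scoped RealInnerProductSpace ContDiff Gradient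

noncomputable section

namespace BFD

/-- Three-dimensional Euclidean space, used for positions and for velocities. -/
abbrev E3 : Type := EuclideanSpace ℝ (Fin 3)

/-- The unit sphere `S²` of `ℝ³`. -/
abbrev S2 : Type := Metric.sphere (0 : E3) 1

/-- The usual surface measure on `S²`. -/
def surface : Measure S2 := (volume : Measure E3).toSphere

/-- `Ω` is a regular open subset of `ℝ³` and `n` is a continuously differentiable function on
`ℝ³` which extends the outer unit normal of `∂Ω`. -/
structure IsRegularDomain (Ω : Set E3) (n : E3 → E3) : Prop where
  isOpen : IsOpen Ω
  /-- `n` is of class `C¹` on the whole space. -/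
  contDiff_normal : ContDiff ℝ 1 n
  /-- Near every boundary point, `Ω` is a strict sublevel set of a `C¹` function without critical
  points, and `n` is the normalised gradient of that function on `∂Ω`. -/
  local_graph : ∀ x ∈ frontier Ω, ∃ (U : Set E3) (φ : E3 → ℝ), IsOpen U ∧ x ∈ U ∧
    ContDiffOn ℝ 1 φ U ∧ (∀ y ∈ U, ∇ φ y ≠ 0) ∧ (∀ y ∈ U, (y ∈ Ω ↔ φ y < 0)) ∧
    (∀ y ∈ U ∩ frontier Ω, n y = ‖∇ φ y‖⁻¹ • ∇ φ y)
  /-- The curvature is bounded: the tangential derivative of the normal (the shape operator)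
  is bounded on `∂Ω`. -/
  bounded_curvature : ∃ K : ℝ, ∀ x ∈ frontier Ω, ∀ τ : E3, ⟪n x, τ⟫ = 0 →
    ‖fderiv ℝ n x τ‖ ≤ K * ‖τ‖

/-- Specular reflection at the point `x`: `R_x(v) = v - 2 (v · n(x)) n(x)`. -/
def reflect (n : E3 → E3) (x v : E3) : E3 := v - (2 * ⟪v, n x⟫) • n x

/-- The first positive time at which the straight line issued from `x` with velocity `v` meets
`∂Ω`; it is `⊤` if this never happens. -/
def hitTime (Ω : Set E3) (z : E3 × E3) : ENNReal :=
  ⨅ (t : ℝ) (_ : 0 < t ∧ z.1 + t • z.2 ∈ frontier Ω), ENNReal.ofReal t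

/-- Follow the straight line from `z = (x, v)` up to the first hit of `∂Ω` and reflect there
(only meaningful if the hitting time is finite). -/
def bounce (Ω : Set E3) (n : E3 → E3) (z : E3 × E3) : E3 × E3 :=
  (z.1 + (hitTime Ω z).toReal • z.2, reflect n (z.1 + (hitTime Ω z).toReal • z.2) z.2)

/-- Position and outgoing velocity just after the `k`-th reflection of the trajectory of `z`. -/
def bounceState (Ω : Set E3) (n : E3 → E3) (z : E3 × E3) (k : ℕ) : E3 × E3 :=
  (bounce Ω n)^[k] z

/-- Time of the `k`-th reflection of the trajectory of `z` (`0` for `k = 0`, and `⊤` if there are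
fewer than `k` reflections). -/
def bounceTime (Ω : Set E3) (n : E3 → E3) (z : E3 × E3) (k : ℕ) : ENNReal :=
  ∑ j ∈ Finset.range k, hitTime Ω (bounceState Ω n z j)

/-- Number of reflections undergone by the trajectory of `z` in the time interval `[0, t]`
(the value is `0` by convention if there are infinitely many). -/
def bounceCount (Ω : Set E3) (n : E3 → E3) (t : ℝ) (z : E3 × E3) : ℕ :=
  sSup {k : ℕ | bounceTime Ω n z k ≤ ENNReal.ofReal t}

/-- The trajectory map `Ψ^t` of free transport in `Ω` with specular reflection at `∂Ω`; it is
continuous from the right at the reflection times. -/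
def traj (Ω : Set E3) (n : E3 → E3) (t : ℝ) (z : E3 × E3) : E3 × E3 :=
  let k := bounceCount Ω n t z
  let y := bounceState Ω n z k
  (y.1 + (t - (bounceTime Ω n z k).toReal) • y.2, y.2)

/-- `f^♯(t, x, v) = f(t, Ψ^t(x, v))`. -/
def sharp (Ω : Set E3) (n : E3 → E3) (f : ℝ × E3 × E3 → ℝ) (t : ℝ) (z : E3 × E3) : ℝ :=
  f (t, traj Ω n t z)

/-- `v' = v - ((v - v_*) · σ) σ`. -/
def vPrime (v vs : E3) (σ : S2) : E3 := v - ⟪v - vs, (σ : E3)⟫ • (σ : E3)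

/-- `v_*' = v_* + ((v - v_*) · σ) σ`. -/
def vsPrime (v vs : E3) (σ : S2) : E3 := vs + ⟪v - vs, (σ : E3)⟫ • (σ : E3)

/-- The integrand of the collision integral at velocity `v`, as a function of `(v_*, σ)`, for a
velocity distribution `g`. -/
def collisionIntegrand (b : E3 × S2 → ℝ) (g : E3 → ℝ) (v : E3) (p : E3 × S2) : ℝ :=
  b (v - p.1, p.2) *
    (g (vPrime v p.1 p.2) * g (vsPrime v p.1 p.2) * (1 - g v) * (1 - g p.1)
      - g v * g p.1 * (1 - g (vPrime v p.1 p.2)) * (1 - g (vsPrime v p.1 p.2)))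

/-- The Boltzmann–Fermi–Dirac collision integral `Q(f)(t, x, v)`. -/
def Q (b : E3 × S2 → ℝ) (f : ℝ × E3 × E3 → ℝ) (q : ℝ × E3 × E3) : ℝ :=
  ∫ p, collisionIntegrand b (fun w => f (q.1, q.2.1, w)) q.2.2 p ∂(volume.prod surface)

/-- Phase space `Ω × ℝ³`. -/
def phase (Ω : Set E3) : Set (E3 × E3) := Ω ×ˢ univ

/-- The set `(0, ∞) × Ω × ℝ³`. -/
def timePhase (Ω : Set E3) : Set (ℝ × E3 × E3) := Ioi 0 ×ˢ phase Ω

/-- `∂ₜ f + v · ∇ₓ f = h` in the sense of distributions on `(0, ∞) × Ω × ℝ³`. The derivative of the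
test function `φ` at `(t, x, v)` in the direction `(1, v, 0)` is `∂ₜ φ + v · ∇ₓ φ`. -/
def IsWeakTransport (Ω : Set E3) (f h : ℝ × E3 × E3 → ℝ) : Prop :=
  LocallyIntegrableOn f (timePhase Ω) ∧ LocallyIntegrableOn h (timePhase Ω) ∧
  ∀ φ : ℝ × E3 × E3 → ℝ, ContDiff ℝ ∞ φ → HasCompactSupport φ → tsupport φ ⊆ timePhase Ω →
    -(∫ q in timePhase Ω, f q * fderiv ℝ φ q (1, q.2.2, 0)) = ∫ q in timePhase Ω, h q * φ q

/-- `f` solves the initial-boundary value problem for the Boltzmann–Fermi–Dirac equation in `Ω`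
with specular reflection, with initial datum `f₀`. -/
structure IsSolution (Ω : Set E3) (n : E3 → E3) (b : E3 × S2 → ℝ) (f₀ : E3 × E3 → ℝ)
    (f : ℝ × E3 × E3 → ℝ) : Prop where
  /-- The collision integral converges absolutely at almost every point. -/
  collision_integrable : ∀ᵐ q ∂(volume.restrict (timePhase Ω)),
    Integrable (collisionIntegrand b (fun w => f (q.1, q.2.1, w)) q.2.2) (volume.prod surface)
  /-- The equation `∂ₜ f + v · ∇ₓ f = Q(f)` holds in the sense of distributions. -/
  equation : IsWeakTransport Ω f (Q b f)
  /-- The initial condition. -/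
  initial : ∀ᵐ z ∂(volume.restrict (phase Ω)), f (0, z) = f₀ z
  /-- The reflection condition at the boundary: `t ↦ f^♯(t, x, v)` is continuous. -/
  boundary : ∀ᵐ z ∂(volume.restrict (phase Ω)), ContinuousOn (fun t => sharp Ω n f t z) (Ici 0)

/-- `f ∈ L^∞((0, ∞) × Ω × ℝ³)` and `0 ≤ f ≤ 1` almost everywhere. -/
def IsAdmissible (Ω : Set E3) (f : ℝ × E3 × E3 → ℝ) : Prop :=
  MemLp f ⊤ (volume.restrict (timePhase Ω)) ∧
  ∀ᵐ q ∂(volume.restrict (timePhase Ω)), 0 ≤ f q ∧ f q ≤ 1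

end BFD

end

/-!
The collision integral is Lipschitz continuous in the supremum norm on distributions with values in
`[0, 1]`, with a constant proportional to `∫ b`. So along the trajectories of the reflected flow the
problem is an ordinary integral equation with a bounded Lipschitz right-hand side; what has to be
shown is that the flow is good enough for this point of view, and that the weak formulation is
equivalent to the integral equation.

*The flow.* `Reach Ω n t z z'` describes trajectories with finitely many transversal reflections.
Such a trajectory is stable under perturbation (`Reach.stableAt`), reversible (`Reach.reverse`), and
the flow is differentiable there with Jacobian determinant `±1`, a product of linear involutions;
hence it does not increase volume (`volume_flow_preimage_le`). Almost every trajectory has this form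
for all times (`ae_isRegularPoint`): a trajectory of life span `ℓ` is, during the time interval
`(ℓ - h, ℓ)`, in a set of points which are within `O(h)` of the boundary and have a normal velocity
of size `O(h)`, because within the time `h` it is tangent to the boundary or hits it twice. The
volume of this set is `o(h)`, and integration in time shows that the trajectories of finite life
span form a null set.

*Existence.* Picard iteration for the integral equation with the argument of `Q` truncated to
`[0, 1]` converges in a supremum norm with an exponential weight in time (`exists_duhamel_eq`). The
truncation is never active: `Q ≥ 0` where the distribution is `0` and `Q ≤ 0` where it is `1`
(`Reach.mem_Icc_of_duhamel_eq`). The values at boundary points do not matter for the equation, and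
are chosen such that `f^♯` is given by the integral equation at the reflection times as well
(`sharp_representative`); then `f^♯` is Lipschitz continuous in time.

*Weak form and integrated form.* Testing with translates of a test function along the vector field
`(1, v, 0)` turns the equation in the sense of distributions into its integrated form along almost
all free flights (`shift_of_weak`), and conversely (`weak_of_shift`).

*Uniqueness.* For an admissible solution `g`, the function `g^♯` minus the primitive of `Q(g)^♯` is
constant along the free flights of almost every trajectory, and continuous by the reflection
condition; so it is constant (`IsRegularPoint.eq_primitive`). Two solutions of the integral equation
agree by the contraction estimate. Here the estimates hold almost everywhere only, and are
transported by the facts that collisions (`ae_collision`) and the reflected flow (`ae_along_flow`,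
`ae_starting_point`) preserve null sets.

If `Ω` is the whole space, it is a regular domain for the normal field `0`, and the trajectories do
not depend on the normal (`traj_univ`).
-/

open Filter Topology

noncomputable section

namespace BFD

variable {Ω : Set E3} {n : E3 → E3}

/-! ### The boundary and the reflection law -/

/-- A defining function of `Ω` near a boundary point, in the form used below: its differential is a
positive multiple of the inner product with the normal along `∂Ω`. -/
lemma IsRegularDomain.exists_chart (hΩ : IsRegularDomain Ω n) {x : E3} (hx : x ∈ frontier Ω) :
    ∃ (U : Set E3) (φ : E3 → ℝ), IsOpen U ∧ x ∈ U ∧ ContDiffOn ℝ 1 φ U ∧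
      (∀ y ∈ U, (y ∈ Ω ↔ φ y < 0)) ∧ (∀ y ∈ U, y ∈ frontier Ω ↔ φ y = 0) ∧
      (∀ y ∈ U ∩ frontier Ω, ‖n y‖ = 1) ∧
      (∀ y ∈ U ∩ frontier Ω, ∃ κ : ℝ, 0 < κ ∧ ∀ u, fderiv ℝ φ y u = κ * ⟪u, n y⟫) := by
  obtain ⟨U, φ, hU, hxU, hφ, hgrad, hsub, hn⟩ := hΩ.local_graph x hx
  have hd : ∀ y ∈ U, DifferentiableAt ℝ φ y := fun y hy =>
    (hφ.differentiableOn one_ne_zero).differentiableAt (hU.mem_nhds hy)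
  refine ⟨U, φ, hU, hxU, hφ, hsub, fun y hy => ⟨fun h => ?_, fun h => ?_⟩, fun y hy => ?_,
    fun y hy => ?_⟩
  · have h1 : ¬ φ y < 0 := fun h' => by
      have := (hsub y hy).2 h'
      rw [hΩ.isOpen.frontier_eq] at h
      exact h.2 this
    by_contra h2
    have h3 : 0 < φ y := lt_of_le_of_ne (not_lt.1 h1) (Ne.symm h2)
    have h4 : ∀ᶠ p in 𝓝 y, p ∈ U ∧ 0 < φ p :=
      Filter.Eventually.and (hU.mem_nhds hy) ((hd y hy).continuousAt.eventually (lt_mem_nhds h3))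
    have h5 : ∃ᶠ p in 𝓝 y, p ∈ Ω := mem_closure_iff_frequently.1 (frontier_subset_closure h)
    obtain ⟨p, hp, hp'⟩ := (h5.and_eventually h4).exists
    exact absurd ((hsub p hp'.1).1 hp) (not_lt.2 hp'.2.le)
  · rw [hΩ.isOpen.frontier_eq]
    refine ⟨?_, fun h' => absurd ((hsub y hy).1 h') (by simp [h])⟩
    -- moving against the gradient decreases `φ`, so `y` is a limit of points of `Ω`
    have hc : HasDerivAt (fun s : ℝ => φ (y - s • ∇ φ y)) (-‖∇ φ y‖ ^ 2) 0 := by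
      have h1 : HasFDerivAt φ (fderiv ℝ φ y) (y - (0:ℝ) • ∇ φ y) := by
        simpa using (hd y hy).hasFDerivAt
      have h2 : HasDerivAt (fun s : ℝ => y - s • ∇ φ y) (-∇ φ y) 0 := by
        simpa using ((hasDerivAt_id (0:ℝ)).smul_const (∇ φ y)).const_sub y
      have h3 : HasDerivAt (fun s : ℝ => φ (y - s • ∇ φ y)) (fderiv ℝ φ y (-∇ φ y)) 0 :=
        h1.comp_hasDerivAt (0:ℝ) h2
      have h4 : fderiv ℝ φ y (∇ φ y) = ‖∇ φ y‖ ^ 2 := by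
        rw [← real_inner_self_eq_norm_sq, inner_gradient_left]
      simpa [h4] using h3
    have hneg : -‖∇ φ y‖ ^ 2 < 0 := by
      have := norm_pos_iff.2 (hgrad y hy)
      nlinarith
    have h1 : ∀ᶠ s in 𝓝[>] (0:ℝ), φ (y - s • ∇ φ y) < 0 := by
      have := (hasDerivAt_iff_tendsto_slope.1 hc).mono_left
        (nhdsGT_le_nhdsNE 0)
      filter_upwards [this.eventually (gt_mem_nhds hneg), self_mem_nhdsWithin] with s hs hs0
      rw [slope_def_field] at hs
      simp only [zero_smul, sub_zero, h] at hs
      by_contra hcon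
      exact absurd hs (not_lt.2 (div_nonneg (not_lt.1 hcon) (le_of_lt hs0)))
    have h2 : Tendsto (fun s : ℝ => y - s • ∇ φ y) (𝓝[>] 0) (𝓝 y) := by
      have : Continuous (fun s : ℝ => y - s • ∇ φ y) := by fun_prop
      simpa using (this.tendsto 0).mono_left nhdsWithin_le_nhds
    refine mem_closure_of_tendsto h2 ?_
    filter_upwards [h1, h2.eventually (hU.mem_nhds hy)] with s hs hsU
    exact (hsub _ hsU).2 hs
  · rw [hn y hy, norm_smul, norm_inv, norm_norm]
    exact inv_mul_cancel₀ (norm_ne_zero_iff.2 (hgrad y hy.1))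
  · refine ⟨‖∇ φ y‖, norm_pos_iff.2 (hgrad y hy.1), fun u => ?_⟩
    rw [hn y hy, inner_smul_right, ← mul_assoc,
      mul_inv_cancel₀ (norm_ne_zero_iff.2 (hgrad y hy.1)), one_mul, inner_gradient_right]
    simp

lemma IsRegularDomain.norm_normal (hΩ : IsRegularDomain Ω n) {y : E3} (hy : y ∈ frontier Ω) :
    ‖n y‖ = 1 := by
  obtain ⟨U, φ, -, hyU, -, -, -, h, -⟩ := hΩ.exists_chart hy
  exact h y ⟨hyU, hy⟩

lemma inner_reflect_normal {y : E3} (hy : ‖n y‖ = 1) (v : E3) :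
    ⟪reflect n y v, n y⟫ = -⟪v, n y⟫ := by
  simp only [reflect, inner_sub_left, inner_smul_left, real_inner_self_eq_norm_sq, hy]
  simp
  ring

lemma reflect_reflect {y : E3} (hy : ‖n y‖ = 1) (v : E3) :
    reflect n y (reflect n y v) = v := by
  have h := inner_reflect_normal hy v
  rw [reflect, h, reflect]
  module

lemma reflect_neg (y v : E3) : reflect n y (-v) = -reflect n y v := by
  simp only [reflect, inner_neg_left]
  module

lemma norm_reflect {y : E3} (hy : ‖n y‖ = 1) (v : E3) : ‖reflect n y v‖ = ‖v‖ := by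
  have : ‖reflect n y v‖ ^ 2 = ‖v‖ ^ 2 := by
    rw [reflect, norm_sub_sq_real, inner_smul_right, norm_smul, hy, mul_one, Real.norm_eq_abs,
      sq_abs]
    ring
  exact (sq_eq_sq₀ (norm_nonneg _) (norm_nonneg _)).1 this

/-- A line which passes near the boundary point `y₀` with a direction close to the strictly inward
direction `u₀` and issues from a boundary point is in `Ω` for all small positive times, with
uniformity in the base point and the direction. -/
lemma IsRegularDomain.eventually_entering (hΩ : IsRegularDomain Ω n) {y₀ u₀ : E3}
    (hy : y₀ ∈ frontier Ω) (hu : ⟪u₀, n y₀⟫ < 0) :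
    ∀ᶠ p : ℝ × E3 × E3 in 𝓝 (0, y₀, u₀), 0 < p.1 → p.2.1 ∈ frontier Ω →
      p.2.1 + p.1 • p.2.2 ∈ Ω := by
  obtain ⟨U, φ, hU, hyU, hφ, hsub, hfr, -, hder⟩ := hΩ.exists_chart hy
  obtain ⟨κ, hκ, hκ'⟩ := hder y₀ ⟨hyU, hy⟩
  have hcont : ContinuousAt (fun p : E3 × E3 => fderiv ℝ φ p.1 p.2) (y₀, u₀) := by
    have h1 : ContinuousAt (fderiv ℝ φ) y₀ :=
      (hφ.continuousOn_fderiv_of_isOpen hU le_rfl).continuousAt (hU.mem_nhds hyU)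
    have h2 : ContinuousAt (fun p : E3 × E3 => fderiv ℝ φ p.1) (y₀, u₀) :=
      ContinuousAt.comp (x := (y₀, u₀)) (g := fderiv ℝ φ) h1 continuousAt_fst
    exact h2.clm_apply continuousAt_snd
  have hneg : ∀ᶠ p : E3 × E3 in 𝓝 (y₀, u₀), p.1 ∈ U ∧ fderiv ℝ φ p.1 p.2 < 0 := by
    refine (continuousAt_fst.eventually (hU.mem_nhds hyU)).and
      (hcont.eventually (gt_mem_nhds ?_))
    simp only [hκ']
    nlinarith
  obtain ⟨r, hr, hball⟩ := Metric.eventually_nhds_iff_ball.1 hneg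
  have h1 : ∀ᶠ p : ℝ × E3 × E3 in 𝓝 (0, y₀, u₀),
      p.2.1 ∈ Metric.ball y₀ r ∧ p.2.1 + p.1 • p.2.2 ∈ Metric.ball y₀ r ∧
        p.2.2 ∈ Metric.ball u₀ r := by
    refine Filter.Eventually.and ?_ (Filter.Eventually.and ?_ ?_)
    · have : ContinuousAt (fun p : ℝ × E3 × E3 => p.2.1) (0, y₀, u₀) := by fun_prop
      exact this.eventually (Metric.ball_mem_nhds _ hr)
    · have : ContinuousAt (fun p : ℝ × E3 × E3 => p.2.1 + p.1 • p.2.2) (0, y₀, u₀) := by fun_prop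
      exact this.eventually (Metric.isOpen_ball.mem_nhds (by simpa using hr))
    · have : ContinuousAt (fun p : ℝ × E3 × E3 => p.2.2) (0, y₀, u₀) := by fun_prop
      exact this.eventually (Metric.ball_mem_nhds _ hr)
  filter_upwards [h1] with ⟨t, y, u⟩ ⟨hp1, hp2, hp3⟩ ht hyf
  simp only at hp1 hp2 hp3 ht hyf ⊢
  have hseg : ∀ s ∈ Icc 0 t, y + s • u ∈ Metric.ball y₀ r := by
    intro s hs
    have : y + s • u = (1 - s / t) • y + (s / t) • (y + t • u) := by
      rw [smul_add, smul_smul, div_mul_cancel₀ _ ht.ne']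
      module
    rw [this]
    refine convex_ball y₀ r hp1 hp2 ?_ (div_nonneg hs.1 ht.le) (by ring)
    rw [sub_nonneg, div_le_one ht]; exact hs.2
  have hder' : ∀ s ∈ Icc 0 t, HasDerivAt (fun s : ℝ => φ (y + s • u))
      (fderiv ℝ φ (y + s • u) u) s ∧ y + s • u ∈ U ∧ fderiv ℝ φ (y + s • u) u < 0 := by
    intro s hs
    have hh := hball (y + s • u, u) (by
      rw [Metric.mem_ball, Prod.dist_eq]
      exact max_lt (hseg s hs) hp3)
    refine ⟨?_, hh⟩
    have h1 : HasFDerivAt φ (fderiv ℝ φ (y + s • u)) (y + s • u) :=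
      ((hφ.differentiableOn one_ne_zero).differentiableAt (hU.mem_nhds hh.1)).hasFDerivAt
    have h2 : HasDerivAt (fun s : ℝ => y + s • u) u s := by
      simpa using ((hasDerivAt_id s).smul_const u).const_add y
    exact h1.comp_hasDerivAt s h2
  -- the defining function decreases along the line, starting from the value `0`
  have hanti : StrictAntiOn (fun s : ℝ => φ (y + s • u)) (Icc 0 t) := by
    refine strictAntiOn_of_deriv_neg (convex_Icc 0 t)
      (fun s hs => (hder' s hs).1.continuousAt.continuousWithinAt) fun s hs => ?_
    rw [interior_Icc] at hs
    rw [(hder' s (Ioo_subset_Icc_self hs)).1.deriv]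
    exact (hder' s (Ioo_subset_Icc_self hs)).2.2
  have h0 : φ y = 0 := (hfr y (by simpa using (hder' 0 ⟨le_rfl, ht.le⟩).2.1)).1 hyf
  have h2 := hanti (left_mem_Icc.2 ht.le) (right_mem_Icc.2 ht.le) ht
  simp only [zero_smul, add_zero, h0] at h2
  exact (hsub _ (hder' t ⟨ht.le, le_rfl⟩).2.1).2 h2

/-- A line which stays in `Ω` just before meeting the boundary meets it in an outward
direction. -/
lemma IsRegularDomain.inner_normal_nonneg (hΩ : IsRegularDomain Ω n) {y v : E3}
    (hy : y ∈ frontier Ω) {a : ℝ} (ha : 0 < a) (h : ∀ s ∈ Ioo 0 a, y - s • v ∈ Ω) :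
    0 ≤ ⟪v, n y⟫ := by
  by_contra hcon
  push Not at hcon
  obtain ⟨U, φ, hU, hyU, hφ, hsub, hfr, -, hder⟩ := hΩ.exists_chart hy
  obtain ⟨κ, hκ, hκ'⟩ := hder y ⟨hyU, hy⟩
  have hc : HasDerivAt (fun s : ℝ => φ (y - s • v)) (-(κ * ⟪v, n y⟫)) 0 := by
    have h1 : HasFDerivAt φ (fderiv ℝ φ y) (y - (0:ℝ) • v) := by
      simpa using ((hφ.differentiableOn one_ne_zero).differentiableAt
        (hU.mem_nhds hyU)).hasFDerivAt
    have h2 : HasDerivAt (fun s : ℝ => y - s • v) (-v) 0 := by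
      simpa using ((hasDerivAt_id (0:ℝ)).smul_const v).const_sub y
    have h3 : HasDerivAt (fun s : ℝ => φ (y - s • v)) (fderiv ℝ φ y (-v)) 0 :=
      h1.comp_hasDerivAt (0:ℝ) h2
    simpa [hκ'] using h3
  have hpos : 0 < -(κ * ⟪v, n y⟫) := by nlinarith
  have := (hasDerivAt_iff_tendsto_slope.1 hc).mono_left
    (nhdsGT_le_nhdsNE 0)
  have h2 : Tendsto (fun s : ℝ => y - s • v) (𝓝[>] 0) (𝓝 y) := by
    have : Continuous (fun s : ℝ => y - s • v) := by fun_prop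
    simpa using (this.tendsto 0).mono_left nhdsWithin_le_nhds
  have h3 := ((this.eventually (lt_mem_nhds hpos)).and (h2.eventually (hU.mem_nhds hyU))).and
    (Ioo_mem_nhdsGT ha)
  obtain ⟨s, ⟨hs, hsU⟩, hs0⟩ := h3.exists
  have h4 := (hsub _ hsU).1 (h s hs0)
  rw [slope_def_field] at hs
  simp only [zero_smul, sub_zero, (hfr y hyU).1 hy] at hs
  exact absurd hs (not_lt.2 (div_nonpos_of_nonpos_of_nonneg h4.le hs0.1.le))

/-! ### Free flight and hitting times -/

/-- Free flight for the time `t`. -/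
def free (t : ℝ) (z : E3 × E3) : E3 × E3 := (z.1 + t • z.2, z.2)

/-- Reversal of the velocity. -/
def flip (z : E3 × E3) : E3 × E3 := (z.1, -z.2)

@[simp] lemma free_fst (t : ℝ) (z : E3 × E3) : (free t z).1 = z.1 + t • z.2 := rfl

@[simp] lemma free_snd (t : ℝ) (z : E3 × E3) : (free t z).2 = z.2 := rfl

@[simp] lemma free_zero (z : E3 × E3) : free 0 z = z := by simp [free]

lemma free_free (s t : ℝ) (z : E3 × E3) : free s (free t z) = free (t + s) z := by
  simp only [free, Prod.mk.injEq, and_true]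
  module

@[simp] lemma flip_flip (z : E3 × E3) : flip (flip z) = z := by simp [flip]

lemma continuous_free : Continuous fun p : ℝ × E3 × E3 => free p.1 p.2 := by
  unfold free
  fun_prop

lemma continuous_flip : Continuous flip := by
  unfold flip
  fun_prop

/-- A half-line which starts in the open set `Ω` stays there as long as it does not meet the
boundary. -/
lemma line_mem_of_notMem_frontier (hΩ : IsOpen Ω) {x v : E3} {a : ℝ} (hx : x ∈ Ω)
    (h : ∀ s ∈ Ioo 0 a, x + s • v ∉ frontier Ω) {s : ℝ} (hs : s ∈ Ico 0 a) : x + s • v ∈ Ω := by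
  have hpre : IsPreconnected ((fun r : ℝ => x + r • v) '' Icc 0 s) :=
    isPreconnected_Icc.image _ (by fun_prop)
  refine hpre.subset_left_of_subset_union (v := (closure Ω)ᶜ) hΩ isClosed_closure.isOpen_compl
    (Disjoint.mono_left subset_closure disjoint_compl_right) ?_
    ⟨x, (⟨0, ⟨le_rfl, hs.1⟩, by simp⟩ : x ∈ (fun r : ℝ => x + r • v) '' Icc 0 s), hx⟩
    (⟨s, ⟨hs.1, le_rfl⟩, rfl⟩ : x + s • v ∈ (fun r : ℝ => x + r • v) '' Icc 0 s)
  rintro _ ⟨r, hr, rfl⟩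
  rcases hr.1.eq_or_lt with rfl | hr0
  · left; simpa using hx
  · have := h r ⟨hr0, hr.2.trans_lt hs.2⟩
    rw [hΩ.frontier_eq] at this
    by_cases hΩr : x + r • v ∈ Ω
    · exact Or.inl hΩr
    · exact Or.inr fun hc => this ⟨hc, hΩr⟩

lemma notMem_frontier_of_mem (hΩ : IsOpen Ω) {x : E3} (hx : x ∈ Ω) : x ∉ frontier Ω := by
  rw [hΩ.frontier_eq]
  exact fun h => h.2 hx

/-- A half-line issued from a point of `Ω` either stays in `Ω` or has a first meeting point with
the boundary. -/
lemma exists_first_hit (hΩ : IsOpen Ω) {x : E3} (v : E3) (hx : x ∈ Ω) :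
    (∀ s : ℝ, 0 ≤ s → x + s • v ∈ Ω) ∨
      ∃ τ : ℝ, 0 < τ ∧ x + τ • v ∈ frontier Ω ∧ ∀ s ∈ Ico 0 τ, x + s • v ∈ Ω := by
  by_cases hne : ∃ t : ℝ, 0 < t ∧ x + t • v ∈ frontier Ω
  · right
    set A : Set ℝ := {t | 0 ≤ t ∧ x + t • v ∈ frontier Ω} with hA
    have hcl : IsClosed A := by
      refine IsClosed.inter isClosed_Ici (isClosed_frontier.preimage ?_)
      fun_prop
    obtain ⟨t, ht, htf⟩ := hne
    have hbdd : BddBelow A := ⟨0, fun s hs => hs.1⟩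
    have hmem : sInf A ∈ A := hcl.csInf_mem ⟨t, ht.le, htf⟩ hbdd
    have hpos : 0 < sInf A := by
      refine lt_of_le_of_ne hmem.1 fun h0 => ?_
      have := hmem.2
      rw [← h0] at this
      exact notMem_frontier_of_mem hΩ hx (by simpa using this)
    refine ⟨sInf A, hpos, hmem.2, fun s hs =>
      line_mem_of_notMem_frontier hΩ hx (fun r hr hrf => ?_) hs⟩
    exact absurd (csInf_le hbdd ⟨hr.1.le, hrf⟩) (not_le.2 hr.2)
  · left
    push Not at hne
    exact fun s hs => line_mem_of_notMem_frontier (a := s + 1) hΩ hx (fun r hr => hne r hr.1)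
      ⟨hs, by linarith⟩

lemma hitTime_eq_add {z : E3 × E3} {a : ℝ} (ha : 0 ≤ a)
    (h : ∀ s ∈ Ioc 0 a, z.1 + s • z.2 ∉ frontier Ω) :
    hitTime Ω z = ENNReal.ofReal a + hitTime Ω (free a z) := by
  apply le_antisymm
  · simp only [hitTime, ENNReal.add_iInf]
    refine le_iInf₂ fun t ht => ?_
    rw [← ENNReal.ofReal_add ha ht.1.le]
    refine iInf₂_le (a + t) ⟨by linarith [ht.1], ?_⟩
    have := ht.2
    rw [free_fst, free_snd, add_assoc, ← add_smul] at this
    exact this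
  · refine le_iInf₂ fun t ht => ?_
    have hat : a < t := by
      by_contra hcon
      exact h t ⟨ht.1, not_lt.1 hcon⟩ ht.2
    calc ENNReal.ofReal a + hitTime Ω (free a z)
        ≤ ENNReal.ofReal a + ENNReal.ofReal (t - a) := by
          gcongr
          refine iInf₂_le (t - a) ⟨by linarith, ?_⟩
          rw [free_fst, free_snd, add_assoc, ← add_smul]
          simpa using ht.2
      _ = ENNReal.ofReal t := by
          rw [← ENNReal.ofReal_add ha (by linarith)]
          congr 1; ring

lemma hitTime_pos {z : E3 × E3} {a : ℝ} (ha : 0 < a)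
    (h : ∀ s ∈ Ioc 0 a, z.1 + s • z.2 ∉ frontier Ω) : 0 < hitTime Ω z := by
  rw [hitTime_eq_add ha.le h]
  exact lt_of_lt_of_le (ENNReal.ofReal_pos.2 ha) le_self_add

lemma hitTime_eq {z : E3 × E3} {a : ℝ} (ha : 0 < a)
    (h : ∀ s ∈ Ioo 0 a, z.1 + s • z.2 ∉ frontier Ω) (hf : z.1 + a • z.2 ∈ frontier Ω) :
    hitTime Ω z = ENNReal.ofReal a := by
  apply le_antisymm
  · exact iInf₂_le a ⟨ha, hf⟩
  · refine le_iInf₂ fun t ht => ENNReal.ofReal_le_ofReal ?_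
    by_contra hcon
    exact h t ⟨ht.1, not_le.1 hcon⟩ ht.2

/-! ### Semigroup property of the reflected flow -/

/-- The numbers `k` such that the `k`-th reflection of the trajectory of `z` takes place up to the
time `s`. -/
def bounceSet (Ω : Set E3) (n : E3 → E3) (s : ℝ) (z : E3 × E3) : Set ℕ :=
  {k : ℕ | bounceTime Ω n z k ≤ ENNReal.ofReal s}

lemma zero_mem_bounceSet (s : ℝ) (z : E3 × E3) : 0 ∈ bounceSet Ω n s z := by
  simp [bounceSet, bounceTime]

lemma bounceTime_succ' (z : E3 × E3) (k : ℕ) :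
    bounceTime Ω n z (k + 1) = hitTime Ω z + bounceTime Ω n (bounce Ω n z) k := by
  simp only [bounceTime, Finset.sum_range_succ', bounceState, Function.iterate_succ_apply,
    Function.iterate_zero, id]
  rw [add_comm]

lemma bounceState_succ' (z : E3 × E3) (k : ℕ) :
    bounceState Ω n z (k + 1) = bounceState Ω n (bounce Ω n z) k := by
  simp [bounceState]

lemma bounce_free {z : E3 × E3} {a : ℝ} (ha : 0 ≤ a)
    (h : ∀ s ∈ Ioc 0 a, z.1 + s • z.2 ∉ frontier Ω) (hfin : hitTime Ω (free a z) ≠ ⊤) :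
    bounce Ω n (free a z) = bounce Ω n z := by
  have h1 : (hitTime Ω z).toReal = a + (hitTime Ω (free a z)).toReal := by
    rw [hitTime_eq_add ha h, ENNReal.toReal_add ENNReal.ofReal_ne_top hfin,
      ENNReal.toReal_ofReal ha]
  have h2 : (free a z).1 + (hitTime Ω (free a z)).toReal • (free a z).2
      = z.1 + (hitTime Ω z).toReal • z.2 := by
    rw [h1, free_fst, free_snd]; module
  rw [bounce, h2, bounce, free_snd]

lemma bounceTime_free {z : E3 × E3} {a : ℝ} (ha : 0 ≤ a)
    (h : ∀ s ∈ Ioc 0 a, z.1 + s • z.2 ∉ frontier Ω) (k : ℕ) :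
    bounceTime Ω n z (k + 1) = ENNReal.ofReal a + bounceTime Ω n (free a z) (k + 1) := by
  rw [bounceTime_succ', bounceTime_succ', ← add_assoc, ← hitTime_eq_add ha h]
  by_cases hfin : hitTime Ω (free a z) = ⊤
  · simp [hitTime_eq_add ha h, hfin]
  · rw [bounce_free ha h hfin]

lemma bounceSet_free {z : E3 × E3} {a s : ℝ} (ha : 0 ≤ a) (hs : 0 ≤ s)
    (h : ∀ s ∈ Ioc 0 a, z.1 + s • z.2 ∉ frontier Ω) :
    bounceSet Ω n (a + s) z = bounceSet Ω n s (free a z) := by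
  ext k
  cases k with
  | zero => simp [zero_mem_bounceSet]
  | succ k =>
    simp only [bounceSet, mem_ofPred_eq]
    rw [bounceTime_free ha h, ENNReal.ofReal_add ha hs]
    exact ENNReal.add_le_add_iff_left ENNReal.ofReal_ne_top

/-- A free flight before the first reflection can be split off a trajectory. Boundedness of the
number of reflections excludes the conventional value of `traj`. -/
lemma traj_free {z : E3 × E3} {a s : ℝ} (ha : 0 ≤ a) (hs : 0 ≤ s)
    (h : ∀ s ∈ Ioc 0 a, z.1 + s • z.2 ∉ frontier Ω)
    (hb : BddAbove (bounceSet Ω n s (free a z))) :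
    traj Ω n (a + s) z = traj Ω n s (free a z) := by
  have hset := bounceSet_free (n := n) ha hs h
  have hcount : bounceCount Ω n (a + s) z = bounceCount Ω n s (free a z) := by
    change sSup (bounceSet Ω n (a + s) z) = sSup (bounceSet Ω n s (free a z))
    rw [hset]
  simp only [traj, hcount]
  have hmem : bounceCount Ω n s (free a z) ∈ bounceSet Ω n s (free a z) :=
    Nat.sSup_mem ⟨0, zero_mem_bounceSet s _⟩ hb
  cases hk : bounceCount Ω n s (free a z) with
  | zero =>
    simp only [bounceState, Function.iterate_zero, id, bounceTime, Finset.range_zero,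
      Finset.sum_empty, ENNReal.toReal_zero, sub_zero, free_fst, free_snd, Prod.mk.injEq, and_true]
    module
  | succ k =>
    rw [hk] at hmem
    have hfin : bounceTime Ω n (free a z) (k + 1) ≠ ⊤ :=
      ne_top_of_le_ne_top ENNReal.ofReal_ne_top hmem
    have hfin' : hitTime Ω (free a z) ≠ ⊤ := by
      intro h'
      rw [bounceTime_succ', h'] at hfin
      simp at hfin
    rw [bounceTime_free ha h, ENNReal.toReal_add ENNReal.ofReal_ne_top hfin,
      ENNReal.toReal_ofReal ha, bounceState_succ', bounceState_succ', bounce_free ha h hfin',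
      add_sub_add_left_eq_sub]

lemma bounce_eq {z : E3 × E3} {a : ℝ} (ha : 0 < a)
    (h : ∀ s ∈ Ioo 0 a, z.1 + s • z.2 ∉ frontier Ω) (hf : z.1 + a • z.2 ∈ frontier Ω) :
    bounce Ω n z = (z.1 + a • z.2, reflect n (z.1 + a • z.2) z.2) := by
  simp only [bounce, hitTime_eq ha h hf, ENNReal.toReal_ofReal ha.le]

/-- The flight up to the first reflection, and this reflection, can be split off a trajectory. -/
lemma traj_bounce {z : E3 × E3} {a s : ℝ} (ha : 0 < a) (hs : 0 ≤ s)
    (h : ∀ s ∈ Ioo 0 a, z.1 + s • z.2 ∉ frontier Ω) (hf : z.1 + a • z.2 ∈ frontier Ω)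
    (hb : BddAbove (bounceSet Ω n s (bounce Ω n z))) :
    BddAbove (bounceSet Ω n (a + s) z) ∧
      traj Ω n (a + s) z = traj Ω n s (bounce Ω n z) := by
  have htime : ∀ k, bounceTime Ω n z (k + 1) =
      ENNReal.ofReal a + bounceTime Ω n (bounce Ω n z) k := fun k => by
    rw [bounceTime_succ', hitTime_eq ha h hf]
  have hiff : ∀ k, k + 1 ∈ bounceSet Ω n (a + s) z ↔ k ∈ bounceSet Ω n s (bounce Ω n z) := by
    intro k
    simp only [bounceSet, mem_ofPred_eq]
    rw [htime, ENNReal.ofReal_add ha.le hs]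
    exact ENNReal.add_le_add_iff_left ENNReal.ofReal_ne_top
  have hmem : bounceCount Ω n s (bounce Ω n z) ∈ bounceSet Ω n s (bounce Ω n z) :=
    Nat.sSup_mem ⟨0, zero_mem_bounceSet s _⟩ hb
  have hgreat : IsGreatest (bounceSet Ω n (a + s) z) (bounceCount Ω n s (bounce Ω n z) + 1) := by
    refine ⟨(hiff _).2 hmem, fun k hk => ?_⟩
    cases k with
    | zero => simp
    | succ k => exact Nat.succ_le_succ (le_csSup hb ((hiff k).1 hk))
  refine ⟨hgreat.bddAbove, ?_⟩
  have hcount : bounceCount Ω n (a + s) z = bounceCount Ω n s (bounce Ω n z) + 1 :=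
    hgreat.csSup_eq
  have hfin : bounceTime Ω n (bounce Ω n z) (bounceCount Ω n s (bounce Ω n z)) ≠ ⊤ :=
    ne_top_of_le_ne_top ENNReal.ofReal_ne_top hmem
  simp only [traj, hcount, bounceState_succ', htime]
  rw [ENNReal.toReal_add ENNReal.ofReal_ne_top hfin, ENNReal.toReal_ofReal ha.le,
    add_sub_add_left_eq_sub]

lemma bounceSet_zero {z : E3 × E3} (h : 0 < hitTime Ω z) : bounceSet Ω n 0 z = {0} := by
  ext k
  cases k with
  | zero => simp [zero_mem_bounceSet]
  | succ k =>
    simp only [bounceSet, mem_ofPred_eq, ENNReal.ofReal_zero, nonpos_iff_eq_zero, bounceTime_succ',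
      add_eq_zero, mem_singleton_iff, one_ne_zero, and_false, iff_false]
    exact fun h' => h.ne' h'.1

lemma traj_zero {z : E3 × E3} (h : 0 < hitTime Ω z) : traj Ω n 0 z = z := by
  have hcount : bounceCount Ω n 0 z = 0 := by
    change sSup (bounceSet Ω n 0 z) = 0
    rw [bounceSet_zero h]
    simp
  simp [traj, hcount, bounceState, bounceTime]

lemma hitTime_pos_of_mem (hΩ : IsOpen Ω) {z : E3 × E3} (hz : z.1 ∈ Ω) : 0 < hitTime Ω z := by
  rcases exists_first_hit hΩ z.2 hz with h | ⟨τ, hτ, -, h⟩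
  · exact hitTime_pos one_pos fun s hs => notMem_frontier_of_mem hΩ (h s hs.1.le)
  · exact hitTime_pos (half_pos hτ) fun s hs => notMem_frontier_of_mem hΩ
      (h s ⟨hs.1.le, by linarith [hs.2]⟩)

/-! ### Trajectories with finitely many transversal reflections -/

/-- `Reach Ω n t z z'` says that, in the time `t > 0`, the point `z` of phase space is carried into
`z'` through finitely many free flights in `Ω` and reflections at points of `∂Ω` which are hit
transversally; the positions of `z` and `z'` are in `Ω`. -/
inductive Reach (Ω : Set E3) (n : E3 → E3) : ℝ → E3 × E3 → E3 × E3 → Prop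
  | free {t : ℝ} {z : E3 × E3} (ht : 0 < t) (h : ∀ s ∈ Icc 0 t, z.1 + s • z.2 ∈ Ω) :
      Reach Ω n t z (free t z)
  | cross {y v : E3} {a a' : ℝ} (ha : 0 < a) (ha' : 0 < a') (hy : y ∈ frontier Ω)
      (hv : 0 < ⟪v, n y⟫) (h : ∀ s ∈ Ioc 0 a, y - s • v ∈ Ω)
      (h' : ∀ s ∈ Ioc 0 a', y + s • reflect n y v ∈ Ω) :
      Reach Ω n (a + a') (y - a • v, v) (y + a' • reflect n y v, reflect n y v)
  | trans {s t : ℝ} {z z' z'' : E3 × E3} (h : Reach Ω n s z z') (h' : Reach Ω n t z' z'') :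
      Reach Ω n (s + t) z z''

lemma Reach.pos {t : ℝ} {z z' : E3 × E3} (h : Reach Ω n t z z') : 0 < t := by
  induction h with
  | free ht h => exact ht
  | cross ha ha' hy hv h h' => exact add_pos ha ha'
  | trans h h' ih ih' => exact add_pos ih ih'

lemma Reach.mem_left {t : ℝ} {z z' : E3 × E3} (h : Reach Ω n t z z') : z.1 ∈ Ω := by
  induction h with
  | free ht h => simpa using h 0 ⟨le_rfl, ht.le⟩
  | cross ha ha' hy hv h h' => exact h _ ⟨ha, le_rfl⟩
  | trans h h' ih ih' => exact ih

lemma Reach.mem_right {t : ℝ} {z z' : E3 × E3} (h : Reach Ω n t z z') : z'.1 ∈ Ω := by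
  induction h with
  | free ht h => exact h _ ⟨ht.le, le_rfl⟩
  | cross ha ha' hy hv h h' => exact h' _ ⟨ha', le_rfl⟩
  | trans h h' ih ih' => exact ih'

lemma Reach.norm_eq (hΩ : IsRegularDomain Ω n) {t : ℝ} {z z' : E3 × E3} (h : Reach Ω n t z z') :
    ‖z'.2‖ = ‖z.2‖ := by
  induction h with
  | free ht h => rfl
  | cross ha ha' hy hv h h' => exact norm_reflect (hΩ.norm_normal hy) _
  | trans h h' ih ih' => exact ih'.trans ih

lemma Reach.dist_le (hΩ : IsRegularDomain Ω n) {t : ℝ} {z z' : E3 × E3} (h : Reach Ω n t z z') :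
    ‖z'.1 - z.1‖ ≤ t * ‖z.2‖ := by
  induction h with
  | free ht h => simp [norm_smul, abs_of_pos ht]
  | @cross y v a a' ha ha' hy hv h h' =>
    have : y + a' • reflect n y v - (y - a • v) = a' • reflect n y v + a • v := by module
    simp only [this]
    refine (norm_add_le _ _).trans ?_
    rw [norm_smul, norm_smul, norm_reflect (hΩ.norm_normal hy), Real.norm_of_nonneg ha.le,
      Real.norm_of_nonneg ha'.le]
    linarith
  | @trans s t z z' z'' h h' ih ih' =>
    rw [h.norm_eq hΩ] at ih'
    calc ‖z''.1 - z.1‖ = ‖(z''.1 - z'.1) + (z'.1 - z.1)‖ := by congr 1; abel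
      _ ≤ _ := norm_add_le _ _
      _ ≤ (s + t) * ‖z.2‖ := by linarith

/-- Trajectories are reversible. -/
lemma Reach.reverse (hΩ : IsRegularDomain Ω n) {t : ℝ} {z z' : E3 × E3} (h : Reach Ω n t z z') :
    Reach Ω n t (flip z') (flip z) := by
  induction h with
  | @free t z ht h =>
    have h1 : flip z = BFD.free t (flip (BFD.free t z)) := by
      simp [BFD.free, flip]
    rw [h1]
    refine Reach.free ht fun s hs => ?_
    have := h (t - s) ⟨by linarith [hs.2], by linarith [hs.1]⟩
    convert this using 1
    simp only [flip, BFD.free]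
    module
  | @cross y v a a' ha ha' hy hv h h' =>
    have hr : reflect n y (-reflect n y v) = -v := by
      rw [reflect_neg, reflect_reflect (hΩ.norm_normal hy)]
    have key := Reach.cross (Ω := Ω) (n := n) (y := y) (v := -reflect n y v) (a := a') (a' := a)
      ha' ha hy ?_ ?_ ?_
    · rw [hr, smul_neg, smul_neg, sub_neg_eq_add, ← sub_eq_add_neg, add_comm] at key
      exact key
    · rw [inner_neg_left, inner_reflect_normal (hΩ.norm_normal hy)]
      simpa using hv
    · intro s hs
      simpa using h' s hs
    · intro s hs
      rw [hr]
      simpa [sub_eq_add_neg] using h s hs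
  | trans h h' ih ih' =>
    rw [add_comm]
    exact ih'.trans ih

/-- The semigroup property of the reflected flow. The time `s = 0` and boundary points reached after
`z'` are covered as well, since only the number of reflections after `z'` has to be bounded. -/
lemma Reach.traj_add (hΩ : IsOpen Ω) {t : ℝ} {z z' : E3 × E3} (h : Reach Ω n t z z') :
    ∀ s, 0 ≤ s → BddAbove (bounceSet Ω n s z') →
      BddAbove (bounceSet Ω n (t + s) z) ∧ traj Ω n (t + s) z = traj Ω n s z' := by
  induction h with
  | @free t z ht h =>
    intro s hs hb
    have hf : ∀ s ∈ Ioc 0 t, z.1 + s • z.2 ∉ frontier Ω := fun s hs =>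
      notMem_frontier_of_mem hΩ (h s (Ioc_subset_Icc_self hs))
    exact ⟨by rwa [bounceSet_free ht.le hs hf], traj_free ht.le hs hf hb⟩
  | @cross y v a a' ha ha' hy hv h h' =>
    intro s hs hb
    have hf : ∀ s ∈ Ioc 0 a', (y, reflect n y v).1 + s • (y, reflect n y v).2 ∉ frontier Ω :=
      fun s hs => notMem_frontier_of_mem hΩ (h' s hs)
    have hf' : ∀ s ∈ Ioo 0 a, (y - a • v, v).1 + s • (y - a • v, v).2 ∉ frontier Ω := by
      intro s hs
      refine notMem_frontier_of_mem hΩ ?_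
      convert h (a - s) ⟨by linarith [hs.2], by linarith [hs.1]⟩ using 1
      simp only
      module
    have hy' : (y - a • v, v).1 + a • (y - a • v, v).2 ∈ frontier Ω := by simpa using hy
    have hbo : bounce Ω n (y - a • v, v) = (y, reflect n y v) := by
      rw [bounce_eq ha hf' hy']; simp
    have hb1 : BddAbove (bounceSet Ω n (a' + s) (y, reflect n y v)) := by
      rw [bounceSet_free ha'.le hs hf]; exact hb
    have h1 := traj_free (n := n) ha'.le hs hf hb
    have h2 := traj_bounce (n := n) (s := a' + s) ha (by positivity) hf' hy' (by rwa [hbo])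
    rw [hbo, h1] at h2
    rw [add_assoc]
    exact h2
  | @trans t₁ t₂ z z' z'' h h' ih ih' =>
    intro s hs hb
    obtain ⟨h1, h2⟩ := ih' s hs hb
    obtain ⟨h3, h4⟩ := ih (t₂ + s) (by linarith [h'.pos]) h1
    rw [add_assoc]
    exact ⟨h3, h4.trans h2⟩

/-- The relation `Reach` describes the trajectories of the reflected flow. -/
lemma Reach.traj_eq (hΩ : IsOpen Ω) {t : ℝ} {z z' : E3 × E3} (h : Reach Ω n t z z') :
    traj Ω n t z = z' := by
  have hp := hitTime_pos_of_mem hΩ h.mem_right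
  have := (h.traj_add hΩ 0 le_rfl (by rw [bounceSet_zero hp]; simp)).2
  rwa [add_zero, traj_zero hp] at this

lemma Reach.unique (hΩ : IsOpen Ω) {t : ℝ} {z z' z'' : E3 × E3} (h : Reach Ω n t z z')
    (h' : Reach Ω n t z z'') : z' = z'' :=
  (h.traj_eq hΩ).symm.trans (h'.traj_eq hΩ)

lemma Reach.injective (hΩ : IsRegularDomain Ω n) {t : ℝ} {z z' z'' : E3 × E3}
    (h : Reach Ω n t z z'') (h' : Reach Ω n t z' z'') : z = z' := by
  have := (h.reverse hΩ).unique hΩ.isOpen (h'.reverse hΩ)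
  rw [← flip_flip z, this, flip_flip]

/-! ### Stability of transversal trajectories and volume preservation -/

lemma abs_det_eq_one_of_involutive {E : Type*} [AddCommGroup E] [Module ℝ E] (A : E →ₗ[ℝ] E)
    (h : ∀ u, A (A u) = u) : |LinearMap.det A| = 1 := by
  have h1 : A ∘ₗ A = LinearMap.id := LinearMap.ext h
  have h2 : LinearMap.det A * LinearMap.det A = 1 := by
    rw [← LinearMap.det_comp, h1, LinearMap.det_id]
  rcases mul_self_eq_one_iff.1 h2 with h | h <;> simp [h]

/-- The differential of the reflected flow across one reflection preserves volume: `R` is the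
reflection, `N` accounts for the curvature of the boundary, and `a`, `a'` are the flight times
before and after the reflection. The map is a product of linear involutions. -/
lemma abs_det_reflected_flow (R N : E3 →ₗ[ℝ] E3) (hR : ∀ u, R (R u) = u) (a a' : ℝ)
    (L : E3 × E3 →L[ℝ] E3 × E3)
    (hL : ∀ u, L u = (R (u.1 + a • u.2) + a' • (R u.2 + N (u.1 + a • u.2)),
      R u.2 + N (u.1 + a • u.2))) : |L.det| = 1 := by
  have shear : ∀ a : ℝ, ∃ A : E3 × E3 →ₗ[ℝ] E3 × E3, (∀ u, A u = (u.1 + a • u.2, u.2)) ∧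
      |LinearMap.det A| = 1 := by
    intro a
    let J : E3 × E3 →ₗ[ℝ] E3 × E3 := (LinearMap.fst ℝ E3 E3).prod (-LinearMap.snd ℝ E3 E3)
    let K : E3 × E3 →ₗ[ℝ] E3 × E3 :=
      (LinearMap.fst ℝ E3 E3 + a • LinearMap.snd ℝ E3 E3).prod (-LinearMap.snd ℝ E3 E3)
    refine ⟨J ∘ₗ K, fun u => by simp [J, K], ?_⟩
    rw [LinearMap.det_comp, abs_mul, abs_det_eq_one_of_involutive J (fun u => by simp [J]),
      abs_det_eq_one_of_involutive K (fun u => by simp [K]), one_mul]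
  obtain ⟨A, hA, hA'⟩ := shear a
  obtain ⟨A', hA1, hA1'⟩ := shear a'
  let J : E3 × E3 →ₗ[ℝ] E3 × E3 := (R ∘ₗ LinearMap.fst ℝ E3 E3).prod (-R ∘ₗ LinearMap.snd ℝ E3 E3)
  let K : E3 × E3 →ₗ[ℝ] E3 × E3 := (LinearMap.fst ℝ E3 E3).prod
    (-LinearMap.snd ℝ E3 E3 - (R ∘ₗ N) ∘ₗ LinearMap.fst ℝ E3 E3)
  have hcomp : (L : E3 × E3 →ₗ[ℝ] E3 × E3) = A' ∘ₗ J ∘ₗ K ∘ₗ A := by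
    refine LinearMap.ext fun u => ?_
    simp only [ContinuousLinearMap.coe_coe, hL, LinearMap.comp_apply, hA, hA1, J, K,
      LinearMap.prod_apply, Function.prod_apply, LinearMap.fst_apply, LinearMap.snd_apply,
      LinearMap.neg_apply, LinearMap.sub_apply, map_sub, map_neg, hR, neg_sub, sub_neg_eq_add]
    simp [add_comm]
  change |LinearMap.det (L : E3 × E3 →ₗ[ℝ] E3 × E3)| = 1
  rw [hcomp, LinearMap.det_comp, LinearMap.det_comp, LinearMap.det_comp, abs_mul, abs_mul, abs_mul,
    hA', hA1', abs_det_eq_one_of_involutive J (fun u => by simp [J, hR]),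
    abs_det_eq_one_of_involutive K (fun u => by simp [K])]
  norm_num

/-- Near a transversal meeting point of a line with the boundary, the meeting time is a
differentiable function of the line. -/
lemma IsRegularDomain.exists_local_hit (hΩ : IsRegularDomain Ω n) {y v : E3}
    (hy : y ∈ frontier Ω) (hv : 0 < ⟪v, n y⟫) (a : ℝ) :
    ∃ (σ : E3 × E3 → ℝ) (σ' : E3 × E3 →L[ℝ] ℝ), HasFDerivAt σ σ' (y - a • v, v) ∧
      σ (y - a • v, v) = a ∧ (∀ᶠ ζ in 𝓝 (y - a • v, v), ζ.1 + σ ζ • ζ.2 ∈ frontier Ω) ∧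
      ∀ u : E3 × E3, ⟪u.1 + a • u.2 + σ' u • v, n y⟫ = 0 := by
  obtain ⟨U, φ, hU, hyU, hφ, hsub, hfr, -, hder⟩ := hΩ.exists_chart hy
  obtain ⟨κ, hκ, hκ'⟩ := hder y ⟨hyU, hy⟩
  set z : E3 × E3 := (y - a • v, v) with hz
  have hzy : z.1 + a • z.2 = y := by simp [hz]
  set F : (E3 × E3) × ℝ → ℝ := fun p => φ (p.1.1 + p.2 • p.1.2) with hF
  have hφy : ContDiffAt ℝ 1 φ y := hφ.contDiffAt (hU.mem_nhds hyU)
  have hφd : HasFDerivAt φ (fderiv ℝ φ y) y := (hφy.differentiableAt one_ne_zero).hasFDerivAt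
  have hFc : ContDiffAt ℝ 1 F (z, a) := by
    have h1 : ContDiffAt ℝ 1 φ ((z, a).1.1 + (z, a).2 • (z, a).1.2) := by
      simpa only [hzy] using hφy
    refine ContDiffAt.comp (g := φ) (f := fun p : (E3 × E3) × ℝ => p.1.1 + p.2 • p.1.2) (z, a) h1 ?_
    fun_prop
  have hFd : HasFDerivAt F (fderiv ℝ φ y ∘L ((ContinuousLinearMap.fst ℝ E3 E3 ∘L
      ContinuousLinearMap.fst ℝ (E3 × E3) ℝ) + (a • (ContinuousLinearMap.snd ℝ E3 E3 ∘L
      ContinuousLinearMap.fst ℝ (E3 × E3) ℝ) +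
      (ContinuousLinearMap.snd ℝ (E3 × E3) ℝ).smulRight v))) (z, a) := by
    have h1 : HasFDerivAt φ (fderiv ℝ φ y) ((z, a).1.1 + (z, a).2 • (z, a).1.2) := by
      simpa only [hzy] using hφd
    have h2 : HasFDerivAt (fun p : (E3 × E3) × ℝ => p.1) (ContinuousLinearMap.fst ℝ (E3 × E3) ℝ)
      (z, a) := hasFDerivAt_fst
    have h3 : HasFDerivAt (fun p : (E3 × E3) × ℝ => p.2) (ContinuousLinearMap.snd ℝ (E3 × E3) ℝ)
      (z, a) := hasFDerivAt_snd
    exact HasFDerivAt.comp (g := φ) (f := fun p : (E3 × E3) × ℝ => p.1.1 + p.2 • p.1.2) (z, a) h1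
      (h2.fst.add (h3.smul h2.snd))
  have hFv : ∀ s : ℝ, fderiv ℝ F (z, a) (0, s) = s * (κ * ⟪v, n y⟫) := by
    intro s
    rw [hFd.fderiv]
    simp [hκ', inner_smul_left]
    ring
  have hc : κ * ⟪v, n y⟫ ≠ 0 := (mul_pos hκ hv).ne'
  have hinv : (fderiv ℝ F (z, a) ∘L .inr ℝ (E3 × E3) ℝ).IsInvertible := by
    refine ⟨ContinuousLinearEquiv.unitsEquivAut ℝ (Units.mk0 _ hc), ?_⟩
    ext
    simp [hFv]
  -- the implicit function theorem for the equation `φ (x + s • v) = 0` in the unknown `s`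
  have hst := hFc.hasStrictFDerivAt_implicitFunction one_ne_zero hinv
  have hself := hFc.implicitFunction_apply_self one_ne_zero hinv
  have hev := hFc.eventually_apply_implicitFunction one_ne_zero hinv
  set σ := hFc.implicitFunction one_ne_zero hinv with hσ
  simp only at hself hev hst
  have hσd := hst.hasFDerivAt
  set σ' := -(fderiv ℝ F (z, a) ∘L .inr ℝ (E3 × E3) ℝ).inverse ∘L
    (fderiv ℝ F (z, a) ∘L .inl ℝ (E3 × E3) ℝ)
  have hYd : HasFDerivAt (fun ζ : E3 × E3 => ζ.1 + σ ζ • ζ.2)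
      (ContinuousLinearMap.fst ℝ E3 E3 + (a • ContinuousLinearMap.snd ℝ E3 E3 +
        σ'.smulRight v)) z := by
    have := hasFDerivAt_fst (𝕜 := ℝ) (p := z) |>.add (hσd.smul (hasFDerivAt_snd (𝕜 := ℝ) (p := z)))
    rw [hself] at this
    exact this
  have hY0 : z.1 + σ z • z.2 = y := by rw [hself, hzy]
  have hF0 : F (z, a) = 0 := by
    simp only [hF, hzy]
    exact (hfr y hyU).1 hy
  have hUev : ∀ᶠ ζ in 𝓝 z, ζ.1 + σ ζ • ζ.2 ∈ U :=
    hYd.continuousAt.eventually (hU.mem_nhds (by simpa only [hY0] using hyU))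
  refine ⟨σ, σ', hσd, hself, ?_, fun u => ?_⟩
  · filter_upwards [hev, hUev] with ζ h1 h2
    rw [hfr _ h2]
    rw [hF0] at h1
    exact h1
  · have h1 : HasFDerivAt (fun ζ : E3 × E3 => φ (ζ.1 + σ ζ • ζ.2)) _ z :=
      HasFDerivAt.comp (g := φ) z (by simpa only [hY0] using hφd) hYd
    have h2 : (fun ζ : E3 × E3 => φ (ζ.1 + σ ζ • ζ.2)) =ᶠ[𝓝 z] fun _ => 0 := by
      filter_upwards [hev] with ζ h
      rw [hF0] at h
      exact h
    have h3 := h1.unique ((hasFDerivAt_const (0:ℝ) z).congr_of_eventuallyEq h2)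
    have h4 := congrArg (fun A : E3 × E3 →L[ℝ] ℝ => A u) h3
    simp only [ContinuousLinearMap.comp_apply, hκ', zero_apply,
      mul_eq_zero, hκ.ne', false_or] at h4
    rw [add_assoc]
    exact h4

/-- The structural facts on the flow near `(t, z)` proved below: nearby trajectories are transversal
as well, and the flow is continuous in `(t, z)` and differentiable and volume preserving in `z`. -/
def StableAt (Ω : Set E3) (n : E3 → E3) (t : ℝ) (z : E3 × E3) : Prop :=
  (∀ᶠ p : ℝ × E3 × E3 in 𝓝 (t, z), Reach Ω n p.1 p.2 (traj Ω n p.1 p.2)) ∧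
    ContinuousAt (fun p : ℝ × E3 × E3 => traj Ω n p.1 p.2) (t, z) ∧
    ∃ L : E3 × E3 →L[ℝ] E3 × E3, HasFDerivAt (traj Ω n t) L z ∧ |L.det| = 1

lemma StableAt.of_reach (hΩ : IsOpen Ω) {t : ℝ} {z : E3 × E3} (Φ : ℝ × E3 × E3 → E3 × E3)
    (h : ∀ᶠ p : ℝ × E3 × E3 in 𝓝 (t, z), Reach Ω n p.1 p.2 (Φ p)) (hc : ContinuousAt Φ (t, z))
    (L : E3 × E3 →L[ℝ] E3 × E3) (hL : HasFDerivAt (fun ζ => Φ (t, ζ)) L z) (hdet : |L.det| = 1) :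
    StableAt Ω n t z := by
  have heq : (fun p : ℝ × E3 × E3 => traj Ω n p.1 p.2) =ᶠ[𝓝 (t, z)] Φ := by
    filter_upwards [h] with p hp using hp.traj_eq hΩ
  refine ⟨?_, hc.congr heq.symm, L, ?_, hdet⟩
  · filter_upwards [h] with p hp
    rwa [hp.traj_eq hΩ]
  · refine hL.congr_of_eventuallyEq ?_
    have : Tendsto (fun ζ : E3 × E3 => (t, ζ)) (𝓝 z) (𝓝 (t, z)) :=
      Continuous.tendsto (by fun_prop) z
    exact this.eventually heq

/-- Uniformity in the flight time: if a moving point `X p r`, `r ≥ 0`, is in `Ω` for `0 < r ≤ a`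
at `p₀` and enters `Ω` near `r = 0`, then it stays in `Ω` up to times near `a` for `p` near
`p₀`. -/
lemma eventually_forall_segment {P : Type*} [TopologicalSpace P] (hΩ : IsOpen Ω) {p₀ : P}
    {X : P → ℝ → E3} {τ : P → ℝ} (hτ : ContinuousAt τ p₀) (hτ0 : 0 < τ p₀)
    (hX : ∀ r, ContinuousAt (fun q : ℝ × P => X q.2 q.1) (r, p₀))
    (hin : ∀ r ∈ Ioc 0 (τ p₀), X p₀ r ∈ Ω)
    (h0 : ∀ᶠ q : ℝ × P in 𝓝 (0, p₀), 0 < q.1 → X q.2 q.1 ∈ Ω) :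
    ∀ᶠ p in 𝓝 p₀, 0 < τ p ∧ ∀ r ∈ Ioc 0 (τ p), X p r ∈ Ω := by
  -- after rescaling the time to the compact interval `[0, 1]` the tube lemma applies
  have h1 : ∀ᶠ p in 𝓝 p₀, ∀ θ ∈ Icc (0:ℝ) 1, 0 < θ * τ p → X p (θ * τ p) ∈ Ω := by
    refine isCompact_Icc.eventually_forall_of_forall_eventually fun θ hθ => ?_
    have hmap : Tendsto (fun q : P × ℝ => (q.2 * τ q.1, q.1)) (𝓝 (p₀, θ))
        (𝓝 (θ * τ p₀, p₀)) := by
      refine Tendsto.prodMk_nhds ?_ continuousAt_fst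
      have : ContinuousAt (fun q : P × ℝ => τ q.1) (p₀, θ) :=
        ContinuousAt.comp (g := τ) (f := Prod.fst) (x := (p₀, θ)) hτ continuousAt_fst
      have h2 : ContinuousAt (fun q : P × ℝ => q.2) (p₀, θ) := continuousAt_snd
      exact h2.mul this
    rcases hθ.1.eq_or_lt with rfl | hθ0
    · rw [zero_mul] at hmap
      exact hmap.eventually h0
    · have : ∀ᶠ q : ℝ × P in 𝓝 (θ * τ p₀, p₀), X q.2 q.1 ∈ Ω :=
        (hX _).eventually (hΩ.mem_nhds (hin _ ⟨mul_pos hθ0 hτ0,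
          mul_le_of_le_one_left hτ0.le hθ.2⟩))
      filter_upwards [hmap.eventually this] with q hq _ using hq
  filter_upwards [h1, hτ.eventually (lt_mem_nhds hτ0)] with p hp hp0
  refine ⟨hp0, fun r hr => ?_⟩
  have := hp (r / τ p) ⟨div_nonneg hr.1.le hp0.le, (div_le_one hp0).2 hr.2⟩
  rw [div_mul_cancel₀ _ hp0.ne'] at this
  exact this hr.1

lemma stableAt_free (hΩ : IsOpen Ω) {t : ℝ} {z : E3 × E3} (ht : 0 < t)
    (h : ∀ s ∈ Icc 0 t, z.1 + s • z.2 ∈ Ω) : StableAt Ω n t z := by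
  have hz : z.1 ∈ Ω := by simpa using h 0 ⟨le_rfl, ht.le⟩
  have hev : ∀ᶠ p : ℝ × E3 × E3 in 𝓝 (t, z), 0 < p.1 ∧
      ∀ r ∈ Ioc 0 p.1, p.2.1 + r • p.2.2 ∈ Ω := by
    refine eventually_forall_segment (P := ℝ × E3 × E3) (X := fun p r => p.2.1 + r • p.2.2)
      hΩ continuousAt_fst ht (fun r => ?_) (fun r hr => h r ⟨hr.1.le, hr.2⟩) ?_
    · fun_prop
    · have : ContinuousAt (fun q : ℝ × ℝ × E3 × E3 => q.2.2.1 + q.1 • q.2.2.2) (0, t, z) := by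
        fun_prop
      filter_upwards [this.eventually (hΩ.mem_nhds (by simpa using hz))] with q hq _ using hq
  have hz' : ∀ᶠ p : ℝ × E3 × E3 in 𝓝 (t, z), p.2.1 ∈ Ω := by
    have : ContinuousAt (fun p : ℝ × E3 × E3 => p.2.1) (t, z) := by fun_prop
    exact this.eventually (hΩ.mem_nhds hz)
  refine StableAt.of_reach hΩ (fun p => free p.1 p.2) ?_ continuous_free.continuousAt
    ((ContinuousLinearMap.fst ℝ E3 E3 + t • ContinuousLinearMap.snd ℝ E3 E3).prod
      (ContinuousLinearMap.snd ℝ E3 E3)) ?_ ?_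
  · filter_upwards [hev, hz'] with p hp hp'
    refine Reach.free hp.1 fun s hs => ?_
    rcases hs.1.eq_or_lt with rfl | hs0
    · simpa using hp'
    · exact hp.2 s ⟨hs0, hs.2⟩
  · exact ((ContinuousLinearMap.fst ℝ E3 E3 + t • ContinuousLinearMap.snd ℝ E3 E3).prod
      (ContinuousLinearMap.snd ℝ E3 E3)).hasFDerivAt
  · refine abs_det_reflected_flow LinearMap.id 0 (fun u => rfl) t 0 _ fun u => ?_
    simp

lemma stableAt_cross (hΩ : IsRegularDomain Ω n) {y v : E3} {a a' : ℝ} (ha : 0 < a) (ha' : 0 < a')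
    (hy : y ∈ frontier Ω) (hv : 0 < ⟪v, n y⟫) (h : ∀ s ∈ Ioc 0 a, y - s • v ∈ Ω)
    (h' : ∀ s ∈ Ioc 0 a', y + s • reflect n y v ∈ Ω) :
    StableAt Ω n (a + a') (y - a • v, v) := by
  obtain ⟨σ, σ', hσd, hσ0, hσf, hσ'⟩ := hΩ.exists_local_hit hy hv a
  set z : E3 × E3 := (y - a • v, v) with hz
  -- meeting point and reflected velocity as functions of the initial point
  set Y : E3 × E3 → E3 := fun ζ => ζ.1 + σ ζ • ζ.2 with hYdef
  set W : E3 × E3 → E3 := fun ζ => reflect n (Y ζ) ζ.2 with hWdef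
  have hY0 : Y z = y := by
    simp only [hYdef, hσ0]
    simp [hz]
  have hW0 : W z = reflect n y v := by simp only [hWdef, hY0]; rfl
  have hn1 := hΩ.norm_normal hy
  have hvn : ⟪v, n y⟫ ≠ 0 := hv.ne'
  have hYd : HasFDerivAt Y (ContinuousLinearMap.fst ℝ E3 E3 +
      (a • ContinuousLinearMap.snd ℝ E3 E3 + σ'.smulRight v)) z := by
    have := hasFDerivAt_fst (𝕜 := ℝ) (p := z) |>.add (hσd.smul (hasFDerivAt_snd (𝕜 := ℝ) (p := z)))
    rw [hσ0] at this
    exact this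
  set Y' := ContinuousLinearMap.fst ℝ E3 E3 +
      (a • ContinuousLinearMap.snd ℝ E3 E3 + σ'.smulRight v) with hY'
  have hnd : HasFDerivAt n (fderiv ℝ n y) y :=
    (hΩ.contDiff_normal.differentiable one_ne_zero).differentiableAt.hasFDerivAt
  have hnY : HasFDerivAt (fun ζ => n (Y ζ)) (fderiv ℝ n y ∘L Y') z :=
    HasFDerivAt.comp (g := n) z (by rwa [hY0]) hYd
  have hWd : HasFDerivAt W _ z := (hasFDerivAt_snd (𝕜 := ℝ) (p := z)).sub
    (((((hasFDerivAt_snd (𝕜 := ℝ) (p := z)).inner ℝ hnY).const_mul 2)).smul hnY)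
  set W' : E3 × E3 →L[ℝ] E3 := _ with hW'
  replace hWd : HasFDerivAt W W' z := hWd
  set Dn := fderiv ℝ n y with hDn
  have hY'u : ∀ u, Y' u = u.1 + a • u.2 + σ' u • v := fun u => by
    simp [hY', add_assoc]
  have hW'u : ∀ u, W' u = reflect n y u.2 -
      ((2 * ⟪v, Dn (Y' u)⟫) • n y + (2 * ⟪v, n y⟫) • Dn (Y' u)) := by
    intro u
    simp only [hW', hY0, reflect]
    simp [fderivInnerCLM_apply, hz]
    module
  -- the reflection, the projection onto the tangent plane along `v`, and the change of the
  -- reflected velocity which is caused by a displacement of the reflection point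
  let R : E3 →ₗ[ℝ] E3 := IsLinearMap.mk' (reflect n y)
    ⟨fun u w => by simp only [reflect, inner_add_left]; module,
      fun c u => by simp only [reflect, inner_smul_left, RCLike.conj_to_real]; module⟩
  let Pr : E3 →ₗ[ℝ] E3 := IsLinearMap.mk' (fun e : E3 => e - (⟪e, n y⟫ / ⟪v, n y⟫) • v)
    ⟨fun u w => by simp only [inner_add_left]; module,
      fun c u => by simp only [inner_smul_left, RCLike.conj_to_real]; module⟩
  let N₀ : E3 →ₗ[ℝ] E3 := IsLinearMap.mk'
    (fun e : E3 => -((2 * ⟪v, Dn e⟫) • n y + (2 * ⟪v, n y⟫) • Dn e))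
    ⟨fun u w => by simp only [map_add, inner_add_right]; module,
      fun c u => by simp only [map_smul, inner_smul_right]; module⟩
  have hσu : ∀ u : E3 × E3, σ' u = -(⟪u.1 + a • u.2, n y⟫ / ⟪v, n y⟫) := by
    intro u
    have := hσ' u
    rw [inner_add_left, inner_smul_left, RCLike.conj_to_real] at this
    field_simp
    linarith
  have hYP : ∀ u, Y' u = Pr (u.1 + a • u.2) := by
    intro u
    simp only [hY'u, hσu, Pr, IsLinearMap.mk'_apply]
    module
  have hσc := hσd.continuousAt
  have hσp : ContinuousAt (fun p : ℝ × E3 × E3 => σ p.2) (a + a', z) :=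
    ContinuousAt.comp (g := σ) (x := ((a + a', z) : ℝ × E3 × E3)) hσc continuousAt_snd
  have hYp : ContinuousAt (fun p : ℝ × E3 × E3 => Y p.2) (a + a', z) :=
    ContinuousAt.comp (g := Y) (x := ((a + a', z) : ℝ × E3 × E3)) hYd.continuousAt continuousAt_snd
  have hWp : ContinuousAt (fun p : ℝ × E3 × E3 => W p.2) (a + a', z) :=
    ContinuousAt.comp (g := W) (x := ((a + a', z) : ℝ × E3 × E3)) hWd.continuousAt continuousAt_snd
  have hlift : ∀ (r : ℝ) {f : ℝ × E3 × E3 → E3}, ContinuousAt f (a + a', z) →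
      ContinuousAt (fun q : ℝ × ℝ × E3 × E3 => f q.2) (r, a + a', z) := fun r f hf =>
    ContinuousAt.comp (g := f) (x := ((r, a + a', z) : ℝ × ℝ × E3 × E3)) hf continuousAt_snd
  have hvp : ∀ r : ℝ, ContinuousAt (fun q : ℝ × ℝ × E3 × E3 => q.2.2.2) (r, a + a', z) := by
    intro r; fun_prop
  have hfront : ∀ᶠ p : ℝ × E3 × E3 in 𝓝 (a + a', z), Y p.2 ∈ frontier Ω :=
    (continuousAt_snd (p := ((a + a', z) : ℝ × E3 × E3))).eventually hσf
  have hfront' : ∀ r : ℝ, ∀ᶠ q : ℝ × ℝ × E3 × E3 in 𝓝 (r, a + a', z), Y q.2.2 ∈ frontier Ω :=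
    fun r => (continuousAt_snd (p := ((r, a + a', z) : ℝ × ℝ × E3 × E3))).eventually hfront
  -- seen backwards from the meeting point, the incoming piece enters `Ω` with the velocity `-v`
  have hin : ∀ᶠ p : ℝ × E3 × E3 in 𝓝 (a + a', z), 0 < σ p.2 ∧
      ∀ r ∈ Ioc 0 (σ p.2), Y p.2 - r • p.2.2 ∈ Ω := by
    refine eventually_forall_segment (P := ℝ × E3 × E3) (p₀ := (a + a', z))
      (τ := fun p => σ p.2) (X := fun p r => Y p.2 - r • p.2.2) hΩ.isOpen hσp
      (by simpa only [hσ0] using ha) (fun r => ?_) ?_ ?_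
    · exact (hlift r hYp).sub (continuousAt_fst.smul (hvp r))
    · simp only [hσ0, hY0]
      exact h
    · have hent := hΩ.eventually_entering (u₀ := -v) hy (by rw [inner_neg_left]; linarith)
      have hmap : Tendsto (fun q : ℝ × ℝ × E3 × E3 => (q.1, Y q.2.2, -q.2.2.2))
          (𝓝 (0, a + a', z)) (𝓝 (0, y, -v)) := by
        have hneg : ContinuousAt (fun q : ℝ × ℝ × E3 × E3 => -q.2.2.2) (0, a + a', z) := by fun_prop
        have := continuousAt_fst.prodMk ((hlift 0 hYp).prodMk hneg)
        simpa only [ContinuousAt, hY0] using this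
      filter_upwards [hmap.eventually hent, hfront' 0] with q hq hq' hq0
      simpa [sub_eq_add_neg] using hq hq0 hq'
  have hout : ∀ᶠ p : ℝ × E3 × E3 in 𝓝 (a + a', z), 0 < p.1 - σ p.2 ∧
      ∀ r ∈ Ioc 0 (p.1 - σ p.2), Y p.2 + r • W p.2 ∈ Ω := by
    refine eventually_forall_segment (P := ℝ × E3 × E3) (p₀ := (a + a', z))
      (τ := fun p => p.1 - σ p.2) (X := fun p r => Y p.2 + r • W p.2) hΩ.isOpen
      (continuousAt_fst.sub hσp) (by simpa only [hσ0, add_sub_cancel_left] using ha')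
      (fun r => ?_) ?_ ?_
    · exact (hlift r hYp).add (continuousAt_fst.smul (hlift r hWp))
    · simp only [hσ0, hY0, hW0, add_sub_cancel_left]
      exact h'
    · have hent := hΩ.eventually_entering (u₀ := reflect n y v) hy
        (by rw [inner_reflect_normal hn1]; linarith)
      have hmap : Tendsto (fun q : ℝ × ℝ × E3 × E3 => (q.1, Y q.2.2, W q.2.2))
          (𝓝 (0, a + a', z)) (𝓝 (0, y, reflect n y v)) := by
        have := continuousAt_fst.prodMk ((hlift 0 hYp).prodMk (hlift 0 hWp))
        simpa only [ContinuousAt, hY0, hW0] using this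
      filter_upwards [hmap.eventually hent, hfront' 0] with q hq hq' hq0
      exact hq hq0 hq'
  have htrans : ∀ᶠ p : ℝ × E3 × E3 in 𝓝 (a + a', z), 0 < ⟪p.2.2, n (Y p.2)⟫ := by
    have h1 : ContinuousAt (fun p : ℝ × E3 × E3 => n (Y p.2)) (a + a', z) :=
      ContinuousAt.comp (g := n) hΩ.contDiff_normal.continuous.continuousAt hYp
    have h2 : ContinuousAt (fun p : ℝ × E3 × E3 => p.2.2) (a + a', z) := by fun_prop
    exact (h2.inner h1).eventually (lt_mem_nhds (by simpa only [hY0] using hv))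
  -- the derivative of the map from the initial state to the state at the time `a + a'`
  have hdΦ : HasFDerivAt (fun ζ : E3 × E3 => (Y ζ + (a + a' - σ ζ) • W ζ, W ζ))
      ((Y' + (a' • W' + (-σ').smulRight (reflect n y v))).prod W') z := by
    have h1 : HasFDerivAt (fun ζ => a + a' - σ ζ) (-σ') z := hσd.const_sub _
    have h2 := hYd.add (h1.smul hWd)
    simp only [hσ0, hW0, add_sub_cancel_left] at h2
    exact h2.prodMk hWd
  refine StableAt.of_reach hΩ.isOpen
    (fun p => (Y p.2 + (p.1 - σ p.2) • W p.2, W p.2)) ?_ ?_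
    ((Y' + (a' • W' + (-σ').smulRight (reflect n y v))).prod W') hdΦ ?_
  · filter_upwards [hin, hout, htrans, hfront] with p h1 h2 h3 h4
    have key := Reach.cross (Ω := Ω) (n := n) h1.1 h2.1 h4 h3 h1.2 h2.2
    have e1 : σ p.2 + (p.1 - σ p.2) = p.1 := by ring
    have e2 : (Y p.2 - σ p.2 • p.2.2, p.2.2) = p.2 := by simp [hYdef]
    rwa [e1, e2] at key
  · exact (hYp.add ((continuousAt_fst.sub hσp).smul hWp)).prodMk hWp
  · refine abs_det_reflected_flow R (N₀ ∘ₗ Pr) (fun u => reflect_reflect hn1 u) a a' _ fun u => ?_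
    have e1 : W' u = R u.2 + (N₀ ∘ₗ Pr) (u.1 + a • u.2) := by
      rw [LinearMap.comp_apply, ← hYP, hW'u]
      simp only [R, N₀, IsLinearMap.mk'_apply]
      module
    simp only [ContinuousLinearMap.prod_apply, ← e1, Prod.mk.injEq, and_true]
    have e2 : Y' u + σ' u • (-reflect n y v) = R (u.1 + a • u.2) := by
      simp only [hY'u, R, IsLinearMap.mk'_apply, reflect]
      have e3 : σ' u * ⟪v, n y⟫ = -⟪u.1 + a • u.2, n y⟫ := by
        rw [hσu]; field_simp
      have e4 : ⟪u.1 + a • u.2, n y⟫ = -(σ' u * ⟪v, n y⟫) := by rw [e3, neg_neg]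
      rw [e4]
      module
    rw [← e2]
    simp
    module

lemma StableAt.trans (hΩ : IsOpen Ω) {s t : ℝ} {z z' : E3 × E3} (hr : Reach Ω n s z z')
    (h : StableAt Ω n s z) (h' : StableAt Ω n t z') : StableAt Ω n (s + t) z := by
  obtain ⟨h1, h2, L, hL, hdet⟩ := h
  obtain ⟨h1', h2', L', hL', hdet'⟩ := h'
  have hz' := hr.traj_eq hΩ
  have hs : ContinuousAt (traj Ω n s) z := hL.continuousAt
  have hmap : Tendsto (fun p : ℝ × E3 × E3 => (p.1 - s, traj Ω n s p.2)) (𝓝 (s + t, z))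
      (𝓝 (t, z')) := by
    have h3 : ContinuousAt (fun p : ℝ × E3 × E3 => traj Ω n s p.2) (s + t, z) :=
      ContinuousAt.comp (g := traj Ω n s) (x := ((s + t, z) : ℝ × E3 × E3)) hs continuousAt_snd
    have h4 : ContinuousAt (fun p : ℝ × E3 × E3 => p.1 - s) (s + t, z) := by fun_prop
    have := h4.prodMk h3
    simpa only [ContinuousAt, hz', add_sub_cancel_left] using this
  have hslice : Tendsto (fun p : ℝ × E3 × E3 => (s, p.2)) (𝓝 (s + t, z)) (𝓝 (s, z)) := by
    have : ContinuousAt (fun p : ℝ × E3 × E3 => (s, p.2)) (s + t, z) := by fun_prop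
    exact this
  refine StableAt.of_reach hΩ (fun p => traj Ω n (p.1 - s) (traj Ω n s p.2)) ?_ ?_ (L' ∘L L) ?_ ?_
  · filter_upwards [hslice.eventually h1, hmap.eventually h1'] with p hp hp'
    have := hp.trans hp'
    simpa using this
  · obtain ⟨G, hG⟩ : ∃ G : ℝ × E3 × E3 → E3 × E3, G = fun p => traj Ω n p.1 p.2 := ⟨_, rfl⟩
    have e : (fun p : ℝ × E3 × E3 => traj Ω n (p.1 - s) (traj Ω n s p.2)) =
        G ∘ fun p => (p.1 - s, traj Ω n s p.2) := by rw [hG]; rfl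
    rw [e]
    rw [← hG] at h2'
    exact Tendsto.comp (h2'.tendsto.trans_eq (by simp [hz'])) hmap
  · have hL'' : HasFDerivAt (traj Ω n t) L' (traj Ω n s z) := by rw [hz']; exact hL'
    have e : (fun ζ => traj Ω n ((s + t, ζ).1 - s) (traj Ω n s (s + t, ζ).2)) =
        traj Ω n t ∘ traj Ω n s := by
      funext ζ
      rw [Function.comp_apply, add_sub_cancel_left]
    rw [e]
    exact hL''.comp z hL
  · rw [ContinuousLinearMap.det, ContinuousLinearMap.toLinearMap_comp, LinearMap.det_comp, abs_mul]
    have e1 : |LinearMap.det (L : E3 × E3 →ₗ[ℝ] E3 × E3)| = 1 := hdet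
    have e2 : |LinearMap.det (L' : E3 × E3 →ₗ[ℝ] E3 × E3)| = 1 := hdet'
    rw [e1, e2, one_mul]

lemma Reach.stableAt (hΩ : IsRegularDomain Ω n) {t : ℝ} {z z' : E3 × E3} (h : Reach Ω n t z z') :
    StableAt Ω n t z := by
  induction h with
  | free ht h => exact stableAt_free hΩ.isOpen ht h
  | cross ha ha' hy hv h h' => exact stableAt_cross hΩ ha ha' hy hv h h'
  | trans h h' ih ih' => exact StableAt.trans hΩ.isOpen h ih ih'

/-! ### Intermediate times of a trajectory -/

/-- Except for countably many times, a trajectory may be split at a given time. -/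
lemma Reach.countable_not_split {T : ℝ} {z z' : E3 × E3} (h : Reach Ω n T z z') :
    {t ∈ Ioo 0 T | ¬ ∃ z₁, Reach Ω n t z z₁ ∧ Reach Ω n (T - t) z₁ z'}.Countable := by
  induction h with
  | @free T z hT h =>
    convert countable_empty
    ext t
    simp only [mem_sep_iff, mem_empty_iff_false, iff_false, not_and, not_not]
    intro ht
    refine ⟨BFD.free t z, Reach.free ht.1 fun s hs => h s ⟨hs.1, hs.2.trans ht.2.le⟩, ?_⟩
    have : BFD.free T z = BFD.free (T - t) (BFD.free t z) := by rw [free_free]; congr 1; ring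
    rw [this]
    refine Reach.free (by linarith [ht.2]) fun s hs => ?_
    have h1 := h (t + s) ⟨by linarith [hs.1, ht.1], by linarith [hs.2]⟩
    rw [add_smul, ← add_assoc] at h1
    exact h1
  | @cross y v a a' ha ha' hy hv h h' =>
    -- the only exceptional time is that of the reflection, when the position is not in `Ω`
    refine (countable_singleton a).mono fun t ht => ?_
    obtain ⟨ht, hn⟩ := ht
    by_contra hta
    refine hn ?_
    rcases lt_or_gt_of_ne hta with hlt | hgt
    · refine ⟨(y - (a - t) • v, v), ?_, ?_⟩
      · have : (y - (a - t) • v, v) = BFD.free t (y - a • v, v) := by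
          simp only [BFD.free, Prod.mk.injEq, and_true]; module
        rw [this]
        refine Reach.free ht.1 fun s hs => ?_
        convert h (a - s) ⟨by linarith [hs.2], by linarith [hs.1]⟩ using 1
        simp only
        module
      · have := Reach.cross (Ω := Ω) (n := n) (sub_pos.2 hlt) ha' hy hv
          (fun s hs => h s ⟨hs.1, by linarith [hs.2, ht.1]⟩) h'
        convert this using 1
        ring
    · refine ⟨(y + (t - a) • reflect n y v, reflect n y v), ?_, ?_⟩
      · have := Reach.cross (Ω := Ω) (n := n) ha (sub_pos.2 hgt) hy hv h
          (fun s hs => h' s ⟨hs.1, by linarith [hs.2, ht.2]⟩)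
        convert this using 1
        ring
      · have : (y + a' • reflect n y v, reflect n y v) =
            BFD.free (a + a' - t) (y + (t - a) • reflect n y v, reflect n y v) := by
          simp only [BFD.free, Prod.mk.injEq, and_true]; module
        rw [this]
        refine Reach.free (by linarith [ht.2]) fun s hs => ?_
        convert h' (t - a + s) ⟨by linarith [hs.1], by linarith [hs.2]⟩ using 1
        simp only
        module
  | @trans t₁ t₂ z z' z'' h h' ih ih' =>
    refine ((ih.union (ih'.image fun t => t₁ + t)).union (countable_singleton t₁)).mono
      fun t ht => ?_
    obtain ⟨ht, hn⟩ := ht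
    rcases lt_trichotomy t t₁ with hlt | heq | hgt
    · refine Or.inl (Or.inl ⟨⟨ht.1, hlt⟩, fun ⟨z₁, hz₁, hz₁'⟩ => hn ⟨z₁, hz₁, ?_⟩⟩)
      convert hz₁'.trans h' using 1
      ring
    · exact Or.inr heq
    · refine Or.inl (Or.inr ⟨t - t₁, ⟨⟨by linarith, by linarith [ht.2]⟩,
        fun ⟨z₁, hz₁, hz₁'⟩ => hn ⟨z₁, ?_, ?_⟩⟩, by ring⟩)
      · convert h.trans hz₁ using 1
        ring
      · convert hz₁' using 1
        ring

/-- Near a time at which the position is in `Ω`, a trajectory is a free flight. -/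
lemma Reach.eventually_free (hΩ : IsOpen Ω) {t : ℝ} {z z' : E3 × E3} (h : Reach Ω n t z z') :
    ∀ᶠ t' in 𝓝 t, Reach Ω n t' z (BFD.free (t' - t) z') := by
  induction h with
  | @free t z ht h =>
    have hc : ContinuousAt (fun s : ℝ => z.1 + s • z.2) t := by fun_prop
    obtain ⟨ε, hε, hball⟩ := Metric.eventually_nhds_iff_ball.1
      (hc.eventually (hΩ.mem_nhds (h t ⟨ht.le, le_rfl⟩)))
    filter_upwards [Metric.ball_mem_nhds t hε, lt_mem_nhds ht] with t' ht' ht0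
    rw [free_free, add_sub_cancel]
    refine Reach.free ht0 fun s hs => ?_
    rcases le_or_gt s t with hst | hst
    · exact h s ⟨hs.1, hst⟩
    · refine hball s ?_
      rw [Metric.mem_ball, Real.dist_eq, abs_lt] at ht' ⊢
      constructor <;> linarith [hs.2, ht'.2]
  | @cross y v a a' ha ha' hy hv h h' =>
    have hc : ContinuousAt (fun s : ℝ => y + (s - a) • reflect n y v) (a + a') := by fun_prop
    obtain ⟨ε, hε, hball⟩ := Metric.eventually_nhds_iff_ball.1
      (hc.eventually (hΩ.mem_nhds (by simpa using h' a' ⟨ha', le_rfl⟩)))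
    filter_upwards [Metric.ball_mem_nhds (a + a') hε, lt_mem_nhds (show a < a + a' by linarith)]
      with t' ht' ht0
    have := Reach.cross (Ω := Ω) (n := n) (a' := t' - a) ha (sub_pos.2 ht0) hy hv h ?_
    · convert this using 1
      · ring
      · simp only [BFD.free, Prod.mk.injEq, and_true]; module
    · intro s hs
      rcases le_or_gt s a' with hst | hst
      · exact h' s ⟨hs.1, hst⟩
      · have := hball (a + s) (by
          rw [Metric.mem_ball, Real.dist_eq, abs_lt] at ht' ⊢
          constructor <;> linarith [hs.2, ht'.2])
        rwa [add_sub_cancel_left] at this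
  | @trans t₁ t₂ z z' z'' h h' ih ih' =>
    have hc : Tendsto (fun s : ℝ => s - t₁) (𝓝 (t₁ + t₂)) (𝓝 t₂) := by
      have : ContinuousAt (fun s : ℝ => s - t₁) (t₁ + t₂) := by fun_prop
      simpa only [ContinuousAt, add_sub_cancel_left] using this
    filter_upwards [hc.eventually ih'] with t' ht'
    convert h.trans ht' using 1
    · ring
    · congr 1; ring

/-- The part of a trajectory between two times. -/
lemma Reach.sub (hΩ : IsOpen Ω) {t T : ℝ} {z z' z'' : E3 × E3} (h : Reach Ω n t z z')
    (h' : Reach Ω n T z z'') (htT : t < T) : Reach Ω n (T - t) z' z'' := by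
  have hev : ∀ᶠ s in 𝓝[>] t, Reach Ω n s z (BFD.free (s - t) z') ∧ s ∈ Ioo t T ∧
      ∀ r ∈ Icc 0 (s - t), z'.1 + r • z'.2 ∈ Ω := by
    have hc : ContinuousAt (fun r : ℝ => z'.1 + r • z'.2) 0 := by fun_prop
    obtain ⟨ε, hε, hball⟩ := Metric.eventually_nhds_iff_ball.1
      (hc.eventually (hΩ.mem_nhds (by simpa using h.mem_right)))
    filter_upwards [nhdsWithin_le_nhds (h.eventually_free hΩ), Ioo_mem_nhdsGT htT,
      Ioo_mem_nhdsGT (show t < t + ε by linarith)] with s h1 h2 h3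
    refine ⟨h1, h2, fun r hr => hball r ?_⟩
    rw [Metric.mem_ball, Real.dist_eq, sub_zero, abs_of_nonneg hr.1]
    linarith [hr.2, h3.2]
  obtain ⟨u, hu, hsub⟩ := (mem_nhdsGT_iff_exists_Ioo_subset).1 hev
  -- the times just after `t` are uncountable, so the longer trajectory splits at one of them
  have hunc : ¬ (Ioo t u).Countable := by
    rw [← Cardinal.le_aleph0_iff_set_countable, Cardinal.mk_Ioo_real hu]
    exact not_le.2 Cardinal.aleph0_lt_continuum
  obtain ⟨s, hs, hs'⟩ := not_subset.1 fun hcon => hunc (h'.countable_not_split.mono hcon)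
  obtain ⟨h1, h2, h3⟩ := hsub hs
  have h4 : ∃ z₁, Reach Ω n s z z₁ ∧ Reach Ω n (T - s) z₁ z'' := by
    by_contra hcon
    exact hs' ⟨⟨h.pos.trans hs.1, h2.2⟩, hcon⟩
  obtain ⟨z₁, hz₁, hz₁'⟩ := h4
  rw [hz₁.unique hΩ h1] at hz₁'
  convert (Reach.free (Ω := Ω) (n := n) (sub_pos.2 hs.1) h3).trans hz₁' using 1
  ring

lemma bounceSet_mono {s t : ℝ} (h : s ≤ t) (z : E3 × E3) :
    bounceSet Ω n s z ⊆ bounceSet Ω n t z := fun _ hk =>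
  le_trans (show _ ≤ _ from hk) (ENNReal.ofReal_le_ofReal h)

lemma Reach.bddAbove (hΩ : IsOpen Ω) {t : ℝ} {z z' : E3 × E3} (h : Reach Ω n t z z') :
    BddAbove (bounceSet Ω n t z) := by
  have := (h.traj_add hΩ 0 le_rfl (by
    rw [bounceSet_zero (hitTime_pos_of_mem hΩ h.mem_right)]; simp)).1
  rwa [add_zero] at this

/-- At every time, including the reflection times, the trajectory continues by a free flight. -/
lemma Reach.eventually_free_right (hΩ : IsOpen Ω) {T : ℝ} {z z' : E3 × E3}
    (h : Reach Ω n T z z') : ∀ t ∈ Ico 0 T,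
    ∀ᶠ s in 𝓝[>] (0:ℝ), Reach Ω n (t + s) z (BFD.free s (traj Ω n t z)) := by
  induction h with
  | @free T z hT h =>
    intro t ht
    have hz : z.1 ∈ Ω := by simpa using h 0 ⟨le_rfl, hT.le⟩
    have htr : traj Ω n t z = BFD.free t z := by
      rcases ht.1.eq_or_lt with rfl | ht0
      · rw [traj_zero (hitTime_pos_of_mem hΩ hz), free_zero]
      · exact (Reach.free ht0 fun s hs => h s ⟨hs.1, hs.2.trans ht.2.le⟩).traj_eq hΩ
    filter_upwards [Ioo_mem_nhdsGT (sub_pos.2 ht.2)] with s hs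
    rw [htr, free_free]
    exact Reach.free (by linarith [ht.1, hs.1]) fun r hr => h r ⟨hr.1, by linarith [hr.2, hs.2]⟩
  | @cross y v a a' ha ha' hy hv h h' =>
    intro t ht
    rcases lt_or_ge t a with hta | hta
    · have hfree : ∀ r, 0 < r → r < a → Reach Ω n r (y - a • v, v) (BFD.free r (y - a • v, v)) := by
        intro r hr hra
        refine Reach.free hr fun s hs => ?_
        convert h (a - s) ⟨by linarith [hs.2], by linarith [hs.1]⟩ using 1
        simp only
        module
      have htr : traj Ω n t (y - a • v, v) = BFD.free t (y - a • v, v) := by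
        rcases ht.1.eq_or_lt with rfl | ht0
        · rw [traj_zero (hitTime_pos_of_mem hΩ (h a ⟨ha, le_rfl⟩)), free_zero]
        · exact (hfree t ht0 hta).traj_eq hΩ
      filter_upwards [Ioo_mem_nhdsGT (sub_pos.2 hta)] with s hs
      rw [htr, free_free]
      exact hfree _ (by linarith [ht.1, hs.1]) (by linarith [hs.2])
    · have hcross : ∀ r, 0 < r → r < a' → Reach Ω n (a + r) (y - a • v, v)
          (y + r • reflect n y v, reflect n y v) := fun r hr hra =>
        Reach.cross ha hr hy hv h fun s hs => h' s ⟨hs.1, hs.2.trans hra.le⟩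
      have htr : traj Ω n t (y - a • v, v) =
          (y + (t - a) • reflect n y v, reflect n y v) := by
        -- `t = a` is the time of the reflection, where `traj` has its value from the right
        rcases hta.eq_or_lt with rfl | hta0
        · have hf' : ∀ s ∈ Ioo 0 a, (y - a • v, v).1 + s • (y - a • v, v).2 ∉ frontier Ω := by
            intro s hs
            refine notMem_frontier_of_mem hΩ ?_
            convert h (a - s) ⟨by linarith [hs.2], by linarith [hs.1]⟩ using 1
            simp only
            module
          have hy' : (y - a • v, v).1 + a • (y - a • v, v).2 ∈ frontier Ω := by simpa using hy
          have hbo : bounce Ω n (y - a • v, v) = (y, reflect n y v) := by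
            rw [bounce_eq ha hf' hy']; simp
          have hp : 0 < hitTime Ω (y, reflect n y v) :=
            hitTime_pos ha' fun s hs => notMem_frontier_of_mem hΩ (h' s hs)
          have := (traj_bounce (n := n) (s := 0) ha le_rfl hf' hy'
            (by rw [hbo, bounceSet_zero hp]; simp)).2
          rw [add_zero, hbo, traj_zero hp] at this
          rw [this]
          simp
        · have := (hcross (t - a) (sub_pos.2 hta0) (by linarith [ht.2])).traj_eq hΩ
          rwa [add_sub_cancel] at this
      filter_upwards [Ioo_mem_nhdsGT (sub_pos.2 ht.2)] with s hs
      have := hcross (t - a + s) (by linarith [hs.1]) (by linarith [hs.2])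
      rw [htr]
      convert this using 1
      · ring
      · simp only [BFD.free, Prod.mk.injEq, and_true]; module
  | @trans t₁ t₂ z z' z'' h h' ih ih' =>
    intro t ht
    rcases lt_or_ge t t₁ with hlt | hge
    · exact ih t ⟨ht.1, hlt⟩
    · have h1 := ih' (t - t₁) ⟨by linarith, by linarith [ht.2]⟩
      have h2 := (h.traj_add hΩ (t - t₁) (by linarith)
        ((h'.bddAbove hΩ).mono (bounceSet_mono (by linarith [ht.2]) _))).2
      rw [add_sub_cancel] at h2
      rw [h2]
      filter_upwards [h1] with s hs
      convert h.trans hs using 1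
      ring

/-! ### The domain of the flow -/

/-- The set of `(t, z)` such that the trajectory of `z` up to the time `t > 0` has finitely many
reflections, all of them transversal, and is inside `Ω` at the time `t`. -/
def flowDomain (Ω : Set E3) (n : E3 → E3) : Set (ℝ × E3 × E3) :=
  {p | Reach Ω n p.1 p.2 (traj Ω n p.1 p.2)}

lemma Reach.mem_flowDomain (hΩ : IsOpen Ω) {t : ℝ} {z z' : E3 × E3} (h : Reach Ω n t z z') :
    (t, z) ∈ flowDomain Ω n := by
  change Reach Ω n t z (traj Ω n t z)
  rwa [h.traj_eq hΩ]

lemma isOpen_flowDomain (hΩ : IsRegularDomain Ω n) : IsOpen (flowDomain Ω n) :=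
  isOpen_iff_mem_nhds.2 fun _ hp => (hp.stableAt hΩ).1

lemma continuousOn_traj (hΩ : IsRegularDomain Ω n) :
    ContinuousOn (fun p : ℝ × E3 × E3 => traj Ω n p.1 p.2) (flowDomain Ω n) := fun _ hp =>
  (Reach.stableAt hΩ hp).2.1.continuousWithinAt

/-- The reflected flow as a measurable map: the trajectory on the domain of the flow, and `0`
elsewhere. -/
def flow (Ω : Set E3) (n : E3 → E3) (p : ℝ × E3 × E3) : E3 × E3 :=
  open Classical in if p ∈ flowDomain Ω n then traj Ω n p.1 p.2 else 0

lemma Reach.flow_eq (hΩ : IsOpen Ω) {t : ℝ} {z z' : E3 × E3} (h : Reach Ω n t z z') :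
    flow Ω n (t, z) = z' := by
  rw [flow, if_pos (h.mem_flowDomain hΩ)]
  exact h.traj_eq hΩ

lemma flow_eq_of_mem {t : ℝ} {z : E3 × E3} (h : (t, z) ∈ flowDomain Ω n) :
    flow Ω n (t, z) = traj Ω n t z := if_pos h

lemma measurable_flow (hΩ : IsRegularDomain Ω n) : Measurable (flow Ω n) := by
  have h := (isOpen_flowDomain hΩ).measurableSet
  classical
  have := (continuousOn_traj hΩ).measurable_piecewise (g := fun _ => (0 : E3 × E3))
    continuousOn_const h
  convert this using 1
  ext p : 1
  simp only [flow, Set.piecewise]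

instance : (volume : Measure (E3 × E3)).IsAddHaarMeasure := by
  rw [Measure.volume_eq_prod]
  infer_instance

/-- The flow does not increase volume. -/
lemma volume_flow_preimage_le (hΩ : IsRegularDomain Ω n) (t : ℝ) {A : Set (E3 × E3)}
    (hA : MeasurableSet A) :
    volume {z | (t, z) ∈ flowDomain Ω n ∧ flow Ω n (t, z) ∈ A} ≤ volume A := by
  set s : Set (E3 × E3) := {z | (t, z) ∈ flowDomain Ω n ∧ flow Ω n (t, z) ∈ A} with hs
  have hsm : MeasurableSet s := by
    have h1 : Measurable fun z : E3 × E3 => (t, z) := by fun_prop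
    exact (h1 (isOpen_flowDomain hΩ).measurableSet).inter (h1 (measurable_flow hΩ hA))
  have hL : ∀ z : E3 × E3, ∃ L : E3 × E3 →L[ℝ] E3 × E3, z ∈ s →
      HasFDerivAt (traj Ω n t) L z ∧ |L.det| = 1 := by
    intro z
    by_cases hz : z ∈ s
    · obtain ⟨L, hL⟩ := (Reach.stableAt hΩ hz.1).2.2
      exact ⟨L, fun _ => hL⟩
    · exact ⟨0, fun h => absurd h hz⟩
  choose L hL using hL
  have hinj : InjOn (traj Ω n t) s := by
    intro z hz z' hz' heq
    have h1 : Reach Ω n t z (traj Ω n t z) := hz.1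
    have h2 : Reach Ω n t z' (traj Ω n t z') := hz'.1
    rw [← heq] at h2
    exact h1.injective hΩ h2
  -- change of variables for an injective map whose Jacobian determinant is `±1`
  have hvol := lintegral_abs_det_fderiv_eq_addHaar_image volume hsm
    (fun z hz => (hL z hz).1.hasFDerivWithinAt) hinj
  have h1 : ∫⁻ z in s, ENNReal.ofReal |(L z).det| = volume s := by
    rw [setLIntegral_congr_fun hsm (g := fun _ => 1) (fun z hz => by simp [(hL z hz).2])]
    simp
  rw [← h1, hvol]
  refine measure_mono ?_
  rintro _ ⟨z, hz, rfl⟩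
  have := hz.2
  rwa [flow_eq_of_mem hz.1] at this

/-! ### Almost every trajectory has finitely many reflections in finite time -/

/-- If the trajectory of `z` breaks down not later than at the time `h`, then it meets the boundary
before, and either it is tangent there, or it meets the boundary a second time up to the
time `h`. -/
lemma exists_hits_of_breakdown (hΩ : IsRegularDomain Ω n) {z : E3 × E3} (hz : z.1 ∈ Ω) {h : ℝ}
    (hlife : ∀ t, (t, z) ∈ flowDomain Ω n → t ≤ h) :
    ∃ y ∈ frontier Ω, ‖y - z.1‖ ≤ h * ‖z.2‖ ∧ 0 ≤ ⟪z.2, n y⟫ ∧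
      (⟪z.2, n y⟫ = 0 ∨ ∃ y₂ ∈ frontier Ω, ‖y₂ - y‖ ≤ h * ‖z.2‖ ∧
        0 ≤ ⟪reflect n y z.2, n y₂⟫) := by
  have hfree : ∀ r : ℝ, 0 < r → (∀ s ∈ Icc 0 r, z.1 + s • z.2 ∈ Ω) → r ≤ h := fun r hr hs =>
    hlife r ((Reach.free hr hs).mem_flowDomain hΩ.isOpen)
  rcases exists_first_hit hΩ.isOpen z.2 hz with hall | ⟨τ, hτ, hτf, hτΩ⟩
  · have := hfree (|h| + 1) (by positivity) fun s hs => hall s hs.1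
    linarith [le_abs_self h]
  have hτh : τ ≤ h := by
    refine le_of_forall_lt_imp_le_of_dense fun r hr => ?_
    rcases le_or_gt r 0 with h0 | h0
    · exact h0.trans ((half_pos hτ).le.trans (hfree (τ / 2) (half_pos hτ)
        fun s hs => hτΩ s ⟨hs.1, by linarith [hs.2]⟩))
    · exact hfree r h0 fun s hs => hτΩ s ⟨hs.1, hs.2.trans_lt hr⟩
  set y := z.1 + τ • z.2 with hy
  have hback : ∀ s ∈ Ioc 0 τ, y - s • z.2 ∈ Ω := by
    intro s hs
    convert hτΩ (τ - s) ⟨by linarith [hs.2], by linarith [hs.1]⟩ using 1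
    rw [hy]; module
  have hnn : 0 ≤ ⟪z.2, n y⟫ :=
    hΩ.inner_normal_nonneg hτf hτ fun s hs => hback s ⟨hs.1, hs.2.le⟩
  refine ⟨y, hτf, ?_, hnn, ?_⟩
  · rw [hy, add_sub_cancel_left, norm_smul, Real.norm_of_nonneg hτ.le]
    gcongr
  -- a transversal meeting is followed by a reflected piece, which must not survive the time `h`
  rcases hnn.eq_or_lt with h0 | hpos
  · exact Or.inl h0.symm
  right
  set w := reflect n y z.2 with hw
  have hn1 := hΩ.norm_normal hτf
  -- a short piece of the reflected line is inside `Ω`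
  have hent := hΩ.eventually_entering (u₀ := w) hτf (by
    rw [hw, inner_reflect_normal hn1]; linarith)
  have hmap : Tendsto (fun r : ℝ => (r, y, w)) (𝓝[>] 0) (𝓝 (0, y, w)) :=
    ((Continuous.tendsto (by fun_prop) (0:ℝ)).mono_left nhdsWithin_le_nhds)
  obtain ⟨a', ha', hsub⟩ := (mem_nhdsGT_iff_exists_Ioo_subset).1 (hmap.eventually hent)
  have ha'0 : (0:ℝ) < a' := ha'
  have hin : ∀ s ∈ Ioc 0 (a' / 2), y + s • w ∈ Ω := fun s hs =>
    hsub ⟨hs.1, by linarith [hs.2]⟩ hs.1 hτf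
  have hcross := Reach.cross (Ω := Ω) (n := n) hτ (half_pos ha'0) hτf hpos hback hin
  have hzz : (y - τ • z.2, z.2) = z := by simp [hy]
  rw [hzz] at hcross
  set b := a' / 2 with hb
  have hb0 : 0 < b := half_pos ha'0
  have hx₁ : y + b • w ∈ Ω := hin b ⟨hb0, le_rfl⟩
  have hfree' : ∀ r : ℝ, 0 < r → (∀ s ∈ Icc 0 r, (y + b • w) + s • w ∈ Ω) → τ + b + r ≤ h := by
    intro r hr hs
    exact hlife _ ((hcross.trans (Reach.free (z := (y + b • w, w)) hr hs)).mem_flowDomain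
      hΩ.isOpen)
  rcases exists_first_hit hΩ.isOpen w hx₁ with hall | ⟨τ₂, hτ₂, hτ₂f, hτ₂Ω⟩
  · have := hfree' (|h| + 1) (by positivity) fun s hs => hall s hs.1
    linarith [le_abs_self h]
  have hτ₂h : τ₂ ≤ h - τ - b := by
    refine le_of_forall_lt_imp_le_of_dense fun r hr => ?_
    rcases le_or_gt r 0 with h0 | h0
    · have := hfree' (τ₂ / 2) (half_pos hτ₂) fun s hs => hτ₂Ω s ⟨hs.1, by linarith [hs.2]⟩
      linarith
    · have := hfree' r h0 fun s hs => hτ₂Ω s ⟨hs.1, hs.2.trans_lt hr⟩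
      linarith
  refine ⟨_, hτ₂f, ?_, ?_⟩
  · have : y + b • w + τ₂ • w - y = (b + τ₂) • w := by module
    rw [this, norm_smul, hw, norm_reflect hn1, Real.norm_of_nonneg (by positivity)]
    gcongr
    linarith
  · refine hΩ.inner_normal_nonneg hτ₂f hτ₂ fun s hs => ?_
    convert hτ₂Ω (τ₂ - s) ⟨by linarith [hs.2], by linarith [hs.1]⟩ using 1
    module

lemma exists_lipschitz_normal (hΩ : IsRegularDomain Ω n) (R : ℝ) :
    ∃ K : ℝ, 0 ≤ K ∧ ∀ x ∈ Metric.closedBall (0 : E3) R, ∀ y ∈ Metric.closedBall (0 : E3) R,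
      ‖n x - n y‖ ≤ K * ‖x - y‖ := by
  obtain ⟨K, hK⟩ := (isCompact_closedBall (0 : E3) R).exists_bound_of_continuousOn
    (hΩ.contDiff_normal.continuous_fderiv one_ne_zero).continuousOn
  refine ⟨max K 0, le_max_right _ _, fun x hx y hy => ?_⟩
  refine (convex_closedBall (0 : E3) R).norm_image_sub_le_of_norm_fderiv_le (𝕜 := ℝ) (f := n)
    (fun p _ => (hΩ.contDiff_normal.differentiable one_ne_zero).differentiableAt)
    (fun p hp => (hK p hp).trans (le_max_left _ _)) hy hx

/-- The volume of the part of a slab of width `δ` in a ball is `O(δ)`. -/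
lemma volume_slab_le (R : ℝ) : ∃ C : ENNReal, C ≠ ⊤ ∧ ∀ (m : E3) (δ : ℝ), 0 < δ → 1 / 2 ≤ ‖m‖ →
    volume {v : E3 | ‖v‖ ≤ R ∧ |⟪v, m⟫| ≤ δ} ≤ C * ENNReal.ofReal δ := by
  -- about `1 / δ` disjoint translates of the slab fit into a larger ball
  refine ⟨2 * volume (Metric.closedBall (0 : E3) (|R| + 6)), ENNReal.mul_ne_top (by simp)
    measure_closedBall_lt_top.ne, fun m δ hδ hm => ?_⟩
  set s : Set E3 := {v : E3 | ‖v‖ ≤ R ∧ |⟪v, m⟫| ≤ δ} with hs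
  have hm0 : 0 < ‖m‖ := by linarith
  have hsm : MeasurableSet s := by
    have h1 : IsClosed {v : E3 | ‖v‖ ≤ R} := isClosed_le continuous_norm continuous_const
    have h2 : IsClosed {v : E3 | |⟪v, m⟫| ≤ δ} :=
      isClosed_le (continuous_id.inner continuous_const).abs continuous_const
    exact (h1.inter h2).measurableSet
  rcases le_or_gt 1 δ with hδ1 | hδ1
  · calc volume s ≤ volume (Metric.closedBall (0 : E3) (|R| + 6)) := by
          refine measure_mono fun v hv => ?_
          rw [mem_closedBall_zero_iff]
          linarith [hv.1, le_abs_self R]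
      _ ≤ 2 * volume (Metric.closedBall (0 : E3) (|R| + 6)) * 1 := by
          rw [mul_one, two_mul]; exact le_self_add
      _ ≤ _ := by gcongr; exact ENNReal.one_le_ofReal.2 hδ1
  set c : ℝ := 3 * δ / ‖m‖ ^ 2 with hc
  have hcpos : 0 < c := by positivity
  set N : ℕ := ⌊1 / δ⌋₊ with hN
  have hNle : (N : ℝ) ≤ 1 / δ := Nat.floor_le (by positivity)
  have hNge : 1 / δ < N + 1 := Nat.lt_floor_add_one _
  have hN1 : (1:ℝ) ≤ N := by
    have : 1 ≤ N := Nat.le_floor (by rw [Nat.cast_one, le_div_iff₀ hδ]; linarith)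
    exact_mod_cast this
  set S : ℕ → Set E3 := fun j => (fun v => v - (j * c) • m) ⁻¹' s with hS
  have hSvol : ∀ j, volume (S j) = volume s := fun j =>
    (measurePreserving_sub_right volume ((j * c) • m)).measure_preimage hsm.nullMeasurableSet
  have hSm : ∀ j, MeasurableSet (S j) := fun j => (measurable_sub_const _) hsm
  have hinn : ∀ (j : ℕ) (v : E3), v ∈ S j → |⟪v, m⟫ - 3 * δ * j| ≤ δ := by
    intro j v hv
    have := hv.2
    rw [inner_sub_left, inner_smul_left, real_inner_self_eq_norm_sq, RCLike.conj_to_real] at this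
    have e : (j : ℝ) * c * ‖m‖ ^ 2 = 3 * δ * j := by
      rw [hc]; field_simp
    rwa [e] at this
  have hdisj : Pairwise (Function.onFun Disjoint S) := by
    intro i j hij
    rw [Function.onFun, Set.disjoint_left]
    intro v hvi hvj
    have h1 := abs_le.1 (hinn i v hvi)
    have h2 := abs_le.1 (hinn j v hvj)
    rcases lt_or_gt_of_ne hij with h | h
    · have h' : (i : ℝ) + 1 ≤ j := by exact_mod_cast h
      nlinarith
    · have h' : (j : ℝ) + 1 ≤ i := by exact_mod_cast h
      nlinarith
  have hsub : (⋃ j ∈ Finset.range N, S j) ⊆ Metric.closedBall (0 : E3) (|R| + 6) := by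
    intro v hv
    simp only [mem_iUnion, Finset.mem_range] at hv
    obtain ⟨j, hj, hv⟩ := hv
    rw [mem_closedBall_zero_iff]
    have h1 : ‖(j * c) • m‖ ≤ 6 := by
      rw [norm_smul, Real.norm_of_nonneg (by positivity), hc]
      have e : (j : ℝ) * (3 * δ / ‖m‖ ^ 2) * ‖m‖ = 3 * (j * δ) / ‖m‖ := by field_simp
      rw [e, div_le_iff₀ hm0]
      have h2 : (j : ℝ) * δ ≤ 1 := by
        have : (j : ℝ) ≤ 1 / δ := le_trans (by exact_mod_cast hj.le) hNle
        rwa [le_div_iff₀ hδ] at this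
      nlinarith
    calc ‖v‖ = ‖(v - (j * c) • m) + (j * c) • m‖ := by rw [sub_add_cancel]
      _ ≤ ‖v - (j * c) • m‖ + ‖(j * c) • m‖ := norm_add_le _ _
      _ ≤ |R| + 6 := by linarith [hv.1, le_abs_self R]
  have hsum : (N : ENNReal) * volume s ≤ volume (Metric.closedBall (0 : E3) (|R| + 6)) := by
    calc (N : ENNReal) * volume s = ∑ j ∈ Finset.range N, volume (S j) := by
          simp [hSvol]
      _ = volume (⋃ j ∈ Finset.range N, S j) :=
          (measure_biUnion_finset (fun i _ j _ hij => hdisj hij) fun j _ => hSm j).symm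
      _ ≤ _ := measure_mono hsub
  have hone : 1 ≤ 2 * ENNReal.ofReal δ * N := by
    rw [← ENNReal.ofReal_natCast, show (2 : ENNReal) = ENNReal.ofReal 2 by simp,
      ← ENNReal.ofReal_mul (by norm_num), ← ENNReal.ofReal_mul (by positivity),
      ENNReal.one_le_ofReal]
    rw [div_lt_iff₀ hδ] at hNge
    nlinarith
  calc volume s ≤ 2 * ENNReal.ofReal δ * N * volume s := le_mul_of_one_le_left' hone
    _ = 2 * ENNReal.ofReal δ * (N * volume s) := by ring
    _ ≤ 2 * ENNReal.ofReal δ * volume (Metric.closedBall (0 : E3) (|R| + 6)) := by gcongr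
    _ = _ := by ring

/-- The points of phase space near the boundary, at the scale `h`, whose velocity is almost
tangential. -/
def almostGrazing (Ω : Set E3) (n : E3 → E3) (R C h : ℝ) : Set (E3 × E3) :=
  {z | (z.1 ∈ Ω ∩ Metric.closedBall 0 R ∩ Metric.cthickening (R * h) (frontier Ω) ∧
    1 / 2 ≤ ‖n z.1‖) ∧ ‖z.2‖ ≤ R ∧ |⟪z.2, n z.1⟫| ≤ C * h}

lemma measurableSet_almostGrazing (hΩ : IsRegularDomain Ω n) (R C h : ℝ) :
    MeasurableSet (almostGrazing Ω n R C h) := by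
  have hn := hΩ.contDiff_normal.continuous
  have h1 : MeasurableSet {x : E3 | x ∈ Ω ∩ Metric.closedBall 0 R ∩
      Metric.cthickening (R * h) (frontier Ω) ∧ 1 / 2 ≤ ‖n x‖} :=
    ((hΩ.isOpen.measurableSet.inter measurableSet_closedBall).inter
      Metric.isClosed_cthickening.measurableSet).inter
      (isClosed_le continuous_const hn.norm).measurableSet
  have h2 : MeasurableSet {z : E3 × E3 | ‖z.2‖ ≤ R ∧ |⟪z.2, n z.1⟫| ≤ C * h} := by
    have h3 : IsClosed {z : E3 × E3 | ‖z.2‖ ≤ R} :=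
      isClosed_le continuous_snd.norm continuous_const
    have h4 : IsClosed {z : E3 × E3 | |⟪z.2, n z.1⟫| ≤ C * h} :=
      isClosed_le (continuous_snd.inner (hn.comp continuous_fst)).abs continuous_const
    exact (h3.inter h4).measurableSet
  exact (measurable_fst h1).inter h2

lemma volume_almostGrazing_le (hΩ : IsRegularDomain Ω n) (R C : ℝ) (hC : 0 < C) :
    ∃ M : ENNReal, M ≠ ⊤ ∧ ∀ h : ℝ, 0 < h → volume (almostGrazing Ω n R C h) ≤
      M * ENNReal.ofReal h * (volume.restrict (Ω ∩ Metric.closedBall 0 R))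
        (Metric.cthickening (R * h) (frontier Ω)) := by
  obtain ⟨M, hM, hslab⟩ := volume_slab_le R
  refine ⟨M * ENNReal.ofReal C, ENNReal.mul_ne_top hM ENNReal.ofReal_ne_top, fun h hh => ?_⟩
  rw [Measure.volume_eq_prod, Measure.prod_apply (measurableSet_almostGrazing hΩ R C h),
    Measure.restrict_apply Metric.isClosed_cthickening.measurableSet, inter_comm]
  have hX : MeasurableSet (Ω ∩ Metric.closedBall 0 R ∩ Metric.cthickening (R * h) (frontier Ω)) :=
    (hΩ.isOpen.measurableSet.inter measurableSet_closedBall).inter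
      Metric.isClosed_cthickening.measurableSet
  calc ∫⁻ x, volume (Prod.mk x ⁻¹' almostGrazing Ω n R C h)
      ≤ ∫⁻ x, (Ω ∩ Metric.closedBall 0 R ∩ Metric.cthickening (R * h) (frontier Ω)).indicator
          (fun _ => M * ENNReal.ofReal C * ENNReal.ofReal h) x := by
        refine lintegral_mono fun x => ?_
        by_cases hx : x ∈ Ω ∩ Metric.closedBall 0 R ∩ Metric.cthickening (R * h) (frontier Ω) ∧
            1 / 2 ≤ ‖n x‖
        · rw [indicator_of_mem hx.1, mul_assoc, ← ENNReal.ofReal_mul hC.le]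
          exact (measure_mono fun v hv => hv.2).trans (hslab (n x) (C * h) (by positivity) hx.2)
        · have : Prod.mk x ⁻¹' almostGrazing Ω n R C h = ∅ :=
            eq_empty_of_forall_notMem fun v hv => hx hv.1
          rw [this, measure_empty]
          exact zero_le
    _ = _ := by rw [lintegral_indicator hX, setLIntegral_const]

/-- A trajectory which breaks down not later than at the time `h` issues from the almost grazing
set. -/
lemma mem_almostGrazing_of_breakdown (hΩ : IsRegularDomain Ω n) (R : ℝ) (hR : 0 < R) :
    ∃ C h₀ : ℝ, 0 < C ∧ 0 < h₀ ∧ ∀ (z : E3 × E3) (h : ℝ), 0 < h → h ≤ h₀ → z.1 ∈ Ω → ‖z.1‖ ≤ R →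
      ‖z.2‖ ≤ R → (∀ t, (t, z) ∈ flowDomain Ω n → t ≤ h) → z ∈ almostGrazing Ω n R C h := by
  obtain ⟨K, hK, hlip⟩ := exists_lipschitz_normal hΩ (3 * R)
  refine ⟨2 * (K + 1) * R ^ 2, min 1 (1 / (2 * (K + 1) * R)), by positivity, by positivity,
    fun z h hh hh0 hz hzR hvR hlife => ?_⟩
  have hh1 : h ≤ 1 := hh0.trans (min_le_left _ _)
  have hh2 : (K + 1) * (h * R) ≤ 1 / 2 := by
    have := hh0.trans (min_le_right _ _)
    rw [le_div_iff₀ (by positivity)] at this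
    linarith
  obtain ⟨y, hy, hyz, hnn, hcase⟩ := exists_hits_of_breakdown hΩ hz hlife
  have hhR : h * ‖z.2‖ ≤ h * R := by gcongr
  have hhR' : h * R ≤ R := by nlinarith
  have hyR : ‖y‖ ≤ 2 * R := by
    have := norm_add_le (y - z.1) z.1
    rw [sub_add_cancel] at this
    linarith
  have hn1 := hΩ.norm_normal hy
  have hmemz : z.1 ∈ Metric.closedBall (0 : E3) (3 * R) := by
    rw [mem_closedBall_zero_iff]; linarith
  have hmemy : y ∈ Metric.closedBall (0 : E3) (3 * R) := by
    rw [mem_closedBall_zero_iff]; linarith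
  have hnd : ‖n y - n z.1‖ ≤ (K + 1) * (h * R) := by
    refine (hlip y hmemy z.1 hmemz).trans ?_
    have := norm_nonneg (y - z.1)
    nlinarith
  -- the reflected velocity points inward at `y` and outward at `y₂`, and the normals at these two
  -- points differ by `O(h)`
  have hgraze : ⟪z.2, n y⟫ ≤ R * ((K + 1) * (h * R)) := by
    rcases hcase with h0 | ⟨y₂, hy₂, hyy, hw⟩
    · rw [h0]; positivity
    · have h1 : ⟪z.2, n y⟫ ≤ ⟪reflect n y z.2, n y₂ - n y⟫ := by
        rw [inner_sub_right, inner_reflect_normal hn1]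
        linarith
      have hmemy₂ : y₂ ∈ Metric.closedBall (0 : E3) (3 * R) := by
        rw [mem_closedBall_zero_iff]
        have := norm_add_le (y₂ - y) y
        rw [sub_add_cancel] at this
        linarith
      refine h1.trans ((real_inner_le_norm _ _).trans ?_)
      rw [norm_reflect hn1]
      gcongr
      refine (hlip y₂ hmemy₂ y hmemy).trans ?_
      have := norm_nonneg (y₂ - y)
      nlinarith
  refine ⟨⟨⟨⟨hz, by rwa [mem_closedBall_zero_iff]⟩, ?_⟩, ?_⟩, hvR, ?_⟩
  · refine Metric.mem_cthickening_of_dist_le z.1 y _ _ hy ?_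
    rw [dist_eq_norm, norm_sub_rev]
    linarith
  · have := norm_sub_norm_le (n y) (n z.1)
    linarith
  · have h1 : |⟪z.2, n y - n z.1⟫| ≤ R * ((K + 1) * (h * R)) :=
      (abs_real_inner_le_norm _ _).trans (by gcongr)
    rw [inner_sub_right] at h1
    have h2 := abs_le.1 h1
    rw [abs_le]
    constructor <;> nlinarith

/-- A trajectory is inside `Ω`, with finitely many transversal reflections behind it, at all but
countably many times of its life span. -/
lemma countable_notMem_flowDomain (hΩ : IsOpen Ω) (z : E3 × E3) :
    {t | 0 < t ∧ (∃ T, t < T ∧ (T, z) ∈ flowDomain Ω n) ∧ (t, z) ∉ flowDomain Ω n}.Countable := by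
  have hq : ∀ q : ℚ, {t : ℝ | 0 < t ∧ t < q ∧ (∃ T, (q : ℝ) ≤ T ∧ (T, z) ∈ flowDomain Ω n) ∧
      ¬ ∃ z', Reach Ω n t z z'}.Countable := by
    intro q
    by_cases hT : ∃ T, (q : ℝ) ≤ T ∧ (T, z) ∈ flowDomain Ω n
    · obtain ⟨T, hqT, hT⟩ := hT
      have hT' : Reach Ω n T z (traj Ω n T z) := hT
      refine hT'.countable_not_split.mono ?_
      intro t ht
      refine ⟨⟨ht.1, lt_of_lt_of_le ht.2.1 hqT⟩, ?_⟩
      rintro ⟨z₁, hz₁, -⟩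
      exact ht.2.2.2 ⟨z₁, hz₁⟩
    · convert countable_empty
      ext t
      simp only [mem_ofPred_eq, mem_empty_iff_false, iff_false]
      exact fun h => hT h.2.2.1
  refine (countable_iUnion hq).mono fun t ht => ?_
  obtain ⟨ht0, ⟨T, htT, hT⟩, hn⟩ := ht
  obtain ⟨q, hq1, hq2⟩ := exists_rat_btwn htT
  refine mem_iUnion.2 ⟨q, ht0, hq1, ⟨T, hq2.le, hT⟩, ?_⟩
  rintro ⟨z', hz'⟩
  exact hn (hz'.mem_flowDomain hΩ)

lemma measurableSet_flow_preimage (hΩ : IsRegularDomain Ω n) {A : Set (E3 × E3)}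
    (hA : MeasurableSet A) :
    MeasurableSet {p : ℝ × E3 × E3 | p ∈ flowDomain Ω n ∧ flow Ω n p ∈ A} :=
  (isOpen_flowDomain hΩ).measurableSet.inter (measurable_flow hΩ hA)

lemma exists_mem_flowDomain (hΩ : IsOpen Ω) {z : E3 × E3} (hz : z.1 ∈ Ω) :
    ∃ ε > 0, ∀ t ∈ Ioo 0 ε, (t, z) ∈ flowDomain Ω n := by
  have hc : ContinuousAt (fun r : ℝ => z.1 + r • z.2) 0 := by fun_prop
  obtain ⟨ε, hε, hball⟩ := Metric.eventually_nhds_iff_ball.1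
    (hc.eventually (hΩ.mem_nhds (by simpa using hz)))
  refine ⟨ε, hε, fun t ht => Reach.mem_flowDomain hΩ (Reach.free ht.1 fun s hs => ?_)⟩
  refine hball s ?_
  rw [Metric.mem_ball, Real.dist_eq, sub_zero, abs_of_nonneg hs.1]
  linarith [hs.2, ht.2]

/-- The trajectories which break down between the times `δ` and `T`, in a bounded part of phase
space, form a null set: a trajectory with life span `ℓ` spends the time interval `(ℓ - h, ℓ)` in
the almost grazing set, which has the volume `o(h)`, while the flow does not increase volume. -/
lemma volume_breakdown_eq_zero (hΩ : IsRegularDomain Ω n) (R T δ : ℝ) (hR : 0 < R) (hT : 0 < T)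
    (hδ : 0 < δ) :
    volume {z : E3 × E3 | z.1 ∈ Ω ∧ ‖z.1‖ ≤ R ∧ ‖z.2‖ ≤ R ∧
      (∀ t, (t, z) ∈ flowDomain Ω n → t ≤ T) ∧ ∃ t, δ < t ∧ (t, z) ∈ flowDomain Ω n} = 0 := by
  set B := {z : E3 × E3 | z.1 ∈ Ω ∧ ‖z.1‖ ≤ R ∧ ‖z.2‖ ≤ R ∧
      (∀ t, (t, z) ∈ flowDomain Ω n → t ≤ T) ∧ ∃ t, δ < t ∧ (t, z) ∈ flowDomain Ω n} with hB
  set R' := R + T * R with hR'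
  have hR'0 : 0 < R' := by positivity
  have hRR' : R ≤ R' := by nlinarith
  obtain ⟨C, h₀, hC, hh₀, hgraze⟩ := mem_almostGrazing_of_breakdown hΩ R' hR'0
  obtain ⟨M, hM, hvol⟩ := volume_almostGrazing_le hΩ R' C hC
  set μ := volume.restrict (Ω ∩ Metric.closedBall (0 : E3) R') with hμ
  -- Fubini's theorem and Markov's inequality for the time spent in the almost grazing set
  have key : ∀ h : ℝ, 0 < h → h ≤ h₀ → h ≤ δ →
      volume B ≤ ENNReal.ofReal T * M * μ (Metric.cthickening (R' * h) (frontier Ω)) := by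
    intro h hh hh0 hhδ
    have hYm := measurableSet_almostGrazing hΩ R' C h
    set S : Set (ℝ × E3 × E3) :=
      {p | p ∈ flowDomain Ω n ∧ flow Ω n p ∈ almostGrazing Ω n R' C h} with hS
    have hSm : MeasurableSet S := measurableSet_flow_preimage hΩ hYm
    set G : E3 × E3 → ENNReal := fun z => ∫⁻ t in Ioc 0 T, S.indicator 1 (t, z) with hG
    have hSi : Measurable (S.indicator (1 : ℝ × E3 × E3 → ENNReal)) :=
      measurable_one.indicator hSm
    have hGm : Measurable G := by
      exact Measurable.lintegral_prod_left' (f := S.indicator (1 : ℝ × E3 × E3 → ENNReal)) hSi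
    -- a trajectory is almost grazing during the last `h` units of time of its life span `l`
    have hBG : B ⊆ {z | ENNReal.ofReal h ≤ G z} := by
      rintro z ⟨hz, hzR, hvR, hlife, t₁, ht₁, ht₁'⟩
      set A : Set ℝ := {t | (t, z) ∈ flowDomain Ω n} with hA
      have hAb : BddAbove A := ⟨T, fun t ht => hlife t ht⟩
      set l := sSup A with hl
      have hδl : δ < l := ht₁.trans_le (le_csSup hAb ht₁')
      have hlT : l ≤ T := csSup_le ⟨t₁, ht₁'⟩ fun t ht => hlife t ht
      have hmem : ∀ t ∈ Ioo (l - h) l, (t, z) ∈ flowDomain Ω n → (t, z) ∈ S := by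
        intro t ht htE
        refine ⟨htE, ?_⟩
        have hr : Reach Ω n t z (traj Ω n t z) := htE
        rw [flow_eq_of_mem htE]
        have hd := hr.dist_le hΩ
        refine hgraze _ h hh hh0 hr.mem_right ?_ ?_ fun s hs => ?_
        · have h1 := norm_add_le ((traj Ω n t z).1 - z.1) z.1
          rw [sub_add_cancel] at h1
          have h2 : t * ‖z.2‖ ≤ T * R := by
            have := hr.pos
            gcongr
            linarith [ht.2]
          linarith
        · rw [hr.norm_eq hΩ]; linarith
        · have h1 : t + s ≤ l := le_csSup hAb ((hr.trans hs).mem_flowDomain hΩ.isOpen)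
          linarith [ht.1]
      have hae : ∀ᵐ t ∂(volume.restrict (Ioo (l - h) l)), S.indicator (1 : ℝ × E3 × E3 → ENNReal)
          (t, z) = 1 := by
        rw [ae_restrict_iff' measurableSet_Ioo]
        filter_upwards [(countable_notMem_flowDomain (n := n) hΩ.isOpen z).ae_notMem volume]
          with t ht htl
        have htE : (t, z) ∈ flowDomain Ω n := by
          by_contra hcon
          obtain ⟨T', hT', hT''⟩ := exists_lt_of_lt_csSup ⟨t₁, ht₁'⟩ htl.2
          exact ht ⟨by linarith [htl.1], ⟨T', hT'', hT'⟩, hcon⟩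
        exact indicator_of_mem (hmem t htl htE) _
      calc ENNReal.ofReal h = ∫⁻ t in Ioo (l - h) l, 1 := by
            simp [Real.volume_Ioo]
        _ = ∫⁻ t in Ioo (l - h) l, S.indicator 1 (t, z) :=
            lintegral_congr_ae (hae.mono fun t ht => ht.symm)
        _ ≤ G z := lintegral_mono_set fun t ht => ⟨by linarith [ht.1], ht.2.le.trans hlT⟩
    have hslice : ∀ t, ∫⁻ z, S.indicator (1 : ℝ × E3 × E3 → ENNReal) (t, z) ≤
        volume (almostGrazing Ω n R' C h) := by
      intro t
      have h1 : MeasurableSet {z : E3 × E3 | (t, z) ∈ S} :=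
        (measurable_prodMk_left : Measurable (Prod.mk t)) hSm
      have h2 : ∫⁻ z, S.indicator (1 : ℝ × E3 × E3 → ENNReal) (t, z) =
          volume {z : E3 × E3 | (t, z) ∈ S} := by
        rw [← lintegral_indicator_one h1]
        rfl
      rw [h2]
      exact volume_flow_preimage_le hΩ t hYm
    have hint : ∫⁻ z, G z ≤ ENNReal.ofReal T * volume (almostGrazing Ω n R' C h) := by
      calc ∫⁻ z, G z = ∫⁻ t in Ioc 0 T, ∫⁻ z, S.indicator (1 : ℝ × E3 × E3 → ENNReal) (t, z) := by
            rw [lintegral_lintegral_swap]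
            exact (hSi.comp measurable_swap).aemeasurable
        _ ≤ ∫⁻ t in Ioc 0 T, volume (almostGrazing Ω n R' C h) := lintegral_mono hslice
        _ = _ := by
            rw [setLIntegral_const, Real.volume_Ioc, sub_zero, mul_comm]
    have hmarkov : ENNReal.ofReal h * volume B ≤ ∫⁻ z, G z :=
      (mul_le_mul_right (measure_mono hBG) _).trans (mul_meas_ge_le_lintegral hGm _)
    have hfin : ENNReal.ofReal h * volume B ≤ ENNReal.ofReal h *
        (ENNReal.ofReal T * M * μ (Metric.cthickening (R' * h) (frontier Ω))) := by
      refine (hmarkov.trans (hint.trans (mul_le_mul_right (hvol h hh) _))).trans_eq ?_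
      ring
    exact (ENNReal.mul_le_mul_iff_right (ENNReal.ofReal_pos.2 hh).ne' ENNReal.ofReal_ne_top).1 hfin
  -- the neighbourhoods of `∂Ω` inside `Ω` shrink to the empty set
  have hlim : Tendsto (fun h : ℝ => ENNReal.ofReal T * M *
      μ (Metric.cthickening (R' * h) (frontier Ω))) (𝓝[>] 0) (𝓝 0) := by
    have h1 : Tendsto (fun r => μ (Metric.cthickening r (frontier Ω))) (𝓝 0)
        (𝓝 (μ (frontier Ω))) := by
      refine tendsto_measure_cthickening_of_isClosed ⟨1, one_pos, ?_⟩ isClosed_frontier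
      refine ((measure_mono (subset_univ _)).trans_lt ?_).ne
      rw [hμ, Measure.restrict_apply_univ]
      exact (measure_mono inter_subset_right).trans_lt measure_closedBall_lt_top
    have h2 : μ (frontier Ω) = 0 := by
      rw [hμ, Measure.restrict_apply isClosed_frontier.measurableSet]
      convert measure_empty (μ := (volume : Measure E3))
      rw [hΩ.isOpen.frontier_eq]
      ext x
      simp only [mem_inter_iff, Set.mem_sdiff, mem_empty_iff_false, iff_false]
      tauto
    have h3 : Tendsto (fun h : ℝ => R' * h) (𝓝[>] 0) (𝓝 0) := by
      have : Tendsto (fun h : ℝ => R' * h) (𝓝 0) (𝓝 (R' * 0)) :=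
        (continuous_const_mul R').tendsto 0
      rw [mul_zero] at this
      exact this.mono_left nhdsWithin_le_nhds
    have h4 := ENNReal.Tendsto.const_mul (h1.comp h3) (a := ENNReal.ofReal T * M)
      (Or.inr (ENNReal.mul_ne_top ENNReal.ofReal_ne_top hM))
    rw [h2, mul_zero] at h4
    exact h4
  refine le_antisymm (ge_of_tendsto hlim ?_) zero_le
  filter_upwards [Ioo_mem_nhdsGT (lt_min hh₀ hδ)] with h hh
  exact key h hh.1 (hh.2.le.trans (min_le_left _ _)) (hh.2.le.trans (min_le_right _ _))

lemma ae_phase_iff (hΩ : IsOpen Ω) {p : E3 × E3 → Prop} :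
    (∀ᵐ z ∂(volume.restrict (phase Ω)), p z) ↔ ∀ᵐ z : E3 × E3, z.1 ∈ Ω → p z := by
  rw [phase, ae_restrict_iff' (hΩ.measurableSet.prod MeasurableSet.univ)]
  simp

/-- The trajectory of `z` has finitely many reflections in every bounded time interval, and all of
them are transversal. -/
def IsRegularPoint (Ω : Set E3) (n : E3 → E3) (z : E3 × E3) : Prop :=
  z.1 ∈ Ω ∧ ∀ T : ℝ, ∃ t, T < t ∧ (t, z) ∈ flowDomain Ω n

/-- Almost every point of phase space is regular. -/
theorem ae_isRegularPoint (hΩ : IsRegularDomain Ω n) :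
    ∀ᵐ z : E3 × E3, z.1 ∈ Ω → IsRegularPoint Ω n z := by
  have h : ∀ i j k : ℕ, ∀ᵐ z : E3 × E3, ¬ (z.1 ∈ Ω ∧ ‖z.1‖ ≤ (i + 1 : ℝ) ∧ ‖z.2‖ ≤ (i + 1 : ℝ) ∧
      (∀ t, (t, z) ∈ flowDomain Ω n → t ≤ (j + 1 : ℝ)) ∧
        ∃ t, 1 / (k + 1 : ℝ) < t ∧ (t, z) ∈ flowDomain Ω n) := fun i j k => by
    have := volume_breakdown_eq_zero hΩ (i + 1) (j + 1) (1 / (k + 1 : ℝ)) (by positivity)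
      (by positivity) (by positivity)
    rw [ae_iff]
    simpa only [not_not] using this
  filter_upwards [ae_all_iff.2 fun i => ae_all_iff.2 fun j => ae_all_iff.2 (h i j)] with z hz hzΩ
  refine ⟨hzΩ, fun T => ?_⟩
  by_contra hcon
  push Not at hcon
  obtain ⟨i, hi⟩ := exists_nat_ge (max ‖z.1‖ ‖z.2‖)
  obtain ⟨j, hj⟩ := exists_nat_ge T
  obtain ⟨ε, hε, hε'⟩ := exists_mem_flowDomain (n := n) hΩ.isOpen hzΩ
  obtain ⟨k, hk⟩ := exists_nat_one_div_lt (half_pos hε)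
  refine hz i j k ⟨hzΩ, by linarith [le_max_left ‖z.1‖ ‖z.2‖],
    by linarith [le_max_right ‖z.1‖ ‖z.2‖], fun t ht => ?_, ε / 2, hk,
    hε' _ ⟨half_pos hε, by linarith⟩⟩
  by_contra hlt
  exact hcon t (by linarith) ht

/-! ### Null sets and the flow -/

lemma measurePreserving_flip : MeasurePreserving flip (volume : Measure (E3 × E3)) volume := by
  rw [Measure.volume_eq_prod]
  exact (MeasurePreserving.id volume).prod (Measure.measurePreserving_neg volume)

lemma ae_timePhase_iff (hΩ : IsOpen Ω) {p : ℝ × E3 × E3 → Prop} :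
    (∀ᵐ q ∂(volume.restrict (timePhase Ω)), p q) ↔
      ∀ᵐ q : ℝ × E3 × E3, 0 < q.1 → q.2.1 ∈ Ω → p q := by
  rw [timePhase, phase, ae_restrict_iff' (measurableSet_Ioi.prod
    (hΩ.measurableSet.prod MeasurableSet.univ))]
  simp

lemma isOpen_timePhase (hΩ : IsOpen Ω) : IsOpen (timePhase Ω) :=
  isOpen_Ioi.prod (hΩ.prod isOpen_univ)

lemma mem_timePhase {q : ℝ × E3 × E3} : q ∈ timePhase Ω ↔ 0 < q.1 ∧ q.2.1 ∈ Ω := by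
  simp [timePhase, phase]

/-- A property which holds almost everywhere in `(0, ∞) × Ω × ℝ³` holds at almost all times along
almost all trajectories. -/
lemma ae_along_flow (hΩ : IsRegularDomain Ω n) {P : ℝ × E3 × E3 → Prop}
    (hP : ∀ᵐ q ∂(volume.restrict (timePhase Ω)), P q) :
    ∀ᵐ z : E3 × E3, ∀ᵐ t : ℝ, (t, z) ∈ flowDomain Ω n → P (t, traj Ω n t z) := by
  rw [ae_timePhase_iff hΩ.isOpen] at hP
  obtain ⟨N, hN, hNm, hN0⟩ := exists_measurable_superset_of_null (ae_iff.1 hP)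
  set S : Set (ℝ × E3 × E3) := {p | p ∈ flowDomain Ω n ∧ (p.1, flow Ω n p) ∈ N} with hS
  have hSm : MeasurableSet S := (isOpen_flowDomain hΩ).measurableSet.inter
    ((measurable_fst.prodMk (measurable_flow hΩ)) hNm)
  have h1 : ∀ᵐ t : ℝ, ∀ᵐ z : E3 × E3, (t, z) ∉ S := by
    have h2 : ∀ᵐ t : ℝ, volume (Prod.mk t ⁻¹' N) = 0 := by
      rw [Measure.volume_eq_prod, Measure.measure_prod_null hNm] at hN0
      exact hN0
    filter_upwards [h2] with t ht
    have h3 := volume_flow_preimage_le hΩ t (measurable_prodMk_left (x := t) hNm)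
    rw [ht, nonpos_iff_eq_zero] at h3
    rw [ae_iff]
    simp only [not_not]
    exact h3
  have h2 : ∀ᵐ z : E3 × E3, ∀ᵐ t : ℝ, (t, z) ∉ S :=
    (Measure.ae_ae_comm (p := fun t z => (t, z) ∉ S) hSm.compl).1 h1
  filter_upwards [h2] with z hz
  filter_upwards [hz] with t ht hE
  by_contra hcon
  refine ht ⟨hE, ?_⟩
  rw [flow_eq_of_mem hE]
  have hr : Reach Ω n t z (traj Ω n t z) := hE
  exact hN fun h => hcon (h hr.pos hr.mem_right)

lemma IsRegularPoint.ae_mem_flowDomain (hΩ : IsOpen Ω) {z : E3 × E3} (hz : IsRegularPoint Ω n z) :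
    ∀ᵐ t : ℝ, 0 < t → (t, z) ∈ flowDomain Ω n := by
  filter_upwards [(countable_notMem_flowDomain (n := n) hΩ z).ae_notMem volume] with t ht ht0
  by_contra hcon
  obtain ⟨T, hT, hT'⟩ := hz.2 t
  exact ht ⟨ht0, ⟨T, hT, hT'⟩, hcon⟩

/-- Almost every point of `(0, ∞) × Ω × ℝ³` can be followed backwards to the time `0`. -/
lemma ae_flip_mem_flowDomain (hΩ : IsRegularDomain Ω n) :
    ∀ᵐ q ∂(volume.restrict (timePhase Ω)), (q.1, flip q.2) ∈ flowDomain Ω n := by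
  rw [ae_timePhase_iff hΩ.isOpen]
  have hE : MeasurableSet {q : ℝ × E3 × E3 | 0 < q.1 → q.2.1 ∈ Ω →
      (q.1, flip q.2) ∈ flowDomain Ω n} := by
    have h1 : MeasurableSet {q : ℝ × E3 × E3 | (q.1, flip q.2) ∈ flowDomain Ω n} :=
      (measurable_fst.prodMk (continuous_flip.measurable.comp measurable_snd))
        (isOpen_flowDomain hΩ).measurableSet
    have h2 : MeasurableSet {q : ℝ × E3 × E3 | 0 < q.1} := measurable_fst measurableSet_Ioi
    have h3 : MeasurableSet {q : ℝ × E3 × E3 | q.2.1 ∈ Ω} :=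
      (measurable_fst.comp measurable_snd) hΩ.isOpen.measurableSet
    exact h2.imp (h3.imp h1)
  have h1 : ∀ᵐ z : E3 × E3, ∀ᵐ t : ℝ, 0 < t → z.1 ∈ Ω → (t, flip z) ∈ flowDomain Ω n := by
    have h2 := measurePreserving_flip.quasiMeasurePreserving.ae (ae_isRegularPoint hΩ)
    filter_upwards [h2] with z hz
    by_cases hzΩ : z.1 ∈ Ω
    · filter_upwards [(hz hzΩ).ae_mem_flowDomain hΩ.isOpen] with t ht ht0 _ using ht ht0
    · exact Eventually.of_forall fun t _ h => absurd h hzΩ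
  rw [Measure.volume_eq_prod, Measure.ae_prod_iff_ae_ae hE]
  exact (Measure.ae_ae_comm (p := fun t z => (t, z) ∈ {q : ℝ × E3 × E3 | 0 < q.1 → q.2.1 ∈ Ω →
      (q.1, flip q.2) ∈ flowDomain Ω n}) hE).2 h1

/-- A property of almost all starting points is a property of the starting points of the
trajectories through almost all points of `(0, ∞) × Ω × ℝ³`. -/
lemma ae_starting_point (hΩ : IsRegularDomain Ω n) {P : E3 × E3 → Prop}
    (hP : ∀ᵐ z : E3 × E3, z.1 ∈ Ω → P z) :
    ∀ᵐ q ∂(volume.restrict (timePhase Ω)), ∃ z, P z ∧ Reach Ω n q.1 z q.2 := by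
  obtain ⟨N, hN, hNm, hN0⟩ := exists_measurable_superset_of_null (ae_iff.1 hP)
  set S : Set (ℝ × E3 × E3) :=
    {p | (p.1, flip p.2) ∈ flowDomain Ω n ∧ flip (flow Ω n (p.1, flip p.2)) ∈ N} with hS
  have hf : Measurable fun p : ℝ × E3 × E3 => (p.1, flip p.2) :=
    measurable_fst.prodMk (continuous_flip.measurable.comp measurable_snd)
  have hSm : MeasurableSet S := (hf (isOpen_flowDomain hΩ).measurableSet).inter
    ((continuous_flip.measurable.comp ((measurable_flow hΩ).comp hf)) hNm)
  have h1 : ∀ᵐ q : ℝ × E3 × E3, q ∉ S := by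
    rw [Measure.volume_eq_prod, Measure.ae_prod_iff_ae_ae hSm.compl]
    refine Eventually.of_forall fun t => ?_
    have hA : MeasurableSet (flip ⁻¹' N) := continuous_flip.measurable hNm
    have h2 := volume_flow_preimage_le hΩ t hA
    rw [measurePreserving_flip.measure_preimage hNm.nullMeasurableSet, hN0,
      nonpos_iff_eq_zero] at h2
    have h3 : ∀ᵐ z : E3 × E3, ¬ ((t, z) ∈ flowDomain Ω n ∧ flow Ω n (t, z) ∈ flip ⁻¹' N) := by
      rw [ae_iff]
      simpa only [not_not] using h2
    exact measurePreserving_flip.quasiMeasurePreserving.ae h3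
  filter_upwards [ae_flip_mem_flowDomain hΩ, ae_restrict_of_ae h1] with q hq hqS
  have hr : Reach Ω n q.1 (flip q.2) (traj Ω n q.1 (flip q.2)) := hq
  have hr' := hr.reverse hΩ
  rw [flip_flip] at hr'
  refine ⟨_, ?_, hr'⟩
  by_contra hcon
  refine hqS ⟨hq, hN ?_⟩
  rw [flow_eq_of_mem hq]
  exact fun h => hcon (h hr'.mem_left)

/-! ### The collision integral -/

instance : IsFiniteMeasure surface := by
  unfold surface
  infer_instance

lemma continuous_vPrime : Continuous fun q : E3 × E3 × S2 => vPrime q.1 q.2.1 q.2.2 := by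
  unfold vPrime
  fun_prop

lemma continuous_vsPrime : Continuous fun q : E3 × E3 × S2 => vsPrime q.1 q.2.1 q.2.2 := by
  unfold vsPrime
  fun_prop

/-- The polynomial in the four values `g' = a`, `g'_* = c`, `g = d`, `g_* = e` of the velocity
distribution in the collision integral. -/
def collisionPoly (a c d e : ℝ) : ℝ :=
  a * c * (1 - d) * (1 - e) - d * e * (1 - a) * (1 - c)

lemma collisionIntegrand_eq (b : E3 × S2 → ℝ) (g : E3 → ℝ) (v : E3) (p : E3 × S2) :
    collisionIntegrand b g v p = b (v - p.1, p.2) *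
      collisionPoly (g (vPrime v p.1 p.2)) (g (vsPrime v p.1 p.2)) (g v) (g p.1) := rfl

lemma prod4_mem {a c d e : ℝ} (ha : a ∈ Icc (0:ℝ) 1) (hc : c ∈ Icc (0:ℝ) 1) (hd : d ∈ Icc (0:ℝ) 1)
    (he : e ∈ Icc (0:ℝ) 1) : a * c * d * e ∈ Icc (0:ℝ) 1 :=
  unitInterval.mul_mem (unitInterval.mul_mem (unitInterval.mul_mem ha hc) hd) he

lemma one_sub_mem {a : ℝ} (ha : a ∈ Icc (0:ℝ) 1) : 1 - a ∈ Icc (0:ℝ) 1 :=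
  ⟨by linarith [ha.2], by linarith [ha.1]⟩

lemma abs_collisionPoly_le {a c d e : ℝ} (ha : a ∈ Icc (0:ℝ) 1) (hc : c ∈ Icc (0:ℝ) 1)
    (hd : d ∈ Icc (0:ℝ) 1) (he : e ∈ Icc (0:ℝ) 1) : |collisionPoly a c d e| ≤ 1 := by
  have h1 := prod4_mem ha hc (one_sub_mem hd) (one_sub_mem he)
  have h2 := prod4_mem hd he (one_sub_mem ha) (one_sub_mem hc)
  rw [collisionPoly, abs_le]
  constructor <;> linarith [h1.1, h1.2, h2.1, h2.2]

lemma abs_mul_sub_mul_le {a c a' c' δ ε : ℝ} (ha : a ∈ Icc (0:ℝ) 1) (hc' : c' ∈ Icc (0:ℝ) 1)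
    (h : |a - a'| ≤ δ) (h' : |c - c'| ≤ ε) : |a * c - a' * c'| ≤ δ + ε := by
  have e1 : a * c - a' * c' = a * (c - c') + c' * (a - a') := by ring
  rw [e1]
  refine (abs_add_le _ _).trans ?_
  rw [abs_mul, abs_mul, abs_of_nonneg ha.1, abs_of_nonneg hc'.1]
  nlinarith [abs_nonneg (c - c'), abs_nonneg (a - a'), ha.2, hc'.2]

lemma abs_collisionPoly_sub_le {a c d e a' c' d' e' δ : ℝ} (ha : a ∈ Icc (0:ℝ) 1)
    (hc : c ∈ Icc (0:ℝ) 1) (hd : d ∈ Icc (0:ℝ) 1) (he : e ∈ Icc (0:ℝ) 1) (ha' : a' ∈ Icc (0:ℝ) 1)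
    (hc' : c' ∈ Icc (0:ℝ) 1) (hd' : d' ∈ Icc (0:ℝ) 1) (he' : e' ∈ Icc (0:ℝ) 1)
    (h1 : |a - a'| ≤ δ) (h2 : |c - c'| ≤ δ) (h3 : |d - d'| ≤ δ) (h4 : |e - e'| ≤ δ) :
    |collisionPoly a c d e - collisionPoly a' c' d' e'| ≤ 8 * δ := by
  have key : ∀ {a c d e a' c' d' e' : ℝ}, a ∈ Icc (0:ℝ) 1 → c ∈ Icc (0:ℝ) 1 → d ∈ Icc (0:ℝ) 1 →
      c' ∈ Icc (0:ℝ) 1 → d' ∈ Icc (0:ℝ) 1 → e' ∈ Icc (0:ℝ) 1 → |a - a'| ≤ δ → |c - c'| ≤ δ →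
      |d - d'| ≤ δ → |e - e'| ≤ δ → |a * c * d * e - a' * c' * d' * e'| ≤ 4 * δ := by
    intro a c d e a' c' d' e' ha hc hd hc' hd' he' h1 h2 h3 h4
    have e1 := abs_mul_sub_mul_le ha hc' h1 h2
    have e2 := abs_mul_sub_mul_le (unitInterval.mul_mem ha hc) hd' e1 h3
    have e3 := abs_mul_sub_mul_le (unitInterval.mul_mem (unitInterval.mul_mem ha hc) hd) he' e2 h4
    linarith
  have hsub : ∀ {x y : ℝ}, |x - y| ≤ δ → |(1 - x) - (1 - y)| ≤ δ := by
    intro x y h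
    rw [show (1 - x) - (1 - y) = -(x - y) by ring, abs_neg]
    exact h
  have e1 := key ha hc (one_sub_mem hd) hc' (one_sub_mem hd') (one_sub_mem he') h1 h2 (hsub h3)
    (hsub h4)
  have e2 := key hd he (one_sub_mem ha) he' (one_sub_mem ha') (one_sub_mem hc') h3 h4 (hsub h1)
    (hsub h2)
  rw [collisionPoly, collisionPoly, sub_sub_sub_comm]
  refine (abs_sub _ _).trans ?_
  linarith

section Kernel

variable {b : E3 × S2 → ℝ}

lemma measurePreserving_relative (v : E3) :
    MeasurePreserving (fun p : E3 × S2 => (v - p.1, p.2)) (volume.prod surface)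
      (volume.prod surface) :=
  (Measure.measurePreserving_sub_left volume v).prod (MeasurePreserving.id surface)

lemma collisionIntegrand_congr_ae {b' : E3 × S2 → ℝ} (h : b =ᵐ[volume.prod surface] b') (g : E3 → ℝ)
    (v : E3) : collisionIntegrand b g v =ᵐ[volume.prod surface] collisionIntegrand b' g v := by
  filter_upwards [(measurePreserving_relative v).quasiMeasurePreserving.ae h] with p hp
  rw [collisionIntegrand_eq, collisionIntegrand_eq, hp]

lemma Q_congr_ae {b' : E3 × S2 → ℝ} (h : b =ᵐ[volume.prod surface] b') : Q b = Q b' := by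
  funext f q
  exact integral_congr_ae (collisionIntegrand_congr_ae h _ _)

lemma integrable_kernel (hb : Integrable b (volume.prod surface)) (v : E3) :
    Integrable (fun p : E3 × S2 => b (v - p.1, p.2)) (volume.prod surface) :=
  (measurePreserving_relative v).integrable_comp_of_integrable hb

lemma integral_kernel (hbm : Measurable b) (v : E3) :
    ∫ p : E3 × S2, b (v - p.1, p.2) ∂(volume.prod surface) = ∫ p, b p ∂(volume.prod surface) := by
  rw [← (measurePreserving_relative v).map_eq]
  rw [integral_map (measurePreserving_relative v).measurable.aemeasurable
    hbm.aestronglyMeasurable, (measurePreserving_relative v).map_eq]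

/-- The four values of `g` in the collision integrand are in the unit interval. -/
def ValuesIn (g : E3 → ℝ) (v : E3) (p : E3 × S2) : Prop :=
  g (vPrime v p.1 p.2) ∈ Icc (0:ℝ) 1 ∧ g (vsPrime v p.1 p.2) ∈ Icc (0:ℝ) 1 ∧
    g v ∈ Icc (0:ℝ) 1 ∧ g p.1 ∈ Icc (0:ℝ) 1

lemma abs_integral_collisionIntegrand_le (hbm : Measurable b)
    (hb : Integrable b (volume.prod surface)) (hb0 : ∀ p, 0 ≤ b p) {g : E3 → ℝ} {v : E3}
    (hg : ∀ᵐ p ∂(volume.prod surface), ValuesIn g v p) :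
    |∫ p, collisionIntegrand b g v p ∂(volume.prod surface)| ≤
      ∫ p, b p ∂(volume.prod surface) := by
  rw [← integral_kernel hbm v, ← Real.norm_eq_abs]
  refine norm_integral_le_of_norm_le (integrable_kernel hb v) ?_
  filter_upwards [hg] with p hp
  rw [collisionIntegrand_eq, norm_mul, Real.norm_of_nonneg (hb0 _), Real.norm_eq_abs]
  exact mul_le_of_le_one_right (hb0 _) (abs_collisionPoly_le hp.1 hp.2.1 hp.2.2.1 hp.2.2.2)

lemma abs_integral_collisionIntegrand_sub_le (hbm : Measurable b)
    (hb : Integrable b (volume.prod surface)) (hb0 : ∀ p, 0 ≤ b p) {g g' : E3 → ℝ} {v : E3}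
    {δ : ℝ} (hgi : Integrable (collisionIntegrand b g v) (volume.prod surface))
    (hgi' : Integrable (collisionIntegrand b g' v) (volume.prod surface))
    (hg : ∀ᵐ p ∂(volume.prod surface), ValuesIn g v p)
    (hg' : ∀ᵐ p ∂(volume.prod surface), ValuesIn g' v p)
    (hv : |g v - g' v| ≤ δ)
    (hgg : ∀ᵐ p : E3 × S2 ∂(volume.prod surface),
      |g (vPrime v p.1 p.2) - g' (vPrime v p.1 p.2)| ≤ δ ∧
      |g (vsPrime v p.1 p.2) - g' (vsPrime v p.1 p.2)| ≤ δ ∧ |g p.1 - g' p.1| ≤ δ) :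
    |∫ p, collisionIntegrand b g v p ∂(volume.prod surface) -
      ∫ p, collisionIntegrand b g' v p ∂(volume.prod surface)| ≤
      8 * (∫ p, b p ∂(volume.prod surface)) * δ := by
  rw [← integral_sub hgi hgi', ← integral_kernel hbm v, ← Real.norm_eq_abs]
  have h1 : 8 * (∫ p : E3 × S2, b (v - p.1, p.2) ∂(volume.prod surface)) * δ =
      ∫ p : E3 × S2, b (v - p.1, p.2) * (8 * δ) ∂(volume.prod surface) := by
    rw [integral_mul_const]; ring
  rw [h1]
  refine norm_integral_le_of_norm_le ((integrable_kernel hb v).mul_const _) ?_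
  filter_upwards [hg, hg', hgg] with p hp hp' hpp
  rw [collisionIntegrand_eq, collisionIntegrand_eq, ← mul_sub, norm_mul,
    Real.norm_of_nonneg (hb0 _), Real.norm_eq_abs]
  exact mul_le_mul_of_nonneg_left (abs_collisionPoly_sub_le hp.1 hp.2.1 hp.2.2.1 hp.2.2.2 hp'.1
    hp'.2.1 hp'.2.2.1 hp'.2.2.2 hpp.1 hpp.2.1 hv hpp.2.2) (hb0 _)

lemma measurable_collisionIntegrand (hbm : Measurable b) {f : ℝ × E3 × E3 → ℝ}
    (hf : Measurable f) : Measurable fun r : (ℝ × E3 × E3) × (E3 × S2) =>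
      collisionIntegrand b (fun w => f (r.1.1, r.1.2.1, w)) r.1.2.2 r.2 := by
  have hv' : Measurable fun r : (ℝ × E3 × E3) × (E3 × S2) => vPrime r.1.2.2 r.2.1 r.2.2 :=
    continuous_vPrime.measurable.comp (f := fun r : (ℝ × E3 × E3) × (E3 × S2) =>
      (r.1.2.2, r.2.1, r.2.2)) (by fun_prop)
  have hvs' : Measurable fun r : (ℝ × E3 × E3) × (E3 × S2) => vsPrime r.1.2.2 r.2.1 r.2.2 :=
    continuous_vsPrime.measurable.comp (f := fun r : (ℝ × E3 × E3) × (E3 × S2) =>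
      (r.1.2.2, r.2.1, r.2.2)) (by fun_prop)
  unfold collisionIntegrand
  fun_prop

lemma measurable_Q (hbm : Measurable b) {f : ℝ × E3 × E3 → ℝ} (hf : Measurable f) :
    Measurable (Q b f) :=
  (measurable_collisionIntegrand hbm hf).stronglyMeasurable.integral_prod_right'.measurable

lemma integrable_collisionIntegrand (hbm : Measurable b)
    (hb : Integrable b (volume.prod surface)) {f : ℝ × E3 × E3 → ℝ} (hf : Measurable f)
    (hf01 : ∀ q, f q ∈ Icc (0:ℝ) 1) (q : ℝ × E3 × E3) :
    Integrable (collisionIntegrand b (fun w => f (q.1, q.2.1, w)) q.2.2)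
      (volume.prod surface) := by
  refine (integrable_kernel hb q.2.2).norm.mono' ?_ (Eventually.of_forall fun p => ?_)
  · exact ((measurable_collisionIntegrand hbm hf).comp
      (measurable_prodMk_left (x := q))).aestronglyMeasurable
  · rw [collisionIntegrand_eq, norm_mul]
    exact mul_le_of_le_one_right (norm_nonneg _)
      (abs_collisionPoly_le (hf01 _) (hf01 _) (hf01 _) (hf01 _))

lemma abs_Q_le (hbm : Measurable b) (hb : Integrable b (volume.prod surface)) (hb0 : ∀ p, 0 ≤ b p)
    {f : ℝ × E3 × E3 → ℝ} (hf01 : ∀ q, f q ∈ Icc (0:ℝ) 1) (q : ℝ × E3 × E3) :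
    |Q b f q| ≤ ∫ p, b p ∂(volume.prod surface) :=
  abs_integral_collisionIntegrand_le hbm hb hb0
    (Eventually.of_forall fun _ => ⟨hf01 _, hf01 _, hf01 _, hf01 _⟩)

lemma abs_Q_sub_le (hbm : Measurable b) (hb : Integrable b (volume.prod surface))
    (hb0 : ∀ p, 0 ≤ b p) {f g : ℝ × E3 × E3 → ℝ} (hf : Measurable f) (hg : Measurable g)
    (hf01 : ∀ q, f q ∈ Icc (0:ℝ) 1) (hg01 : ∀ q, g q ∈ Icc (0:ℝ) 1) (q : ℝ × E3 × E3) {δ : ℝ}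
    (h : ∀ w, |f (q.1, q.2.1, w) - g (q.1, q.2.1, w)| ≤ δ) :
    |Q b f q - Q b g q| ≤ 8 * (∫ p, b p ∂(volume.prod surface)) * δ :=
  abs_integral_collisionIntegrand_sub_le hbm hb hb0
    (integrable_collisionIntegrand hbm hb hf hf01 q)
    (integrable_collisionIntegrand hbm hb hg hg01 q)
    (Eventually.of_forall fun _ => ⟨hf01 _, hf01 _, hf01 _, hf01 _⟩)
    (Eventually.of_forall fun _ => ⟨hg01 _, hg01 _, hg01 _, hg01 _⟩) (h _)
    (Eventually.of_forall fun _ => ⟨h _, h _, h _⟩)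

/-- The loss term vanishes where the distribution vanishes. -/
lemma Q_nonneg (hb0 : ∀ p, 0 ≤ b p) {f : ℝ × E3 × E3 → ℝ} (hf01 : ∀ q, f q ∈ Icc (0:ℝ) 1)
    {q : ℝ × E3 × E3} (hq : f q = 0) : 0 ≤ Q b f q := by
  refine integral_nonneg fun p => ?_
  rw [collisionIntegrand_eq, collisionPoly, show f (q.1, q.2.1, q.2.2) = 0 from hq]
  have h1 := prod4_mem (hf01 (q.1, q.2.1, vPrime q.2.2 p.1 p.2))
    (hf01 (q.1, q.2.1, vsPrime q.2.2 p.1 p.2)) (one_sub_mem (a := 0) (by simp))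
    (one_sub_mem (hf01 (q.1, q.2.1, p.1)))
  exact mul_nonneg (hb0 _) (by linarith [h1.1])

/-- The gain term vanishes where the distribution is saturated. -/
lemma Q_nonpos (hb0 : ∀ p, 0 ≤ b p) {f : ℝ × E3 × E3 → ℝ} (hf01 : ∀ q, f q ∈ Icc (0:ℝ) 1)
    {q : ℝ × E3 × E3} (hq : f q = 1) : Q b f q ≤ 0 := by
  refine integral_nonpos fun p => ?_
  rw [collisionIntegrand_eq, collisionPoly, show f (q.1, q.2.1, q.2.2) = 1 from hq]
  have h1 := prod4_mem (a := 1) (by simp) (hf01 (q.1, q.2.1, p.1))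
    (one_sub_mem (hf01 (q.1, q.2.1, vPrime q.2.2 p.1 p.2)))
    (one_sub_mem (hf01 (q.1, q.2.1, vsPrime q.2.2 p.1 p.2)))
  refine mul_nonpos_of_nonneg_of_nonpos (hb0 _) ?_
  simp only [sub_self, mul_zero, zero_mul, zero_sub]
  linarith [h1.1]

end Kernel

/-- For a fixed collision parameter, the map from the velocities before a collision to the
velocities after it is a linear involution, hence preserves volume. -/
lemma measurePreserving_collision (σ : S2) :
    MeasurePreserving (fun q : E3 × E3 => (vPrime q.1 q.2 σ, vsPrime q.1 q.2 σ)) volume volume := by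
  have hσ : ⟪(σ : E3), (σ : E3)⟫ = 1 := by
    rw [real_inner_self_eq_norm_sq, norm_eq_of_mem_sphere]; norm_num
  let A : E3 × E3 →ₗ[ℝ] E3 × E3 := IsLinearMap.mk'
    (fun q : E3 × E3 => (vPrime q.1 q.2 σ, vsPrime q.1 q.2 σ))
    ⟨fun p q => by
      simp only [vPrime, vsPrime, Prod.fst_add, Prod.snd_add, Prod.mk_add_mk, inner_sub_left,
        inner_add_left, Prod.mk.injEq]
      constructor <;> module,
    fun c p => by
      simp only [vPrime, vsPrime, Prod.smul_fst, Prod.smul_snd, Prod.smul_mk, inner_sub_left,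
        inner_smul_left, RCLike.conj_to_real, Prod.mk.injEq]
      constructor <;> module⟩
  have hinv : ∀ q, A (A q) = q := by
    intro q
    simp only [A, IsLinearMap.mk'_apply, vPrime, vsPrime, inner_sub_left, inner_add_left,
      inner_smul_left, RCLike.conj_to_real, hσ]
    ext1 <;> simp only <;> module
  have hdet := abs_det_eq_one_of_involutive A hinv
  have hdet0 : LinearMap.det A ≠ 0 := by
    intro h0
    rw [h0] at hdet
    simp at hdet
  have hm : Measurable A := A.continuous_of_finiteDimensional.measurable
  refine ⟨hm, Measure.ext fun s hs => ?_⟩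
  change Measure.map A volume s = _
  rw [Measure.map_apply hm hs]
  rw [Measure.addHaar_preimage_linearMap volume hdet0, abs_inv, hdet]
  simp

/-- A property of almost all velocities holds for the velocities after collision as well. -/
lemma ae_collision {P : E3 → Prop} (hP : ∀ᵐ w, P w) :
    ∀ᵐ v : E3, ∀ᵐ p : E3 × S2 ∂(volume.prod surface),
      P (vPrime v p.1 p.2) ∧ P (vsPrime v p.1 p.2) ∧ P p.1 := by
  obtain ⟨N, hN, hNm, hN0⟩ := exists_measurable_superset_of_null (ae_iff.1 hP)
  have hnotN : ∀ᵐ w, w ∉ N := by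
    rw [ae_iff]
    simp only [not_not]
    exact hN0
  set S : Set (E3 × E3 × S2) := {q | vPrime q.1 q.2.1 q.2.2 ∉ N ∧ vsPrime q.1 q.2.1 q.2.2 ∉ N ∧
    q.2.1 ∉ N} with hS
  have hSm : MeasurableSet S := (continuous_vPrime.measurable hNm.compl).inter
    ((continuous_vsPrime.measurable hNm.compl).inter
      ((measurable_fst.comp measurable_snd) hNm.compl))
  have hpair : ∀ᵐ q : E3 × E3, q.1 ∉ N ∧ q.2 ∉ N :=
    (Measure.quasiMeasurePreserving_fst.ae hnotN).and (Measure.quasiMeasurePreserving_snd.ae hnotN)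
  have hσ : ∀ σ : S2, ∀ᵐ q : E3 × E3, (q.1, q.2, σ) ∈ S := by
    intro σ
    filter_upwards [(measurePreserving_collision σ).quasiMeasurePreserving.ae hpair, hpair]
      with q hq hq'
    exact ⟨hq.1, hq.2, hq'.2⟩
  -- Fubini's theorem, applied twice to the measurable set `S`, moves `σ` inside and separates `v`
  have h1 : ∀ᵐ q : E3 × E3, ∀ᵐ σ ∂surface, (q.1, q.2, σ) ∈ S := by
    refine (Measure.ae_ae_comm (p := fun (q : E3 × E3) σ => (q.1, q.2, σ) ∈ S) ?_).2
      (Eventually.of_forall hσ)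
    exact (MeasurableEquiv.prodAssoc (α := E3) (β := E3) (γ := S2)).measurable hSm
  have h2 : ∀ᵐ v : E3, ∀ᵐ vs : E3, ∀ᵐ σ ∂surface, (v, vs, σ) ∈ S := Measure.ae_ae_of_ae_prod h1
  filter_upwards [h2] with v hv
  have h3 : ∀ᵐ p : E3 × S2 ∂(volume.prod surface), (v, p.1, p.2) ∈ S :=
    (Measure.ae_prod_iff_ae_ae ((measurable_prodMk_left (x := v)) hSm)).2 hv
  filter_upwards [h3] with p hp
  refine ⟨?_, ?_, ?_⟩ <;> by_contra hcon
  · exact hp.1 (hN hcon)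
  · exact hp.2.1 (hN hcon)
  · exact hp.2.2 (hN hcon)

/-- A property which holds almost everywhere in `(0, ∞) × Ω × ℝ³` holds for the velocities before
and after almost every collision. -/
lemma ae_collision_timePhase (hΩ : IsOpen Ω) {P : ℝ × E3 × E3 → Prop}
    (hP : ∀ᵐ q ∂(volume.restrict (timePhase Ω)), P q) :
    ∀ᵐ t : ℝ, ∀ᵐ x : E3, ∀ᵐ v : E3, 0 < t → x ∈ Ω → P (t, x, v) ∧
      ∀ᵐ p : E3 × S2 ∂(volume.prod surface),
        P (t, x, vPrime v p.1 p.2) ∧ P (t, x, vsPrime v p.1 p.2) ∧ P (t, x, p.1) := by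
  rw [ae_timePhase_iff hΩ] at hP
  have h1 : ∀ᵐ t : ℝ, ∀ᵐ y : E3 × E3, 0 < t → y.1 ∈ Ω → P (t, y) := Measure.ae_ae_of_ae_prod hP
  filter_upwards [h1] with t ht
  have h2 : ∀ᵐ x : E3, ∀ᵐ v : E3, 0 < t → x ∈ Ω → P (t, x, v) := Measure.ae_ae_of_ae_prod ht
  filter_upwards [h2] with x hx
  filter_upwards [hx, ae_collision hx] with v hv hv' ht0 hxΩ
  refine ⟨hv ht0 hxΩ, ?_⟩
  filter_upwards [hv'] with p hp
  exact ⟨hp.1 ht0 hxΩ, hp.2.1 ht0 hxΩ, hp.2.2 ht0 hxΩ⟩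

/-! ### Free transport: the weak form and the form along characteristics -/

/-- The flow of the vector field `(1, v, 0)` on the space of the variables `(t, x, v)`. -/
def shift (r : ℝ) (q : ℝ × E3 × E3) : ℝ × E3 × E3 := (q.1 + r, q.2.1 + r • q.2.2, q.2.2)

lemma shift_shift (r s : ℝ) (q : ℝ × E3 × E3) : shift r (shift s q) = shift (s + r) q := by
  simp only [shift, Prod.mk.injEq, and_true]
  constructor
  · ring
  · module

@[simp] lemma shift_zero (q : ℝ × E3 × E3) : shift 0 q = q := by simp [shift]

lemma shift_neg_shift (r : ℝ) (q : ℝ × E3 × E3) : shift (-r) (shift r q) = q := by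
  simp [shift_shift]

lemma shift_shift_neg (r : ℝ) (q : ℝ × E3 × E3) : shift r (shift (-r) q) = q := by
  simp [shift_shift]

lemma continuous_shift : Continuous fun p : ℝ × ℝ × E3 × E3 => shift p.1 p.2 := by
  unfold shift
  fun_prop

lemma continuous_shift_right (r : ℝ) : Continuous (shift r) :=
  continuous_shift.comp (Continuous.prodMk_right r)

instance : (volume : Measure (ℝ × E3 × E3)).IsAddHaarMeasure :=
  Measure.prod.instIsAddHaarMeasure (volume : Measure ℝ) (volume : Measure (E3 × E3))

/-- The linear part of `shift r`. -/
def shiftLin (r : ℝ) : ℝ × E3 × E3 →L[ℝ] ℝ × E3 × E3 :=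
  (ContinuousLinearMap.fst ℝ ℝ (E3 × E3)).prod
    ((ContinuousLinearMap.fst ℝ E3 E3 + r • ContinuousLinearMap.snd ℝ E3 E3).prod
      (ContinuousLinearMap.snd ℝ E3 E3) ∘L ContinuousLinearMap.snd ℝ ℝ (E3 × E3))

lemma shiftLin_apply (r : ℝ) (q : ℝ × E3 × E3) :
    shiftLin r q = (q.1, q.2.1 + r • q.2.2, q.2.2) := rfl

lemma shift_eq (r : ℝ) (q : ℝ × E3 × E3) : shift r q = shiftLin r q + (r, 0, 0) := by
  simp [shiftLin_apply, shift]

lemma hasFDerivAt_shift (r : ℝ) (q : ℝ × E3 × E3) : HasFDerivAt (shift r) (shiftLin r) q := by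
  have h : shift r = fun q => shiftLin r q + (r, 0, 0) := funext (shift_eq r)
  rw [h]
  exact (shiftLin r).hasFDerivAt.add_const _

lemma contDiff_shift (r : ℝ) : ContDiff ℝ ∞ (shift r) := by
  have h : shift r = fun q => shiftLin r q + (r, 0, 0) := funext (shift_eq r)
  rw [h]
  exact (shiftLin r).contDiff.add contDiff_const

lemma measurePreserving_shift (r : ℝ) : MeasurePreserving (shift r) volume volume := by
  have h1 : MeasurePreserving (shiftLin r) volume volume := by
    let J : ℝ × E3 × E3 →ₗ[ℝ] ℝ × E3 × E3 :=
      LinearMap.prodMap LinearMap.id (LinearMap.prodMap LinearMap.id (-LinearMap.id))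
    have hJ : |LinearMap.det J| = 1 := abs_det_eq_one_of_involutive J (fun u => by simp [J])
    have hK : |LinearMap.det (J ∘ₗ (shiftLin r : ℝ × E3 × E3 →ₗ[ℝ] ℝ × E3 × E3))| = 1 :=
      abs_det_eq_one_of_involutive _ (fun u => by simp [J, shiftLin_apply])
    have hdet : |LinearMap.det (shiftLin r : ℝ × E3 × E3 →ₗ[ℝ] ℝ × E3 × E3)| = 1 := by
      rwa [LinearMap.det_comp, abs_mul, hJ, one_mul] at hK
    have hdet0 : LinearMap.det (shiftLin r : ℝ × E3 × E3 →ₗ[ℝ] ℝ × E3 × E3) ≠ 0 := by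
      intro h0
      rw [h0] at hdet
      simp at hdet
    refine ⟨(shiftLin r).continuous.measurable, Measure.ext fun s hs => ?_⟩
    rw [Measure.map_apply (shiftLin r).continuous.measurable hs]
    change volume ((shiftLin r : ℝ × E3 × E3 →ₗ[ℝ] ℝ × E3 × E3) ⁻¹' s) = _
    rw [Measure.addHaar_preimage_linearMap volume hdet0, abs_inv, hdet]
    simp
  have h : shift r = (fun q => q + (r, 0, 0)) ∘ shiftLin r := funext (shift_eq r)
  rw [h]
  exact (measurePreserving_add_right volume _).comp h1

lemma measurableEmbedding_shift (r : ℝ) : MeasurableEmbedding (shift r) := by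
  refine (Homeomorph.mk ⟨shift r, shift (-r), shift_neg_shift r, shift_shift_neg r⟩
    (continuous_shift_right r) (continuous_shift_right (-r))).measurableEmbedding

lemma integral_mul_comp_shift (f ψ : ℝ × E3 × E3 → ℝ) (r : ℝ) :
    ∫ q, f q * ψ (shift r q) = ∫ q, f (shift (-r) q) * ψ q := by
  rw [← (measurePreserving_shift r).integral_comp (measurableEmbedding_shift r)
    (fun q => f (shift (-r) q) * ψ q)]
  simp only [shift_neg_shift]

lemma integrable_mul_comp_shift {f ψ : ℝ × E3 × E3 → ℝ} {C : ℝ} (hf : Measurable f)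
    (hfC : ∀ q, |f q| ≤ C) (hψ : Integrable ψ) (r : ℝ) :
    Integrable fun q => f q * ψ (shift r q) := by
  have h := ((measurePreserving_shift r).integrable_comp_emb (measurableEmbedding_shift r)).2 hψ
  exact h.bdd_mul hf.aestronglyMeasurable (Eventually.of_forall hfC)

/-- The Fubini theorem for the integrals `∫ f ψ(shift r q)`. -/
lemma integrable_prod_shift {f ψ : ℝ × E3 × E3 → ℝ} {C : ℝ} (hf : Measurable f)
    (hfC : ∀ q, |f q| ≤ C) (hψ : Integrable ψ) (hψm : Measurable ψ) (a : ℝ) :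
    Integrable (fun p : ℝ × ℝ × E3 × E3 => f p.2 * ψ (shift p.1 p.2))
      ((volume.restrict (Ioc 0 a)).prod volume) := by
  have hm : Measurable fun p : ℝ × ℝ × E3 × E3 => f p.2 * ψ (shift p.1 p.2) :=
    (hf.comp measurable_snd).mul (hψm.comp continuous_shift.measurable)
  rw [integrable_prod_iff hm.aestronglyMeasurable]
  refine ⟨Eventually.of_forall fun r => integrable_mul_comp_shift hf hfC hψ r, ?_⟩
  refine Integrable.mono' (integrable_const (C * ∫ q, ‖ψ q‖))
    (hm.norm.stronglyMeasurable.integral_prod_right).aestronglyMeasurable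
    (Eventually.of_forall fun r => ?_)
  rw [Real.norm_of_nonneg (integral_nonneg fun q => norm_nonneg _)]
  have h1 : ∫ q, ‖ψ q‖ = ∫ q, ‖ψ (shift r q)‖ :=
    ((measurePreserving_shift r).integral_comp (measurableEmbedding_shift r)
      (fun q => ‖ψ q‖)).symm
  rw [h1, ← integral_const_mul]
  refine integral_mono (integrable_mul_comp_shift hf hfC hψ r).norm
    ((((measurePreserving_shift r).integrable_comp_emb
      (measurableEmbedding_shift r)).2 hψ).norm.const_mul C) fun q => ?_
  simp only [norm_mul]
  exact mul_le_mul_of_nonneg_right (hfC q) (norm_nonneg _)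

/-- The derivative in the direction of free transport. -/
def transportDeriv (φ : ℝ × E3 × E3 → ℝ) (q : ℝ × E3 × E3) : ℝ := fderiv ℝ φ q (1, q.2.2, 0)

lemma hasDerivAt_comp_shift {φ : ℝ × E3 × E3 → ℝ} (hφ : ContDiff ℝ ∞ φ) (q : ℝ × E3 × E3) (r : ℝ) :
    HasDerivAt (fun r => φ (shift r q)) (transportDeriv φ (shift r q)) r := by
  have h1 : HasDerivAt (fun r => shift r q) (1, q.2.2, 0) r := by
    have e1 : HasDerivAt (fun r : ℝ => q.1 + r) 1 r := (hasDerivAt_id r).const_add _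
    have e2 : HasDerivAt (fun r : ℝ => q.2.1 + r • q.2.2) q.2.2 r := by
      simpa using ((hasDerivAt_id r).smul_const q.2.2).const_add q.2.1
    exact e1.prodMk (e2.prodMk (hasDerivAt_const r q.2.2))
  exact ((hφ.differentiable (by simp)).differentiableAt.hasFDerivAt).comp_hasDerivAt r h1

lemma transportDeriv_comp_shift {φ : ℝ × E3 × E3 → ℝ} (hφ : ContDiff ℝ ∞ φ) (r : ℝ)
    (q : ℝ × E3 × E3) :
    fderiv ℝ (fun q => φ (shift r q)) q (1, q.2.2, 0) = transportDeriv φ (shift r q) := by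
  have h1 : HasFDerivAt (fun q => φ (shift r q)) (fderiv ℝ φ (shift r q) ∘L shiftLin r) q :=
    ((hφ.differentiable (by simp)).differentiableAt.hasFDerivAt).comp q (hasFDerivAt_shift r q)
  rw [h1.fderiv, ContinuousLinearMap.comp_apply, shiftLin_apply]
  simp [transportDeriv, shift]

lemma continuous_transportDeriv {φ : ℝ × E3 × E3 → ℝ} (hφ : ContDiff ℝ ∞ φ) :
    Continuous (transportDeriv φ) := by
  have := hφ.continuous_fderiv (by simp)
  unfold transportDeriv
  fun_prop

lemma hasCompactSupport_transportDeriv {φ : ℝ × E3 × E3 → ℝ} (hφ : HasCompactSupport φ) :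
    HasCompactSupport (transportDeriv φ) := by
  refine (hφ.fderiv (𝕜 := ℝ)).mono' fun q hq => subset_tsupport _ fun h => hq ?_
  simp [transportDeriv, h]

/-- Integration of the weak formulation of free transport with the source `h` along the
characteristics. -/
lemma integral_weak_eq {f h φ : ℝ × E3 × E3 → ℝ} {C : ℝ} (hf : Measurable f)
    (hfC : ∀ q, |f q| ≤ C) (hh : Measurable h) (hhC : ∀ q, |h q| ≤ C) (hφ : ContDiff ℝ ∞ φ)
    (hφc : HasCompactSupport φ) {a : ℝ} (ha : 0 ≤ a) :
    ∫ r in Ioc 0 a, ((∫ q, f q * transportDeriv φ (shift r q)) + ∫ q, h q * φ (shift r q)) =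
      ∫ q, φ q * (f (shift (-a) q) - f q + ∫ r in Ioc 0 a, h (shift (-r) q)) := by
  have hψ := continuous_transportDeriv hφ
  have hψi : Integrable (transportDeriv φ) :=
    hψ.integrable_of_hasCompactSupport (hasCompactSupport_transportDeriv hφc)
  have hφi : Integrable φ := hφ.continuous.integrable_of_hasCompactSupport hφc
  have hI1 := integrable_prod_shift hf hfC hψi hψ.measurable a
  have hI2 := integrable_prod_shift hh hhC hφi hφ.continuous.measurable a
  rw [integral_add hI1.integral_prod_left hI2.integral_prod_left]
  -- `transportDeriv φ (shift r q)` is the derivative of `φ (shift r q)` with respect to `r`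
  have e1 : ∫ r in Ioc 0 a, ∫ q, f q * transportDeriv φ (shift r q) =
      (∫ q, φ q * f (shift (-a) q)) - ∫ q, φ q * f q := by
    rw [integral_integral_swap hI1]
    have e2 : ∀ q, ∫ r in Ioc 0 a, f q * transportDeriv φ (shift r q) =
        f q * φ (shift a q) - f q * φ (shift 0 q) := by
      intro q
      rw [integral_const_mul, ← intervalIntegral.integral_of_le ha,
        intervalIntegral.integral_eq_sub_of_hasDerivAt
          (fun r _ => hasDerivAt_comp_shift hφ q r)
          ((hψ.comp (continuous_shift.comp (Continuous.prodMk_left q))).intervalIntegrable _ _)]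
      ring
    simp only [e2]
    rw [integral_sub (integrable_mul_comp_shift hf hfC hφi a)
      (integrable_mul_comp_shift hf hfC hφi 0), integral_mul_comp_shift]
    simp only [shift_zero, mul_comm]
  have e3 : ∫ r in Ioc 0 a, ∫ q, h q * φ (shift r q) =
      ∫ q, φ q * ∫ r in Ioc 0 a, h (shift (-r) q) := by
    simp only [integral_mul_comp_shift]
    rw [integral_integral_swap]
    · simp only [mul_comm, integral_const_mul]
    · refine Integrable.bdd_mul (c := C) ?_ ?_ (Eventually.of_forall fun p => hhC _)
      · exact hφi.comp_snd _
      · exact (hh.comp (continuous_shift.measurable.comp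
          ((measurable_fst.neg).prodMk measurable_snd))).aestronglyMeasurable
  have hfi : ∀ r, Integrable fun q => φ q * f (shift r q) := fun r =>
    hφi.mul_bdd (c := C) (hf.comp (continuous_shift_right r).measurable).aestronglyMeasurable
      (Eventually.of_forall fun q => hfC _)
  have hhi : Integrable fun q => φ q * ∫ r in Ioc 0 a, h (shift (-r) q) := by
    refine hφi.mul_bdd (c := C * a) ?_ (Eventually.of_forall fun q => ?_)
    · have : Measurable fun p : (ℝ × E3 × E3) × ℝ => h (shift (-p.2) p.1) :=
        hh.comp (continuous_shift.measurable.comp ((measurable_snd.neg).prodMk measurable_fst))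
      exact this.stronglyMeasurable.integral_prod_right'.aestronglyMeasurable
    · refine (norm_setIntegral_le_of_norm_le_const (C := C) (by simp) fun r _ => hhC _).trans ?_
      simp [ha]
  have hfi0 := hfi 0
  simp only [shift_zero] at hfi0
  have hadd := integral_add ((hfi (-a)).sub hfi0) hhi
  simp only [Pi.sub_apply] at hadd
  rw [e1, e3, ← integral_sub (hfi (-a)) hfi0, ← hadd]
  congr 1
  funext q
  ring

/-- The points whose backward free flight during the time `a` stays in `O`. -/
def backwardSet (O : Set (ℝ × E3 × E3)) (a : ℝ) : Set (ℝ × E3 × E3) :=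
  {q | ∀ r ∈ Icc 0 a, shift (-r) q ∈ O}

lemma isOpen_backwardSet {O : Set (ℝ × E3 × E3)} (hO : IsOpen O) (a : ℝ) :
    IsOpen (backwardSet O a) := by
  refine isOpen_iff_mem_nhds.2 fun q hq => ?_
  refine isCompact_Icc.eventually_forall_of_forall_eventually fun r hr => ?_
  have hc : Continuous fun p : (ℝ × E3 × E3) × ℝ => shift (-p.2) p.1 :=
    continuous_shift.comp (continuous_snd.neg.prodMk continuous_fst)
  exact hc.continuousAt.eventually (hO.mem_nhds (hq r hr))

/-- A compact subset of an open set stays inside it during short backward free flights. -/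
lemma exists_subset_backwardSet {O K : Set (ℝ × E3 × E3)} (hO : IsOpen O) (hK : IsCompact K)
    (hKO : K ⊆ O) : ∃ ε > 0, ∀ a ∈ Ico 0 ε, K ⊆ backwardSet O a := by
  have h1 : ∀ᶠ r : ℝ in 𝓝 0, ∀ q ∈ K, shift (-r) q ∈ O := by
    refine hK.eventually_forall_of_forall_eventually fun q hq => ?_
    have hc : Continuous fun p : ℝ × ℝ × E3 × E3 => shift (-p.1) p.2 :=
      continuous_shift.comp (continuous_fst.neg.prodMk continuous_snd)
    refine hc.continuousAt.eventually (hO.mem_nhds ?_)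
    simpa using hKO hq
  obtain ⟨ε, hε, hball⟩ := Metric.eventually_nhds_iff_ball.1 h1
  refine ⟨ε, hε, fun a ha q hq r hr => hball r ?_ q hq⟩
  rw [Metric.mem_ball, Real.dist_eq, sub_zero, abs_of_nonneg hr.1]
  exact hr.2.trans_lt ha.2

lemma tsupport_comp_shift_subset {O : Set (ℝ × E3 × E3)} {φ : ℝ × E3 × E3 → ℝ} {a r : ℝ}
    (hφ : tsupport φ ⊆ backwardSet O a) (hr : r ∈ Icc 0 a) :
    tsupport (fun q => φ (shift r q)) ⊆ O := by
  intro q hq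
  have h1 : shift r q ∈ tsupport φ := by
    have : IsClosed (shift r ⁻¹' tsupport φ) :=
      (isClosed_tsupport φ).preimage (continuous_shift_right r)
    refine closure_minimal (fun p hp => ?_) this hq
    exact subset_tsupport _ hp
  have := hφ h1 r hr
  rwa [shift_neg_shift] at this

lemma hasCompactSupport_comp_shift {φ : ℝ × E3 × E3 → ℝ} (hφ : HasCompactSupport φ) (r : ℝ) :
    HasCompactSupport fun q => φ (shift r q) :=
  hφ.comp_isClosedEmbedding (g := shift r) (Homeomorph.mk
    ⟨shift r, shift (-r), shift_neg_shift r, shift_shift_neg r⟩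
    (continuous_shift_right r) (continuous_shift_right (-r))).isClosedEmbedding

lemma transportDeriv_eq_zero {φ : ℝ × E3 × E3 → ℝ} {q : ℝ × E3 × E3} (h : q ∉ tsupport φ) :
    transportDeriv φ q = 0 := by
  have : fderiv ℝ φ q = 0 := by
    by_contra hcon
    exact h (support_fderiv_subset ℝ hcon)
  simp [transportDeriv, this]

/-- A weak solution of the transport equation with bounded source satisfies the equation in
integrated form along almost all characteristics. -/
lemma shift_of_weak {O : Set (ℝ × E3 × E3)} (hO : IsOpen O) {f h : ℝ × E3 × E3 → ℝ} {C : ℝ}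
    (hf : Measurable f) (hfC : ∀ q, |f q| ≤ C) (hh : Measurable h) (hhC : ∀ q, |h q| ≤ C)
    (hweak : ∀ φ : ℝ × E3 × E3 → ℝ, ContDiff ℝ ∞ φ → HasCompactSupport φ → tsupport φ ⊆ O →
      -(∫ q in O, f q * fderiv ℝ φ q (1, q.2.2, 0)) = ∫ q in O, h q * φ q) {a : ℝ} (ha : 0 ≤ a) :
    ∀ᵐ q, q ∈ backwardSet O a → f q - f (shift (-a) q) = ∫ r in Ioc 0 a, h (shift (-r) q) := by
  set u : ℝ × E3 × E3 → ℝ :=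
    fun q => f (shift (-a) q) - f q + ∫ r in Ioc 0 a, h (shift (-r) q) with hu
  have hum : Measurable u := by
    have h1 : Measurable fun p : (ℝ × E3 × E3) × ℝ => h (shift (-p.2) p.1) :=
      hh.comp (continuous_shift.measurable.comp ((measurable_snd.neg).prodMk measurable_fst))
    exact ((hf.comp (continuous_shift_right (-a)).measurable).sub hf).add
      h1.stronglyMeasurable.integral_prod_right'.measurable
  have hub : ∀ q, ‖u q‖ ≤ C + C + C * a := by
    intro q
    refine (norm_add_le _ _).trans (add_le_add ((norm_sub_le _ _).trans
      (add_le_add (hfC _) (hfC _))) ?_)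
    refine (norm_setIntegral_le_of_norm_le_const (C := C) (by simp) fun r _ => hhC _).trans ?_
    simp [ha]
  have hul : LocallyIntegrable u := by
    refine (locallyIntegrable_const (C + C + C * a)).mono hum.aestronglyMeasurable
      (Eventually.of_forall fun q => ?_)
    exact (hub q).trans (le_abs_self _)
  have key := (isOpen_backwardSet hO a).ae_eq_zero_of_integral_contDiff_smul_eq_zero
    (μ := volume) (f := u) (hul.locallyIntegrableOn _) fun φ hφ hφc hφs => ?_
  · filter_upwards [key] with q hq hqO
    have := hq hqO
    simp only [hu] at this
    linarith
  -- the shifted test functions are admissible as long as their supports stay in `O`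
  · have hJ : ∀ r ∈ Ioc 0 a,
        (∫ q, f q * transportDeriv φ (shift r q)) + ∫ q, h q * φ (shift r q) = 0 := by
      intro r hr
      have hts := tsupport_comp_shift_subset hφs (Ioc_subset_Icc_self hr)
      have h1 := hweak (fun q => φ (shift r q)) (hφ.comp (contDiff_shift r))
        (hasCompactSupport_comp_shift hφc r) hts
      have h2 : ∫ q in O, h q * φ (shift r q) = ∫ q, h q * φ (shift r q) := by
        refine setIntegral_eq_integral_of_forall_compl_eq_zero fun q hq => ?_
        have : φ (shift r q) = 0 := by
          by_contra hcon
          exact hq (hts (subset_tsupport _ hcon))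
        rw [this, mul_zero]
      have h3 : ∫ q in O, f q * fderiv ℝ (fun q => φ (shift r q)) q (1, q.2.2, 0) =
          ∫ q, f q * transportDeriv φ (shift r q) := by
        rw [setIntegral_eq_integral_of_forall_compl_eq_zero]
        · simp only [transportDeriv_comp_shift hφ]
        · intro q hq
          have : fderiv ℝ (fun q => φ (shift r q)) q (1, q.2.2, 0) = 0 :=
            transportDeriv_eq_zero (φ := fun q => φ (shift r q)) fun h' => hq (hts h')
          rw [this, mul_zero]
      rw [h2, h3] at h1
      linarith
    have h4 := integral_weak_eq hf hfC hh hhC hφ hφc ha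
    rw [setIntegral_congr_fun measurableSet_Ioc hJ] at h4
    simp only [integral_zero, smul_eq_mul] at h4 ⊢
    exact h4.symm

lemma continuous_integral_mul_comp_shift {f ψ : ℝ × E3 × E3 → ℝ} {C : ℝ} (hf : Measurable f)
    (hfC : ∀ q, |f q| ≤ C) (hψ : Continuous ψ) (hψc : HasCompactSupport ψ) :
    Continuous fun r : ℝ => ∫ q, f q * ψ (shift r q) := by
  refine continuous_iff_continuousAt.2 fun r₀ => ?_
  obtain ⟨M, hM⟩ := hψ.bounded_above_of_compact_support hψc
  set K : Set (ℝ × E3 × E3) := (fun p : ℝ × ℝ × E3 × E3 => shift (-p.1) p.2) ''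
    (Icc (r₀ - 1) (r₀ + 1) ×ˢ tsupport ψ) with hK
  have hKc : IsCompact K := (isCompact_Icc.prod hψc).image
    (continuous_shift.comp (continuous_fst.neg.prodMk continuous_snd))
  have hC : 0 ≤ C := (abs_nonneg _).trans (hfC 0)
  refine continuousAt_of_dominated (bound := K.indicator fun _ => C * M) ?_ ?_ ?_ ?_
  · exact Eventually.of_forall fun r => (hf.mul
      (hψ.comp (continuous_shift_right r)).measurable).aestronglyMeasurable
  · filter_upwards [Icc_mem_nhds (show r₀ - 1 < r₀ by linarith) (show r₀ < r₀ + 1 by linarith)]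
      with r hr
    refine Eventually.of_forall fun q => ?_
    by_cases hq : shift r q ∈ tsupport ψ
    · have : q ∈ K := ⟨(r, shift r q), ⟨hr, hq⟩, shift_neg_shift r q⟩
      rw [indicator_of_mem this, norm_mul]
      exact mul_le_mul (hfC q) (hM _) (norm_nonneg _) hC
    · have : ψ (shift r q) = 0 := by
        by_contra hcon
        exact hq (subset_tsupport _ hcon)
      rw [this, mul_zero, norm_zero]
      exact indicator_nonneg (fun _ _ => mul_nonneg hC ((norm_nonneg _).trans (hM 0))) q
  · exact (integrable_indicator_iff hKc.measurableSet).2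
      (integrableOn_const hKc.measure_lt_top.ne)
  · refine Eventually.of_forall fun q => ?_
    exact (continuous_const.mul (hψ.comp
      (continuous_shift.comp (Continuous.prodMk_left q)))).continuousAt

/-- A function which satisfies the transport equation in integrated form along almost all
characteristics is a weak solution. -/
lemma weak_of_shift {O : Set (ℝ × E3 × E3)} (hO : IsOpen O) {f h : ℝ × E3 × E3 → ℝ} {C : ℝ}
    (hf : Measurable f) (hfC : ∀ q, |f q| ≤ C) (hh : Measurable h) (hhC : ∀ q, |h q| ≤ C)
    (hshift : ∀ a : ℝ, 0 ≤ a → ∀ᵐ q, q ∈ backwardSet O a →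
      f q - f (shift (-a) q) = ∫ r in Ioc 0 a, h (shift (-r) q))
    {φ : ℝ × E3 × E3 → ℝ} (hφ : ContDiff ℝ ∞ φ) (hφc : HasCompactSupport φ) (hφO : tsupport φ ⊆ O) :
    -(∫ q in O, f q * fderiv ℝ φ q (1, q.2.2, 0)) = ∫ q in O, h q * φ q := by
  set J : ℝ → ℝ := fun r =>
    (∫ q, f q * transportDeriv φ (shift r q)) + ∫ q, h q * φ (shift r q) with hJ
  have hJc : Continuous J :=
    (continuous_integral_mul_comp_shift hf hfC (continuous_transportDeriv hφ)
      (hasCompactSupport_transportDeriv hφc)).add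
      (continuous_integral_mul_comp_shift hh hhC hφ.continuous hφc)
  obtain ⟨ε, hε, hεK⟩ := exists_subset_backwardSet hO hφc hφO
  have hint : ∀ a ∈ Ico 0 ε, ∫ r in (0:ℝ)..a, J r = 0 := by
    intro a ha
    rw [intervalIntegral.integral_of_le ha.1]
    rw [integral_weak_eq hf hfC hh hhC hφ hφc ha.1]
    rw [integral_eq_zero_of_ae]
    filter_upwards [hshift a ha.1] with q hq
    by_cases hqs : q ∈ tsupport φ
    · have := hq (hεK a ha hqs)
      rw [Pi.zero_apply, ← this]
      ring
    · have : φ q = 0 := by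
        by_contra hcon
        exact hqs (subset_tsupport _ hcon)
      rw [this, zero_mul, Pi.zero_apply]
  -- the primitive of the continuous function `J` vanishes on an interval `[0, ε)`
  have hJ0 : J 0 = 0 := by
    have h1 : HasDerivWithinAt (fun a => ∫ r in (0:ℝ)..a, J r) (J 0) (Ici 0) 0 :=
      (intervalIntegral.integral_hasDerivAt_right (hJc.intervalIntegrable _ _)
        (hJc.stronglyMeasurableAtFilter _ _) hJc.continuousAt).hasDerivWithinAt
    have h2 : HasDerivWithinAt (fun a => ∫ r in (0:ℝ)..a, J r) 0 (Ici 0) 0 := by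
      refine (hasDerivWithinAt_const (0:ℝ) (Ici (0:ℝ)) (0:ℝ)).congr_of_eventuallyEq ?_ (by simp)
      filter_upwards [Ico_mem_nhdsGE hε] with a ha using hint a ha
    exact (uniqueDiffWithinAt_Ici (0:ℝ)).eq_deriv _ h1 h2
  simp only [hJ, shift_zero] at hJ0
  have h2 : ∫ q in O, h q * φ q = ∫ q, h q * φ q := by
    refine setIntegral_eq_integral_of_forall_compl_eq_zero fun q hq => ?_
    have : φ q = 0 := by
      by_contra hcon
      exact hq (hφO (subset_tsupport _ hcon))
    rw [this, mul_zero]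
  have h3 : ∫ q in O, f q * fderiv ℝ φ q (1, q.2.2, 0) = ∫ q, f q * transportDeriv φ q := by
    refine setIntegral_eq_integral_of_forall_compl_eq_zero fun q hq => ?_
    have : fderiv ℝ φ q (1, q.2.2, 0) = 0 := transportDeriv_eq_zero fun h' => hq (hφO h')
    rw [this, mul_zero]
  rw [h2, h3]
  linarith

/-! ### The integral equation along the trajectories -/

/-- Projection of the real line onto the unit interval. -/
def clamp (x : ℝ) : ℝ := max 0 (min x 1)

lemma clamp_mem (x : ℝ) : clamp x ∈ Icc (0:ℝ) 1 :=
  ⟨le_max_left _ _, max_le zero_le_one (min_le_right _ _)⟩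

lemma clamp_of_mem {x : ℝ} (h : x ∈ Icc (0:ℝ) 1) : clamp x = x := by
  rw [clamp, min_eq_left h.2, max_eq_right h.1]

lemma clamp_of_nonpos {x : ℝ} (h : x ≤ 0) : clamp x = 0 :=
  max_eq_left ((min_le_left _ _).trans h)

lemma clamp_of_one_le {x : ℝ} (h : 1 ≤ x) : clamp x = 1 := by
  rw [clamp, min_eq_right h, max_eq_right zero_le_one]

lemma measurable_clamp : Measurable clamp :=
  measurable_const.max (measurable_id.min measurable_const)

lemma abs_clamp_sub_le (x y : ℝ) : |clamp x - clamp y| ≤ |x - y| := by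
  have h1 := abs_max_sub_max_le_max 0 (min x 1) 0 (min y 1)
  have h2 := abs_min_sub_min_le_max x 1 y 1
  rw [sub_self, abs_zero, max_eq_right (abs_nonneg (min x 1 - min y 1))] at h1
  rw [sub_self, abs_zero, max_eq_left (abs_nonneg (x - y))] at h2
  exact h1.trans h2

lemma integral_exp_le {l t : ℝ} (hl : 0 < l) (ht : 0 ≤ t) :
    ∫ s in Ioc 0 t, Real.exp (l * s) ≤ Real.exp (l * t) / l := by
  rw [← intervalIntegral.integral_of_le ht, intervalIntegral.integral_eq_sub_of_hasDerivAt
    (f := fun s => Real.exp (l * s) / l)]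
  · have : 0 < Real.exp (l * 0) / l := by positivity
    linarith
  · intro s _
    have := ((hasDerivAt_id s).const_mul l).exp.div_const l
    simpa [hl.ne'] using this
  · exact (by fun_prop : Continuous fun s => Real.exp (l * s)).intervalIntegrable _ _

/-- A bound of a source of the form `c e^{l s}` yields a bound of the same form for its
integral. -/
lemma abs_integral_le_of_le_exp {k : ℝ → ℝ} {c l t : ℝ} (hc : 0 ≤ c) (hl : 0 < l) (ht : 0 ≤ t)
    (hk : ∀ᵐ s ∂(volume.restrict (Ioc 0 t)), |k s| ≤ c * Real.exp (l * s)) :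
    |∫ s in Ioc 0 t, k s| ≤ c / l * Real.exp (l * t) := by
  have h1 : ‖∫ s in Ioc 0 t, k s‖ ≤ ∫ s in Ioc 0 t, c * Real.exp (l * s) :=
    norm_integral_le_of_norm_le
      ((by fun_prop : Continuous fun s => c * Real.exp (l * s)).integrableOn_Ioc) hk
  rw [integral_const_mul] at h1
  refine h1.trans ((mul_le_mul_of_nonneg_left (integral_exp_le hl ht) hc).trans_eq ?_)
  ring

section Existence

variable {b : E3 × S2 → ℝ} {f₀ : E3 × E3 → ℝ}

/-- The point reached by following the trajectory through `ζ` backwards for the time `r`; it is `0`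
outside the domain of the flow. -/
def backFlow (Ω : Set E3) (n : E3 → E3) (r : ℝ) (ζ : E3 × E3) : E3 × E3 :=
  flip (flow Ω n (r, flip ζ))

lemma measurable_backFlow (hΩ : IsRegularDomain Ω n) :
    Measurable fun p : ℝ × E3 × E3 => backFlow Ω n p.1 p.2 :=
  continuous_flip.measurable.comp ((measurable_flow hΩ).comp
    (measurable_fst.prodMk (continuous_flip.measurable.comp measurable_snd)))

lemma Reach.backFlow_eq (hΩ : IsRegularDomain Ω n) {t : ℝ} {z ζ : E3 × E3}
    (h : Reach Ω n t z ζ) : backFlow Ω n t ζ = z := by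
  rw [backFlow, (h.reverse hΩ).flow_eq hΩ.isOpen, flip_flip]

/-- The right-hand side of the integral equation: the initial datum plus the time integral of the
collision term along the trajectory which arrives at `(x, v)` at time `t`. The arguments of the
collision term are truncated to the unit interval. -/
def duhamel (Ω : Set E3) (n : E3 → E3) (b : E3 × S2 → ℝ) (f₀ : E3 × E3 → ℝ)
    (f : ℝ × E3 × E3 → ℝ) (q : ℝ × E3 × E3) : ℝ :=
  f₀ (backFlow Ω n q.1 q.2) +
    ∫ s in Ioc 0 q.1, Q b (fun p => clamp (f p)) (s, backFlow Ω n (q.1 - s) q.2)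

lemma measurable_duhamel_integrand (hΩ : IsRegularDomain Ω n) (hbm : Measurable b)
    {f : ℝ × E3 × E3 → ℝ} (hf : Measurable f) : Measurable fun p : (ℝ × E3 × E3) × ℝ =>
      Q b (fun p => clamp (f p)) (p.2, backFlow Ω n (p.1.1 - p.2) p.1.2) := by
  refine (measurable_Q hbm (measurable_clamp.comp hf)).comp (measurable_snd.prodMk ?_)
  exact (measurable_backFlow hΩ).comp (f := fun p : (ℝ × E3 × E3) × ℝ => (p.1.1 - p.2, p.1.2))
    (by fun_prop)

lemma measurable_duhamel (hΩ : IsRegularDomain Ω n) (hbm : Measurable b) (hf₀ : Measurable f₀)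
    {f : ℝ × E3 × E3 → ℝ} (hf : Measurable f) : Measurable (duhamel Ω n b f₀ f) := by
  refine (hf₀.comp (measurable_backFlow hΩ)).add ?_
  have h1 : ∀ q : ℝ × E3 × E3,
      ∫ s in Ioc 0 q.1, Q b (fun p => clamp (f p)) (s, backFlow Ω n (q.1 - s) q.2) =
      ∫ s, {p : (ℝ × E3 × E3) × ℝ | p.2 ∈ Ioc 0 p.1.1}.indicator (fun p =>
        Q b (fun p => clamp (f p)) (p.2, backFlow Ω n (p.1.1 - p.2) p.1.2)) (q, s) := by
    intro q
    rw [← integral_indicator measurableSet_Ioc]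
    rfl
  simp only [h1]
  refine (StronglyMeasurable.integral_prod_right' (f := fun p : (ℝ × E3 × E3) × ℝ =>
    {p : (ℝ × E3 × E3) × ℝ | p.2 ∈ Ioc 0 p.1.1}.indicator (fun p =>
        Q b (fun p => clamp (f p)) (p.2, backFlow Ω n (p.1.1 - p.2) p.1.2)) p) ?_).measurable
  refine ((measurable_duhamel_integrand hΩ hbm hf).indicator ?_).stronglyMeasurable
  have h2 : MeasurableSet {p : (ℝ × E3 × E3) × ℝ | 0 < p.2} := measurable_snd measurableSet_Ioi
  exact h2.inter (measurableSet_le measurable_snd (measurable_fst.comp measurable_fst))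

lemma integrableOn_duhamel (hΩ : IsRegularDomain Ω n) (hbm : Measurable b)
    (hb : Integrable b (volume.prod surface)) (hb0 : ∀ p, 0 ≤ b p)
    {f : ℝ × E3 × E3 → ℝ} (hf : Measurable f) (q : ℝ × E3 × E3) :
    IntegrableOn (fun s => Q b (fun p => clamp (f p)) (s, backFlow Ω n (q.1 - s) q.2))
      (Ioc 0 q.1) := by
  refine Measure.integrableOn_of_bounded (M := ∫ p, b p ∂(volume.prod surface)) (by simp) ?_
    (Eventually.of_forall fun s => abs_Q_le hbm hb hb0 (fun _ => clamp_mem _) _)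
  exact ((measurable_duhamel_integrand hΩ hbm hf).comp
    (measurable_prodMk_left (x := q))).aestronglyMeasurable

/-- The right-hand side of the integral equation is a contraction for a suitable weighted supremum
norm. -/
lemma abs_duhamel_sub_le (hΩ : IsRegularDomain Ω n) (hbm : Measurable b)
    (hb : Integrable b (volume.prod surface)) (hb0 : ∀ p, 0 ≤ b p)
    {f g : ℝ × E3 × E3 → ℝ} (hf : Measurable f) (hg : Measurable g) {M l : ℝ} (hM : 0 ≤ M)
    (hl : l = 16 * (∫ p, b p ∂(volume.prod surface)) + 1)
    (h : ∀ q, |f q - g q| ≤ M * Real.exp (l * |q.1|)) (q : ℝ × E3 × E3) :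
    |duhamel Ω n b f₀ f q - duhamel Ω n b f₀ g q| ≤ M * (1 / 2) * Real.exp (l * |q.1|) := by
  have hB : 0 ≤ ∫ p, b p ∂(volume.prod surface) := integral_nonneg hb0
  have hl0 : 0 < l := by rw [hl]; linarith
  rw [duhamel, duhamel, add_sub_add_left_eq_sub,
    ← integral_sub (integrableOn_duhamel hΩ hbm hb hb0 hf q)
      (integrableOn_duhamel hΩ hbm hb hb0 hg q)]
  rcases le_or_gt q.1 0 with hq | hq
  · rw [Ioc_eq_empty (not_lt.2 hq), setIntegral_empty, abs_zero]
    positivity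
  rw [abs_of_pos hq]
  refine (abs_integral_le_of_le_exp (c := 8 * (∫ p, b p ∂(volume.prod surface)) * M)
    (by positivity) hl0 hq.le ?_).trans ?_
  · refine (ae_restrict_iff' measurableSet_Ioc).2 (Eventually.of_forall fun s hs => ?_)
    rw [mul_assoc]
    refine abs_Q_sub_le hbm hb hb0 (measurable_clamp.comp hf) (measurable_clamp.comp hg)
      (fun _ => clamp_mem _) (fun _ => clamp_mem _) _ fun w => ?_
    refine (abs_clamp_sub_le _ _).trans ((h _).trans_eq ?_)
    simp only [abs_of_pos hs.1]
  · refine mul_le_mul_of_nonneg_right ?_ (Real.exp_pos _).le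
    rw [div_le_iff₀ hl0, hl]
    nlinarith

/-- Existence of a fixed point of the integral equation by Picard iteration. -/
lemma exists_duhamel_eq (hΩ : IsRegularDomain Ω n) (hbm : Measurable b)
    (hb : Integrable b (volume.prod surface)) (hb0 : ∀ p, 0 ≤ b p) (hf₀ : Measurable f₀)
    (hf₀' : ∀ z, f₀ z ∈ Icc (0:ℝ) 1) :
    ∃ f : ℝ × E3 × E3 → ℝ, Measurable f ∧ ∀ q, f q = duhamel Ω n b f₀ f q := by
  set B := ∫ p, b p ∂(volume.prod surface) with hBdef
  have hB : 0 ≤ B := integral_nonneg hb0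
  set l := 16 * B + 1 with hl
  let F : ℕ → ℝ × E3 × E3 → ℝ := fun k => (duhamel Ω n b f₀)^[k] fun _ => 0
  have hFs : ∀ k, F (k + 1) = duhamel Ω n b f₀ (F k) := fun k =>
    Function.iterate_succ_apply' _ _ _
  have hFm : ∀ k, Measurable (F k) := by
    intro k
    induction k with
    | zero => exact measurable_const
    | succ k ih =>
      rw [hFs]
      exact measurable_duhamel hΩ hbm hf₀ ih
  -- the constant `l` is so large that the first iterate is bounded by `e^{l |t|}` and that each
  -- further step gains a factor `1 / 2`
  have hstep : ∀ k q, |F k q - F (k + 1) q| ≤ (1 / 2) ^ k * Real.exp (l * |q.1|) := by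
    intro k
    induction k with
    | zero =>
      intro q
      rw [hFs]
      simp only [F, Function.iterate_zero, id, zero_sub, abs_neg, pow_zero, one_mul, duhamel]
      have h1 : ‖∫ s in Ioc 0 q.1, Q b (fun p => clamp ((fun _ => (0:ℝ)) p))
          (s, backFlow Ω n (q.1 - s) q.2)‖ ≤ B * |q.1| := by
        refine (norm_setIntegral_le_of_norm_le_const (C := B) (by simp) fun s _ =>
          abs_Q_le hbm hb hb0 (fun _ => clamp_mem _) _).trans ?_
        refine mul_le_mul_of_nonneg_left ?_ hB
        rw [Real.volume_real_Ioc, sub_zero]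
        exact max_le (le_abs_self _) (abs_nonneg _)
      have h2 : |f₀ (backFlow Ω n q.1 q.2)| ≤ 1 := by
        rw [abs_of_nonneg (hf₀' _).1]
        exact (hf₀' _).2
      have h3 := Real.add_one_le_exp (l * |q.1|)
      have h4 : B * |q.1| ≤ l * |q.1| :=
        mul_le_mul_of_nonneg_right (by rw [hl]; linarith) (abs_nonneg _)
      refine (abs_add_le _ _).trans ?_
      rw [Real.norm_eq_abs] at h1
      linarith
    | succ k ih =>
      intro q
      rw [hFs, hFs (k + 1), pow_succ]
      exact abs_duhamel_sub_le hΩ hbm hb hb0 (hFm k) (hFm (k + 1)) (by positivity) hl ih q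
  have hdist : ∀ q k, dist (F k q) (F (k + 1) q) ≤ Real.exp (l * |q.1|) * (1 / 2) ^ k := by
    intro q k
    rw [Real.dist_eq, mul_comm]
    exact hstep k q
  have hlim : ∀ q, ∃ y, Tendsto (fun k => F k q) atTop (𝓝 y) := fun q =>
    cauchySeq_tendsto_of_complete (cauchySeq_of_le_geometric _ _ (by norm_num) (hdist q))
  choose f hf using hlim
  have hfm : Measurable f := measurable_of_tendsto_metrizable hFm (tendsto_pi_nhds.2 hf)
  refine ⟨f, hfm, fun q => ?_⟩
  have hclose : ∀ k q, |F k q - f q| ≤ 2 * (1 / 2) ^ k * Real.exp (l * |q.1|) := by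
    intro k q
    have := dist_le_of_le_geometric_of_tendsto _ _ (by norm_num) (hdist q) (hf q) k
    rw [Real.dist_eq] at this
    refine this.trans_eq ?_
    ring
  -- the limit is a fixed point, by the same contraction estimate
  have h1 : Tendsto (fun k => F (k + 1) q) atTop (𝓝 (duhamel Ω n b f₀ f q)) := by
    rw [tendsto_iff_norm_sub_tendsto_zero]
    have h2 : Tendsto (fun k : ℕ => 2 * (1 / 2 : ℝ) ^ k * (1 / 2) * Real.exp (l * |q.1|))
        atTop (𝓝 0) := by
      have := ((tendsto_pow_atTop_nhds_zero_of_lt_one (r := (1 / 2 : ℝ)) (by norm_num)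
        (by norm_num)).const_mul 2).mul_const (1 / 2) |>.mul_const (Real.exp (l * |q.1|))
      simpa using this
    refine squeeze_zero (fun _ => norm_nonneg _) (fun k => ?_) h2
    rw [hFs]
    exact abs_duhamel_sub_le hΩ hbm hb hb0 (hFm k) hfm (by positivity) hl (hclose k) q
  exact tendsto_nhds_unique ((tendsto_add_atTop_iff_nat 1).2 (hf q)) h1

/-- A piece at the end of a trajectory can be cut off. -/
lemma Reach.sub_right (hΩ : IsRegularDomain Ω n) {s T : ℝ} {z z' z'' : E3 × E3}
    (h : Reach Ω n s z' z'') (h' : Reach Ω n T z z'') (hsT : s < T) : Reach Ω n (T - s) z z' := by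
  have := ((h.reverse hΩ).sub hΩ.isOpen (h'.reverse hΩ) hsT).reverse hΩ
  rwa [flip_flip, flip_flip] at this

lemma Reach.ae_split {T : ℝ} {z z' : E3 × E3} (h : Reach Ω n T z z') :
    ∀ᵐ s ∂(volume.restrict (Ioc 0 T)), ∃ z₁, Reach Ω n s z z₁ ∧ Reach Ω n (T - s) z₁ z' := by
  rw [← restrict_Ioo_eq_restrict_Ioc, ae_restrict_iff' measurableSet_Ioo]
  filter_upwards [h.countable_not_split.ae_notMem volume] with s hs hsT
  by_contra hcon
  exact hs ⟨hsT, hcon⟩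

/-- Bounded measurable functions can be integrated along trajectories. -/
lemma Reach.integrableOn_comp_traj (hΩ : IsRegularDomain Ω n) {T : ℝ} {z z' : E3 × E3}
    (h : Reach Ω n T z z') {k : ℝ × E3 × E3 → ℝ} (hk : Measurable k) {C : ℝ}
    (hC : ∀ q, |k q| ≤ C) : IntegrableOn (fun s => k (s, traj Ω n s z)) (Ioc 0 T) := by
  refine Integrable.of_bound ?_ C (Eventually.of_forall fun s => hC _)
  have h1 : Measurable fun s => k (s, flow Ω n (s, z)) :=
    hk.comp (measurable_id.prodMk ((measurable_flow hΩ).comp measurable_prodMk_right))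
  refine h1.aestronglyMeasurable.congr ?_
  filter_upwards [h.ae_split] with s ⟨z₁, hs, _⟩
  rw [hs.flow_eq hΩ.isOpen, hs.traj_eq hΩ.isOpen]

/-- A solution of the integral equation, followed along a trajectory. -/
lemma Reach.eq_of_duhamel_eq (hΩ : IsRegularDomain Ω n) {f : ℝ × E3 × E3 → ℝ}
    (hf : ∀ q, f q = duhamel Ω n b f₀ f q) {t : ℝ} {z ζ : E3 × E3} (h : Reach Ω n t z ζ) :
    f (t, ζ) = f₀ z + ∫ s in Ioc 0 t, Q b (fun p => clamp (f p)) (s, traj Ω n s z) := by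
  rw [hf, duhamel, h.backFlow_eq hΩ]
  congr 1
  refine integral_congr_ae ?_
  filter_upwards [h.ae_split] with s ⟨z₁, hs, hs'⟩
  rw [hs'.backFlow_eq hΩ, hs.traj_eq hΩ.isOpen]

/-- A primitive which decreases wherever it exceeds `1` stays below `1`. -/
lemma le_one_of_primitive {U h : ℝ → ℝ} {T : ℝ} (hT : 0 ≤ T) (hh : IntegrableOn h (Ioc 0 T))
    (hU : ∀ t ∈ Icc 0 T, U t = U 0 + ∫ s in Ioc 0 t, h s) (hU0 : U 0 ≤ 1)
    (hneg : ∀ᵐ s ∂(volume.restrict (Ioc 0 T)), 1 ≤ U s → h s ≤ 0) : U T ≤ 1 := by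
  have hint : IntegrableOn h (uIcc 0 T) := by
    rw [uIcc_of_le hT, integrableOn_Icc_iff_integrableOn_Ioc]
    exact hh
  have hcont : ContinuousOn U (Icc 0 T) := by
    have h1 := intervalIntegral.continuousOn_primitive_interval hint
    rw [uIcc_of_le hT] at h1
    refine ((continuousOn_const (c := U 0)).add h1).congr fun t ht => ?_
    rw [Pi.add_apply]
    rw [intervalIntegral.integral_of_le ht.1]
    exact hU t ht
  by_contra! hcon
  set S := Icc 0 T ∩ U ⁻¹' Iic 1 with hS
  have hSc : IsCompact S :=
    isCompact_Icc.of_isClosed_subset (hcont.preimage_isClosed_of_isClosed isClosed_Icc isClosed_Iic)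
      inter_subset_left
  -- the last time at which the value is at most `1`
  obtain ⟨a, ⟨haT, ha⟩, hmax⟩ := hSc.exists_isGreatest ⟨0, ⟨le_rfl, hT⟩, hU0⟩
  have h1 : ∫ s in Ioc 0 T, h s = (∫ s in Ioc 0 a, h s) + ∫ s in Ioc a T, h s := by
    rw [← Ioc_union_Ioc_eq_Ioc haT.1 haT.2]
    exact setIntegral_union (Ioc_disjoint_Ioc_of_le le_rfl) measurableSet_Ioc
      (hh.mono_set (Ioc_subset_Ioc_right haT.2)) (hh.mono_set (Ioc_subset_Ioc_left haT.1))
  have h2 : ∫ s in Ioc a T, h s ≤ 0 := by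
    refine integral_nonpos_of_ae ?_
    have h3 := ae_restrict_of_ae_restrict_of_subset (Ioc_subset_Ioc_left haT.1) hneg
    filter_upwards [h3, ae_restrict_mem measurableSet_Ioc] with s hs hsa
    refine hs ?_
    by_contra! hlt
    exact absurd (hmax ⟨⟨haT.1.trans hsa.1.le, hsa.2⟩, hlt.le⟩) (not_le.2 hsa.1)
  have h3 := hU T ⟨hT, le_rfl⟩
  have h4 := hU a haT
  have h5 : U a ≤ 1 := ha
  linarith

/-- Pauli's exclusion principle: the gain term vanishes where the distribution is saturated, the
loss term where it is zero; so the truncation is never active. -/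
lemma Reach.mem_Icc_of_duhamel_eq (hΩ : IsRegularDomain Ω n) (hbm : Measurable b)
    (hb : Integrable b (volume.prod surface)) (hb0 : ∀ p, 0 ≤ b p)
    (hf₀' : ∀ z, f₀ z ∈ Icc (0:ℝ) 1) {f : ℝ × E3 × E3 → ℝ} (hfm : Measurable f)
    (hf : ∀ q, f q = duhamel Ω n b f₀ f q) {t : ℝ} {z ζ : E3 × E3} (h : Reach Ω n t z ζ) :
    f (t, ζ) ∈ Icc (0:ℝ) 1 := by
  set k : ℝ → ℝ := fun s => Q b (fun p => clamp (f p)) (s, traj Ω n s z) with hk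
  set U : ℝ → ℝ := fun t => f₀ z + ∫ s in Ioc 0 t, k s with hU
  have hki : IntegrableOn k (Ioc 0 t) := h.integrableOn_comp_traj hΩ
    (measurable_Q hbm (measurable_clamp.comp hfm)) (abs_Q_le hbm hb hb0 fun _ => clamp_mem _)
  have hU0 : U 0 = f₀ z := by simp [hU]
  have hUs : ∀ᵐ s ∂(volume.restrict (Ioc 0 t)), f (s, traj Ω n s z) = U s := by
    filter_upwards [h.ae_split] with s ⟨z₁, hs, hs'⟩
    rw [hs.traj_eq hΩ.isOpen]
    exact hs.eq_of_duhamel_eq hΩ hf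
  rw [h.eq_of_duhamel_eq hΩ hf]
  change U t ∈ Icc (0:ℝ) 1
  constructor
  · have h1 := le_one_of_primitive (U := fun s => 1 - U s) (h := fun s => -k s) h.pos.le hki.neg
      (fun s _ => by simp only [hU, integral_neg]; simp; ring) (by linarith [(hf₀' z).1, hU0]) ?_
    · linarith
    · filter_upwards [hUs] with s hs hle
      have h2 : clamp (f (s, traj Ω n s z)) = 0 := clamp_of_nonpos (by linarith)
      linarith [Q_nonneg hb0 (f := fun p => clamp (f p)) (fun _ => clamp_mem _) h2]
  · refine le_one_of_primitive h.pos.le hki (fun s _ => by simp [hU]) (hU0.trans_le (hf₀' z).2) ?_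
    filter_upwards [hUs] with s hs hle
    have h2 : clamp (f (s, traj Ω n s z)) = 1 := clamp_of_one_le (by linarith)
    exact Q_nonpos hb0 (f := fun p => clamp (f p)) (fun _ => clamp_mem _) h2

/-- A function which is the primitive of a bounded source along all trajectories satisfies the
transport equation in integrated form. -/
lemma shift_of_mild (hΩ : IsRegularDomain Ω n) {f k : ℝ × E3 × E3 → ℝ} {C : ℝ}
    (hk : Measurable k) (hkC : ∀ q, |k q| ≤ C)
    (hf : ∀ {t : ℝ} {z ζ : E3 × E3}, Reach Ω n t z ζ →
      f (t, ζ) = f₀ z + ∫ s in Ioc 0 t, k (s, traj Ω n s z)) {a : ℝ} (ha : 0 ≤ a) :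
    ∀ᵐ q, q ∈ backwardSet (timePhase Ω) a →
      f q - f (shift (-a) q) = ∫ r in Ioc 0 a, k (shift (-r) q) := by
  filter_upwards [(ae_timePhase_iff hΩ.isOpen).1 (ae_flip_mem_flowDomain hΩ)] with ⟨t, ζ⟩ hq hqa
  rcases ha.eq_or_lt with rfl | ha
  · simp
  have hmem : ∀ r ∈ Icc 0 a, 0 < t - r ∧ ζ.1 - r • ζ.2 ∈ Ω := by
    intro r hr
    have := mem_timePhase.1 (hqa r hr)
    simpa [shift, sub_eq_add_neg] using this
  have h0 := hmem 0 ⟨le_rfl, ha.le⟩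
  have hr : Reach Ω n t (flip ζ) (traj Ω n t (flip ζ)) := hq (by simpa using h0.1)
    (by simpa using h0.2)
  have hr' := hr.reverse hΩ
  rw [flip_flip] at hr'
  set z := flip (traj Ω n t (flip ζ)) with hz
  -- the last piece of the trajectory of `z`, of duration `a`, is a free flight
  have hback : ∀ r ∈ Icc 0 a, Reach Ω n (t - r) z (free (-r) ζ) := by
    intro r hra
    rcases hra.1.eq_or_lt with rfl | hr0
    · simpa using hr'
    have h1 : Reach Ω n r (free (-r) ζ) ζ := by
      have := Reach.free (Ω := Ω) (n := n) (z := free (-r) ζ) hr0 fun s hs => ?_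
      · rwa [free_free, neg_add_cancel, free_zero] at this
      · have := (hmem (r - s) ⟨by linarith [hs.2], by linarith [hs.1, hra.2]⟩).2
        convert this using 1
        simp only [free_fst, free_snd]
        module
    exact h1.sub_right hΩ hr' (by linarith [(hmem r hra).1])
  have hshift : ∀ r, shift (-r) (t, ζ) = (t - r, free (-r) ζ) := fun r => by
    simp [shift, free, sub_eq_add_neg]
  have ht := (hmem a ⟨ha.le, le_rfl⟩).1
  have hki := hr'.integrableOn_comp_traj hΩ hk hkC
  rw [hshift, hf hr', hf (hback a ⟨ha.le, le_rfl⟩), add_sub_add_left_eq_sub]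
  have h1 : ∫ s in Ioc 0 t, k (s, traj Ω n s z) =
      (∫ s in Ioc 0 (t - a), k (s, traj Ω n s z)) + ∫ s in Ioc (t - a) t, k (s, traj Ω n s z) := by
    rw [← setIntegral_union (Ioc_disjoint_Ioc_of_le le_rfl) measurableSet_Ioc
      (hki.mono_set (Ioc_subset_Ioc_right (by linarith)))
      (hki.mono_set (Ioc_subset_Ioc_left ht.le)), Ioc_union_Ioc_eq_Ioc ht.le (by linarith)]
  rw [h1, add_sub_cancel_left, ← intervalIntegral.integral_of_le (by linarith),
    ← intervalIntegral.integral_of_le ha.le]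
  have h2 := intervalIntegral.integral_comp_sub_left (a := 0) (b := a)
    (fun s => k (s, traj Ω n s z)) t
  rw [sub_zero] at h2
  rw [← h2]
  refine intervalIntegral.integral_congr fun r hra => ?_
  rw [uIcc_of_le ha.le] at hra
  simp only [hshift, (hback r hra).traj_eq hΩ.isOpen]

end Existence

/-! ### Existence of a solution -/

section Solution

variable {b : E3 × S2 → ℝ} {f₀ : E3 × E3 → ℝ}

lemma IsRegularPoint.integrableOn_comp_traj (hΩ : IsRegularDomain Ω n) {z : E3 × E3}
    (hz : IsRegularPoint Ω n z) {k : ℝ × E3 × E3 → ℝ} (hk : Measurable k) {C : ℝ}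
    (hC : ∀ q, |k q| ≤ C) (T : ℝ) : IntegrableOn (fun s => k (s, traj Ω n s z)) (Ioc 0 T) := by
  obtain ⟨T', hT', hr⟩ := hz.2 T
  have hr' : Reach Ω n T' z (traj Ω n T' z) := hr
  exact (hr'.integrableOn_comp_traj hΩ hk hC).mono_set (Ioc_subset_Ioc_right hT'.le)

/-- The primitive of a bounded source along a trajectory is Lipschitz continuous in time. -/
lemma IsRegularPoint.lipschitzOnWith (hΩ : IsRegularDomain Ω n) {z : E3 × E3}
    (hz : IsRegularPoint Ω n z) {k : ℝ × E3 × E3 → ℝ} (hk : Measurable k) {C : ℝ}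
    (hC : ∀ q, |k q| ≤ C) (c : ℝ) :
    LipschitzOnWith C.toNNReal (fun t => c + ∫ s in Ioc 0 t, k (s, traj Ω n s z)) (Ici 0) := by
  have hC0 : 0 ≤ C := (abs_nonneg _).trans (hC 0)
  have hi : ∀ t ∈ Ici (0:ℝ),
      IntervalIntegrable (fun s => k (s, traj Ω n s z)) volume 0 t := fun t ht =>
    (intervalIntegrable_iff_integrableOn_Ioc_of_le ht).2 (hz.integrableOn_comp_traj hΩ hk hC t)
  refine LipschitzOnWith.of_dist_le_mul fun t ht s hs => ?_
  rw [Real.coe_toNNReal _ hC0, dist_add_left, Real.dist_eq,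
    ← intervalIntegral.integral_of_le ht, ← intervalIntegral.integral_of_le hs,
    intervalIntegral.integral_interval_sub_left (hi t ht) (hi s hs), ← Real.norm_eq_abs]
  exact intervalIntegral.norm_integral_le_of_norm_le_const fun r _ => hC _

/-- The representative of a solution whose values along the trajectories are right for all times:
the values at time `0` are those of the initial datum, and the values at the boundary are limits
along the outgoing direction. -/
def representative (Ω : Set E3) (f₀ : E3 × E3 → ℝ) (f : ℝ × E3 × E3 → ℝ) (q : ℝ × E3 × E3) : ℝ :=
  open Classical in
  if q.1 ≤ 0 then f₀ q.2 else if q.2.1 ∈ Ω then f q else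
    limUnder atTop fun k : ℕ => f (q.1 + 1 / (k + 1 : ℝ), free (1 / (k + 1 : ℝ)) q.2)

lemma representative_eq {f : ℝ × E3 × E3 → ℝ} {q : ℝ × E3 × E3} (hq : 0 < q.1) (hq' : q.2.1 ∈ Ω) :
    representative Ω f₀ f q = f q := by
  rw [representative, if_neg (not_le.2 hq), if_pos hq']

/-- Along a regular trajectory the representative is the primitive of the source at all times, in
particular at the reflection times. -/
lemma sharp_representative (hΩ : IsRegularDomain Ω n) {f k : ℝ × E3 × E3 → ℝ} {C : ℝ}
    (hk : Measurable k) (hkC : ∀ q, |k q| ≤ C)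
    (hf : ∀ {t : ℝ} {z ζ : E3 × E3}, Reach Ω n t z ζ →
      f (t, ζ) = f₀ z + ∫ s in Ioc 0 t, k (s, traj Ω n s z)) {z : E3 × E3}
    (hz : IsRegularPoint Ω n z) {t : ℝ} (ht : 0 ≤ t) :
    sharp Ω n (representative Ω f₀ f) t z = f₀ z + ∫ s in Ioc 0 t, k (s, traj Ω n s z) := by
  rw [sharp]
  rcases ht.eq_or_lt with rfl | ht0
  · rw [traj_zero (hitTime_pos_of_mem hΩ.isOpen hz.1), representative, if_pos le_rfl]
    simp
  -- a free flight follows the time `t`, whether or not this is a reflection time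
  obtain ⟨T, hT, hr⟩ := hz.2 t
  have hev := Reach.eventually_free_right hΩ.isOpen
    (show Reach Ω n T z (traj Ω n T z) from hr) t ⟨ht, hT⟩
  by_cases hmem : (traj Ω n t z).1 ∈ Ω
  · rw [representative_eq ht0 hmem]
    refine hf ?_
    have hc : ContinuousAt (fun r : ℝ => (traj Ω n t z).1 + r • (traj Ω n t z).2) 0 := by fun_prop
    obtain ⟨ε, hε, hball⟩ := Metric.eventually_nhds_iff_ball.1
      (hc.eventually (hΩ.isOpen.mem_nhds (by simpa using hmem)))
    obtain ⟨s, hs, hs0, hsε⟩ := (hev.and (Ioo_mem_nhdsGT hε)).exists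
    have h1 : Reach Ω n s (traj Ω n t z) (free s (traj Ω n t z)) := by
      refine Reach.free hs0 fun r hr => hball r ?_
      rw [Metric.mem_ball, Real.dist_eq, sub_zero, abs_of_nonneg hr.1]
      exact hr.2.trans_lt hsε
    have := h1.sub_right hΩ hs (by linarith)
    rwa [add_sub_cancel_right] at this
  · rw [representative, if_neg (not_le.2 ht0), if_neg hmem]
    refine Tendsto.limUnder_eq ?_
    have h1 : Tendsto (fun k : ℕ => 1 / (k + 1 : ℝ)) atTop (𝓝[>] 0) :=
      tendsto_nhdsWithin_iff.2 ⟨tendsto_one_div_add_atTop_nhds_zero_nat,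
        Eventually.of_forall fun k => by simp only [mem_Ioi]; positivity⟩
    have h2 : Tendsto (fun j : ℕ => t + 1 / (j + 1 : ℝ)) atTop (𝓝[Ici 0] t) := by
      refine tendsto_nhdsWithin_iff.2 ⟨?_, Eventually.of_forall fun j => ?_⟩
      · simpa using (tendsto_one_div_add_atTop_nhds_zero_nat (𝕜 := ℝ)).const_add t
      · simp only [mem_Ici]; positivity
    have h3 := ((hz.lipschitzOnWith hΩ hk hkC (f₀ z)).continuousOn t ht).tendsto.comp h2
    refine h3.congr' ?_
    filter_upwards [h1.eventually hev] with j hj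
    exact (hf hj).symm

lemma locallyIntegrable_of_bounded {f : ℝ × E3 × E3 → ℝ} {C : ℝ} (hf : Measurable f)
    (hC : ∀ q, |f q| ≤ C) : LocallyIntegrable f :=
  (locallyIntegrable_const C).mono hf.aestronglyMeasurable
    (Eventually.of_forall fun q => (hC q).trans (le_abs_self _))

lemma IsWeakTransport.congr {f f' h h' : ℝ × E3 × E3 → ℝ}
    (hf : f =ᵐ[volume.restrict (timePhase Ω)] f') (hh : h =ᵐ[volume.restrict (timePhase Ω)] h')
    (H : IsWeakTransport Ω f h) : IsWeakTransport Ω f' h' := by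
  have key : ∀ {u u' : ℝ × E3 × E3 → ℝ}, u =ᵐ[volume.restrict (timePhase Ω)] u' →
      LocallyIntegrableOn u (timePhase Ω) → LocallyIntegrableOn u' (timePhase Ω) := by
    intro u u' huu hu q hq
    obtain ⟨s, hs, hsi⟩ := hu q hq
    refine ⟨s ∩ timePhase Ω, inter_mem hs self_mem_nhdsWithin, ?_⟩
    exact (hsi.mono_set inter_subset_left).congr
      (ae_restrict_of_ae_restrict_of_subset inter_subset_right huu)
  refine ⟨key hf H.1, key hh H.2.1, fun φ h1 h2 h3 => ?_⟩
  have e1 : ∫ q in timePhase Ω, f q * fderiv ℝ φ q (1, q.2.2, 0) =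
      ∫ q in timePhase Ω, f' q * fderiv ℝ φ q (1, q.2.2, 0) :=
    integral_congr_ae (hf.mono fun q hq => by simp only [hq])
  have e2 : ∫ q in timePhase Ω, h q * φ q = ∫ q in timePhase Ω, h' q * φ q :=
    integral_congr_ae (hh.mono fun q hq => by simp only [hq])
  rw [← e1, ← e2]
  exact H.2.2 φ h1 h2 h3

theorem exists_solution (hΩ : IsRegularDomain Ω n) (hbm : Measurable b)
    (hb : Integrable b (volume.prod surface)) (hb0 : ∀ p, 0 ≤ b p) (hf₀ : Measurable f₀)
    (hf₀' : ∀ z, f₀ z ∈ Icc (0:ℝ) 1) :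
    ∃ f : ℝ × E3 × E3 → ℝ, IsSolution Ω n b f₀ f ∧ IsAdmissible Ω f ∧
      ∀ᵐ z ∂(volume.restrict (phase Ω)), ∀ T : ℝ, 0 ≤ T →
        AbsolutelyContinuousOnInterval (fun t => sharp Ω n f t z) 0 T := by
  obtain ⟨g, hgm, hg⟩ := exists_duhamel_eq hΩ hbm hb hb0 hf₀ hf₀'
  set f : ℝ × E3 × E3 → ℝ := fun q => clamp (g q) with hfdef
  have hfm : Measurable f := measurable_clamp.comp hgm
  have hf01 : ∀ q, f q ∈ Icc (0:ℝ) 1 := fun q => clamp_mem _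
  have hf1 : ∀ q, |f q| ≤ 1 := fun q => by
    rw [abs_of_nonneg (hf01 q).1]
    exact (hf01 q).2
  have hQm : Measurable (Q b f) := measurable_Q hbm hfm
  have hQ := abs_Q_le hbm hb hb0 hf01
  set B := ∫ p, b p ∂(volume.prod surface) with hB
  have hmild : ∀ {t : ℝ} {z ζ : E3 × E3}, Reach Ω n t z ζ →
      f (t, ζ) = f₀ z + ∫ s in Ioc 0 t, Q b f (s, traj Ω n s z) := by
    intro t z ζ h
    rw [hfdef]
    simp only
    rw [clamp_of_mem (h.mem_Icc_of_duhamel_eq hΩ hbm hb hb0 hf₀' hgm hg)]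
    exact h.eq_of_duhamel_eq hΩ hg
  set F := representative Ω f₀ f with hF
  have hFf : ∀ q ∈ timePhase Ω, F q = f q := fun q hq =>
    representative_eq (mem_timePhase.1 hq).1 (mem_timePhase.1 hq).2
  have hmeas : MeasurableSet (timePhase Ω) := (isOpen_timePhase hΩ.isOpen).measurableSet
  have hae : f =ᵐ[volume.restrict (timePhase Ω)] F := by
    filter_upwards [ae_restrict_mem hmeas] with q hq using (hFf q hq).symm
  have hcoll : ∀ q ∈ timePhase Ω, (fun w => F (q.1, q.2.1, w)) = fun w => f (q.1, q.2.1, w) :=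
    fun q hq => funext fun w => hFf _ (mem_timePhase.2 (mem_timePhase.1 hq))
  have hQae : Q b f =ᵐ[volume.restrict (timePhase Ω)] Q b F := by
    filter_upwards [ae_restrict_mem hmeas] with q hq
    rw [Q, Q, hcoll q hq]
  have hreg := (ae_phase_iff hΩ.isOpen).2 (ae_isRegularPoint hΩ)
  have hlip : ∀ z, IsRegularPoint Ω n z →
      LipschitzOnWith B.toNNReal (fun t => sharp Ω n F t z) (Ici 0) := fun z hz =>
    fun t ht s hs => by
      have := hz.lipschitzOnWith hΩ hQm hQ (f₀ z) ht hs
      simp only at this ⊢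
      rwa [← sharp_representative hΩ hQm hQ hmild hz ht,
        ← sharp_representative hΩ hQm hQ hmild hz hs] at this
  refine ⟨F, ⟨?_, ?_, ?_, ?_⟩, ⟨?_, ?_⟩, ?_⟩
  · filter_upwards [ae_restrict_mem hmeas] with q hq
    rw [hcoll q hq]
    exact integrable_collisionIntegrand hbm hb hfm hf01 q
  · refine IsWeakTransport.congr hae hQae
      ⟨(locallyIntegrable_of_bounded hfm hf1).locallyIntegrableOn _,
        (locallyIntegrable_of_bounded hQm hQ).locallyIntegrableOn _, fun φ h1 h2 h3 => ?_⟩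
    exact weak_of_shift (C := max 1 B) (isOpen_timePhase hΩ.isOpen) hfm
      (fun q => (hf1 q).trans (le_max_left _ _)) hQm (fun q => (hQ q).trans (le_max_right _ _))
      (fun a ha => shift_of_mild hΩ hQm hQ hmild ha) h1 h2 h3
  · exact Eventually.of_forall fun z => if_pos le_rfl
  · filter_upwards [hreg] with z hz using (hlip z hz).continuousOn
  · refine MemLp.ae_eq hae (memLp_top_of_bound hfm.aestronglyMeasurable 1
      (Eventually.of_forall hf1))
  · filter_upwards [hae] with q hq
    rw [← hq]
    exact hf01 q
  · filter_upwards [hreg] with z hz T hT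
    refine ((hlip z hz).mono ?_).absolutelyContinuousOnInterval
    rw [uIcc_of_le hT]
    exact Icc_subset_Ici_self

end Solution

/-! ### Uniqueness of the solution -/

section Uniqueness

variable {b : E3 × S2 → ℝ} {f₀ : E3 × E3 → ℝ}

lemma ae_timePhase_of_ae_ae (hΩ : IsOpen Ω) {P : ℝ × E3 × E3 → Prop}
    (hPm : MeasurableSet {q | P q})
    (h : ∀ᵐ t : ℝ, ∀ᵐ x : E3, ∀ᵐ v : E3, 0 < t → x ∈ Ω → P (t, x, v)) :
    ∀ᵐ q ∂(volume.restrict (timePhase Ω)), P q := by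
  rw [ae_timePhase_iff hΩ]
  have hm : MeasurableSet {q : ℝ × E3 × E3 | 0 < q.1 → q.2.1 ∈ Ω → P q} := by
    have h2 : MeasurableSet {q : ℝ × E3 × E3 | 0 < q.1} := measurable_fst measurableSet_Ioi
    have h3 : MeasurableSet {q : ℝ × E3 × E3 | q.2.1 ∈ Ω} :=
      (measurable_fst.comp measurable_snd) hΩ.measurableSet
    exact h2.imp (h3.imp hPm)
  rw [Measure.volume_eq_prod, Measure.ae_prod_iff_ae_ae hm]
  filter_upwards [h] with t ht
  have hmt : MeasurableSet {y : E3 × E3 | 0 < t → y.1 ∈ Ω → P (t, y)} :=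
    (measurable_prodMk_left (x := t)) hm
  rw [Measure.volume_eq_prod]
  exact (Measure.ae_prod_iff_ae_ae hmt).2 ht

/-- A continuous function all of whose increments with rational step vanish at almost all points is
constant. -/
lemma eq_of_ae_increments {u : ℝ → ℝ} {α β : ℝ} (hu : ContinuousOn u (Ioo α β))
    (h : ∀ a : ℚ, 0 ≤ a → ∀ᵐ t : ℝ, t ∈ Ioo α β → t - a ∈ Ioo α β → u t = u (t - a)) :
    ∀ t ∈ Ioo α β, ∀ t' ∈ Ioo α β, u t = u t' := by
  have h1 : ∀ a : ℚ, 0 ≤ a → ∀ t ∈ Ioo (α + a) β, u t = u (t - a) := by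
    intro a ha
    have ha' : (0:ℝ) ≤ a := by exact_mod_cast ha
    refine Measure.eqOn_open_of_ae_eq (μ := volume) (f := u) (g := fun t => u (t - a)) ?_ isOpen_Ioo
      (hu.mono (Ioo_subset_Ioo_left (by linarith))) ?_
    · filter_upwards [ae_restrict_of_ae (h a ha), ae_restrict_mem measurableSet_Ioo] with t ht hta
      exact ht ⟨by linarith [hta.1], hta.2⟩ ⟨by linarith [hta.1], by linarith [hta.2]⟩
    · refine hu.comp (by fun_prop) fun t ht => ?_
      exact ⟨by linarith [ht.1], by linarith [ht.2]⟩
  -- real steps are limits of rational ones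
  have h2 : ∀ t ∈ Ioo α β, ∀ t' ∈ Ioo α β, t' < t → u t = u t' := by
    intro t ht t' ht' htt
    by_contra hne
    have hc : ContinuousAt u t' := hu.continuousAt (Ioo_mem_nhds ht'.1 ht'.2)
    obtain ⟨ε, hε, hball⟩ := Metric.eventually_nhds_iff_ball.1
      (hc.eventually_ne (Ne.symm hne))
    obtain ⟨a, ha1, ha2⟩ := exists_rat_btwn (show t - t' < min (t - t' + ε) (t - α) by
      exact lt_min (by linarith) (by linarith [ht'.1]))
    have ha3 := lt_min_iff.1 ha2
    refine hball (t - a) ?_ (h1 a ?_ t ⟨by linarith, ht.2⟩).symm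
    · rw [Metric.mem_ball, Real.dist_eq, abs_lt]
      constructor <;> linarith
    · have : (0:ℝ) ≤ a := by linarith
      exact_mod_cast this
  intro t ht t' ht'
  rcases lt_trichotomy t t' with hlt | rfl | hlt
  · exact (h2 t' ht' t ht hlt).symm
  · rfl
  · exact h2 t ht t' ht' hlt

/-- A function which satisfies the transport equation in integrated form at almost all times along
a trajectory and is continuous along it is the primitive of the source. -/
lemma IsRegularPoint.eq_primitive (hΩ : IsRegularDomain Ω n) {z : E3 × E3}
    (hz : IsRegularPoint Ω n z) {g k : ℝ × E3 × E3 → ℝ} {C : ℝ} (hk : Measurable k)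
    (hkC : ∀ q, |k q| ≤ C) (hc : ContinuousOn (fun t => sharp Ω n g t z) (Ici 0))
    (hinc : ∀ᵐ t : ℝ, (t, z) ∈ flowDomain Ω n → ∀ a : ℚ, 0 ≤ a →
      (t, traj Ω n t z) ∈ backwardSet (timePhase Ω) a →
      g (t, traj Ω n t z) - g (shift (-a) (t, traj Ω n t z)) =
        ∫ r in Ioc 0 (a : ℝ), k (shift (-r) (t, traj Ω n t z))) {T : ℝ} (hT : 0 ≤ T) :
    g (T, traj Ω n T z) = g (0, z) + ∫ s in Ioc 0 T, k (s, traj Ω n s z) := by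
  set H : ℝ → ℝ := fun s => k (s, traj Ω n s z) with hH
  have hHi : ∀ t ∈ Ici (0:ℝ), IntervalIntegrable H volume 0 t := fun t ht =>
    (intervalIntegrable_iff_integrableOn_Ioc_of_le ht).2 (hz.integrableOn_comp_traj hΩ hk hkC t)
  set u : ℝ → ℝ := fun t => sharp Ω n g t z - (0 + ∫ s in Ioc 0 t, H s) with hu
  have huc : ContinuousOn u (Ici 0) := hc.sub (hz.lipschitzOnWith hΩ hk hkC 0).continuousOn
  -- between the reflections the trajectory is a free flight, along which `u` is locally constant
  have hderiv : ∀ t₀, 0 < t₀ → (t₀, z) ∈ flowDomain Ω n → HasDerivAt u 0 t₀ := by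
    intro t₀ ht₀ hE
    have hr : Reach Ω n t₀ z (traj Ω n t₀ z) := hE
    set z₀ := traj Ω n t₀ z with hz₀
    obtain ⟨ε, hε, hball⟩ := Metric.eventually_nhds_iff_ball.1 (hr.eventually_free hΩ.isOpen)
    have hJ : ∀ t ∈ Ioo (t₀ - ε) (t₀ + ε), Reach Ω n t z (free (t - t₀) z₀) := by
      intro t ht
      refine hball t ?_
      rw [Real.ball_eq_Ioo]
      exact ht
    have hconst := eq_of_ae_increments (u := u) (α := t₀ - ε) (β := t₀ + ε)
      (huc.mono fun t ht => (hJ t ht).pos.le) fun a ha => ?_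
    · refine (hasDerivAt_const t₀ (u t₀)).congr_of_eventuallyEq ?_
      filter_upwards [Ioo_mem_nhds (show t₀ - ε < t₀ by linarith) (show t₀ < t₀ + ε by linarith)]
        with t ht
      exact hconst t ht t₀ ⟨by linarith, by linarith⟩
    · have ha' : (0:ℝ) ≤ a := by exact_mod_cast ha
      filter_upwards [hinc] with t ht htJ htaJ
      have hmid : ∀ r ∈ Icc 0 (a : ℝ), Reach Ω n (t - r) z (free (t - r - t₀) z₀) ∧
          shift (-r) (t, traj Ω n t z) = (t - r, traj Ω n (t - r) z) := by
        intro r hra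
        have h1 := hJ (t - r) ⟨by linarith [htaJ.1, hra.2], by linarith [htJ.2, hra.1]⟩
        refine ⟨h1, ?_⟩
        rw [h1.traj_eq hΩ.isOpen, (hJ t htJ).traj_eq hΩ.isOpen]
        simp only [shift, free, Prod.mk.injEq, and_true]
        constructor
        · ring
        · module
      have h1 := ht ((hJ t htJ).mem_flowDomain hΩ.isOpen) a ha (fun r hra => by
        rw [(hmid r hra).2, mem_timePhase, (hmid r hra).1.traj_eq hΩ.isOpen]
        exact ⟨(hmid r hra).1.pos, (hmid r hra).1.mem_right⟩)
      rw [(hmid a ⟨ha', le_rfl⟩).2, ← intervalIntegral.integral_of_le ha'] at h1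
      have h2 : ∫ r in (0:ℝ)..a, k (shift (-r) (t, traj Ω n t z)) = ∫ s in (t - a)..t, H s := by
        have h3 := intervalIntegral.integral_comp_sub_left (a := 0) (b := (a : ℝ)) H t
        rw [sub_zero] at h3
        rw [← h3]
        refine intervalIntegral.integral_congr fun r hra => ?_
        rw [uIcc_of_le ha'] at hra
        simp only [(hmid r hra).2, hH]
      have ht0 := (hJ t htJ).pos.le
      have hta0 := (hJ _ htaJ).pos.le
      rw [h2, ← intervalIntegral.integral_interval_sub_left (hHi t ht0) (hHi _ hta0),
        intervalIntegral.integral_of_le ht0, intervalIntegral.integral_of_le hta0] at h1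
      simp only [hu, sharp]
      linarith
  -- a continuous function whose derivative vanishes off a countable set is constant
  have h0 := integral_eq_of_hasDerivAt_off_countable_of_le u (fun _ => 0) hT
    (countable_notMem_flowDomain (n := n) hΩ.isOpen z) (huc.mono Icc_subset_Ici_self)
    (fun t ht => hderiv t ht.1.1 ?_) (by simp)
  · simp only [intervalIntegral.integral_zero, hu, sharp, Ioc_self, setIntegral_empty,
      traj_zero (hitTime_pos_of_mem hΩ.isOpen hz.1)] at h0
    linarith
  · by_contra hcon
    obtain ⟨T', hT', hE⟩ := hz.2 t
    exact ht.2 ⟨ht.1.1, ⟨T', hT', hE⟩, hcon⟩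

/-- Every admissible solution is, up to a null set, a measurable function with values in the unit
interval, and it solves the integral equation along almost all trajectories. -/
lemma IsSolution.exists_mild (hΩ : IsRegularDomain Ω n) (hbm : Measurable b)
    (hb : Integrable b (volume.prod surface)) (hb0 : ∀ p, 0 ≤ b p) {g : ℝ × E3 × E3 → ℝ}
    (hg : IsSolution Ω n b f₀ g) (hga : IsAdmissible Ω g) :
    ∃ f : ℝ × E3 × E3 → ℝ, Measurable f ∧ (∀ q, f q ∈ Icc (0:ℝ) 1) ∧
      g =ᵐ[volume.restrict (timePhase Ω)] f ∧
      ∀ᵐ z : E3 × E3, z.1 ∈ Ω → IsRegularPoint Ω n z ∧ ∀ t, 0 ≤ t →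
        g (t, traj Ω n t z) = f₀ z + ∫ s in Ioc 0 t, Q b f (s, traj Ω n s z) := by
  have hgm := hga.1.aestronglyMeasurable
  set f : ℝ × E3 × E3 → ℝ := fun q => clamp (hgm.mk g q) with hf
  have hfm : Measurable f := measurable_clamp.comp hgm.stronglyMeasurable_mk.measurable
  have hf01 : ∀ q, f q ∈ Icc (0:ℝ) 1 := fun q => clamp_mem _
  have hf1 : ∀ q, |f q| ≤ 1 := fun q => by
    rw [abs_of_nonneg (hf01 q).1]
    exact (hf01 q).2
  have hgf : g =ᵐ[volume.restrict (timePhase Ω)] f := by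
    filter_upwards [hgm.ae_eq_mk, hga.2] with q hq hq'
    rw [hf]
    simp only
    rw [← hq, clamp_of_mem hq']
  have hQm : Measurable (Q b f) := measurable_Q hbm hfm
  have hQ := abs_Q_le hbm hb hb0 hf01
  set B := ∫ p, b p ∂(volume.prod surface) with hB
  have hQgm := hg.equation.2.1.aestronglyMeasurable
  -- almost every collision takes place between velocities at which `g` and `f` agree
  have hQQ : Q b g =ᵐ[volume.restrict (timePhase Ω)] Q b f := by
    refine hQgm.ae_eq_mk.trans ?_
    refine ae_timePhase_of_ae_ae hΩ.isOpen
      (measurableSet_eq_fun hQgm.stronglyMeasurable_mk.measurable hQm) ?_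
    filter_upwards [ae_collision_timePhase hΩ.isOpen (hgf.and hQgm.ae_eq_mk)] with t ht
    filter_upwards [ht] with x hx
    filter_upwards [hx] with v hv ht0 hxΩ
    obtain ⟨⟨h1, h2⟩, h3⟩ := hv ht0 hxΩ
    rw [← h2, Q, Q]
    refine integral_congr_ae ?_
    filter_upwards [h3] with p hp
    simp only [collisionIntegrand]
    rw [hp.1.1, hp.2.1.1, hp.2.2.1, h1]
  have hO := isOpen_timePhase hΩ.isOpen
  have hweak := (hg.equation.congr hgf hQQ).2.2
  have hgf' := (ae_restrict_iff' hO.measurableSet).1 hgf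
  have hinc : ∀ᵐ q : ℝ × E3 × E3, ∀ a : ℚ, 0 ≤ a → q ∈ backwardSet (timePhase Ω) a →
      g q - g (shift (-a) q) = ∫ r in Ioc 0 (a : ℝ), Q b f (shift (-r) q) := by
    rw [ae_all_iff]
    intro a
    by_cases ha : 0 ≤ a
    · have ha' : (0:ℝ) ≤ a := by exact_mod_cast ha
      filter_upwards [hgf', (measurePreserving_shift (-a)).quasiMeasurePreserving.ae hgf',
        shift_of_weak (C := max 1 B) hO hfm (fun q => (hf1 q).trans (le_max_left _ _)) hQm
          (fun q => (hQ q).trans (le_max_right _ _)) hweak ha'] with q h1 h2 h3 _ hq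
      rw [h1 (by simpa using hq 0 ⟨le_rfl, ha'⟩), h2 (hq a ⟨ha', le_rfl⟩)]
      exact h3 hq
    · exact Eventually.of_forall fun q h => absurd h ha
  refine ⟨f, hfm, hf01, hgf, ?_⟩
  filter_upwards [ae_isRegularPoint hΩ, (ae_phase_iff hΩ.isOpen).1 hg.initial,
    (ae_phase_iff hΩ.isOpen).1 hg.boundary, ae_along_flow hΩ (ae_restrict_of_ae hinc)]
    with z h1 h2 h3 h4 hz
  refine ⟨h1 hz, fun t ht => ?_⟩
  rw [← h2 hz]
  exact (h1 hz).eq_primitive hΩ hQm hQ (h3 hz) h4 ht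

theorem IsSolution.unique (hΩ : IsRegularDomain Ω n) (hbm : Measurable b)
    (hb : Integrable b (volume.prod surface)) (hb0 : ∀ p, 0 ≤ b p) {g g' : ℝ × E3 × E3 → ℝ}
    (hg : IsSolution Ω n b f₀ g) (hga : IsAdmissible Ω g) (hg' : IsSolution Ω n b f₀ g')
    (hga' : IsAdmissible Ω g') : g =ᵐ[volume.restrict (timePhase Ω)] g' := by
  obtain ⟨f, hfm, hf01, hgf, hmild⟩ := hg.exists_mild hΩ hbm hb hb0 hga
  obtain ⟨f', hfm', hf01', hgf', hmild'⟩ := hg'.exists_mild hΩ hbm hb hb0 hga'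
  have hQm : Measurable (Q b f) := measurable_Q hbm hfm
  have hQm' : Measurable (Q b f') := measurable_Q hbm hfm'
  have hQ := abs_Q_le hbm hb hb0 hf01
  have hQ' := abs_Q_le hbm hb hb0 hf01'
  set B := ∫ p, b p ∂(volume.prod surface) with hBdef
  have hB : 0 ≤ B := integral_nonneg hb0
  set l := 16 * B + 1 with hl
  have hl0 : 0 < l := by rw [hl]; linarith
  -- the contraction argument of the existence proof, for bounds which hold almost everywhere
  have key : ∀ j : ℕ, ∀ᵐ q ∂(volume.restrict (timePhase Ω)),
      |f q - f' q| ≤ (1 / 2) ^ j * Real.exp (l * q.1) := by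
    intro j
    induction j with
    | zero =>
      filter_upwards [ae_restrict_mem (isOpen_timePhase hΩ.isOpen).measurableSet] with q hq
      have h1 : 1 ≤ Real.exp (l * q.1) :=
        Real.one_le_exp (mul_nonneg hl0.le (mem_timePhase.1 hq).1.le)
      rw [pow_zero, one_mul]
      refine le_trans ?_ h1
      rw [abs_le]
      constructor <;> linarith [(hf01 q).1, (hf01 q).2, (hf01' q).1, (hf01' q).2]
    | succ j ih =>
      set M : ℝ := (1 / 2) ^ j with hM
      have hM0 : 0 ≤ M := by positivity
      have hQQ : ∀ᵐ q ∂(volume.restrict (timePhase Ω)),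
          |Q b f q - Q b f' q| ≤ 8 * B * M * Real.exp (l * q.1) := by
        refine ae_timePhase_of_ae_ae hΩ.isOpen (measurableSet_le (hQm.sub hQm').norm
          (by fun_prop)) ?_
        filter_upwards [ae_collision_timePhase hΩ.isOpen ih] with t ht
        filter_upwards [ht] with x hx
        filter_upwards [hx] with v hv ht0 hxΩ
        obtain ⟨h1, h2⟩ := hv ht0 hxΩ
        rw [mul_assoc]
        exact abs_integral_collisionIntegrand_sub_le hbm hb hb0
          (integrable_collisionIntegrand hbm hb hfm hf01 (t, x, v))
          (integrable_collisionIntegrand hbm hb hfm' hf01' (t, x, v))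
          (Eventually.of_forall fun _ => ⟨hf01 _, hf01 _, hf01 _, hf01 _⟩)
          (Eventually.of_forall fun _ => ⟨hf01' _, hf01' _, hf01' _, hf01' _⟩) h1 h2
      have hz : ∀ᵐ z : E3 × E3, z.1 ∈ Ω → ∀ t, 0 ≤ t →
          |g (t, traj Ω n t z) - g' (t, traj Ω n t z)| ≤ M * (1 / 2) * Real.exp (l * t) := by
        filter_upwards [hmild, hmild', ae_along_flow hΩ hQQ] with z h1 h2 h3 hzΩ t ht
        have hreg := (h1 hzΩ).1
        rw [(h1 hzΩ).2 t ht, (h2 hzΩ).2 t ht, add_sub_add_left_eq_sub, ← integral_sub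
          (hreg.integrableOn_comp_traj hΩ hQm hQ t) (hreg.integrableOn_comp_traj hΩ hQm' hQ' t)]
        refine (abs_integral_le_of_le_exp (c := 8 * B * M) (by positivity) hl0 ht ?_).trans ?_
        · rw [ae_restrict_iff' measurableSet_Ioc]
          filter_upwards [h3, hreg.ae_mem_flowDomain hΩ.isOpen] with s hs hs' hst
          exact hs (hs' hst.1)
        · refine mul_le_mul_of_nonneg_right ?_ (Real.exp_pos _).le
          rw [div_le_iff₀ hl0, hl]
          nlinarith
      filter_upwards [hgf, hgf', ae_starting_point hΩ hz] with q h1 h2 ⟨z, h3, h4⟩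
      have h5 := h3 q.1 h4.pos.le
      rw [h4.traj_eq hΩ.isOpen] at h5
      rw [← h1, ← h2, pow_succ]
      exact h5
  filter_upwards [hgf, hgf', ae_all_iff.2 key] with q h1 h2 h3
  rw [h1, h2]
  have h4 : Tendsto (fun j : ℕ => (1 / 2 : ℝ) ^ j * Real.exp (l * q.1)) atTop (𝓝 0) := by
    simpa using (tendsto_pow_atTop_nhds_zero_of_lt_one (r := (1 / 2 : ℝ)) (by norm_num)
      (by norm_num)).mul_const (Real.exp (l * q.1))
  have h5 : |f q - f' q| ≤ 0 := ge_of_tendsto' h4 h3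
  exact sub_eq_zero.1 (abs_nonpos_iff.1 h5)

end Uniqueness

/-! ### The whole space and measurable representatives of the data -/

section Reduction

variable {b b' : E3 × S2 → ℝ} {f₀ f₀' : E3 × E3 → ℝ} {f : ℝ × E3 × E3 → ℝ}

lemma IsSolution.congr_kernel (h : b =ᵐ[volume.prod surface] b') (hf : IsSolution Ω n b f₀ f) :
    IsSolution Ω n b' f₀ f where
  collision_integrable := hf.collision_integrable.mono fun _ hq =>
    hq.congr (collisionIntegrand_congr_ae h _ _)
  equation := by
    rw [← Q_congr_ae h]
    exact hf.equation
  initial := hf.initial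
  boundary := hf.boundary

lemma IsSolution.congr_initial (h : f₀ =ᵐ[volume.restrict (phase Ω)] f₀')
    (hf : IsSolution Ω n b f₀ f) : IsSolution Ω n b f₀' f where
  collision_integrable := hf.collision_integrable
  equation := hf.equation
  initial := by
    filter_upwards [hf.initial, h] with z hz hz'
    rw [hz, hz']
  boundary := hf.boundary

lemma isRegularDomain_univ : IsRegularDomain univ fun _ => 0 where
  isOpen := isOpen_univ
  contDiff_normal := contDiff_const
  local_graph := by simp
  bounded_curvature := ⟨0, by simp⟩

/-- Without a boundary the normal plays no role. -/
lemma traj_univ (n n' : E3 → E3) : traj univ n = traj univ n' := by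
  have hhit : ∀ z, hitTime univ z = ⊤ := by simp [hitTime]
  have hcount : ∀ (n : E3 → E3) t z, bounceCount univ n t z = 0 := by
    intro n t z
    have : {k : ℕ | bounceTime univ n z k ≤ ENNReal.ofReal t} = {0} := by
      ext k
      cases k with
      | zero => simp [bounceTime]
      | succ k => simp [bounceTime, hhit]
    rw [bounceCount, this]
    simp
  funext t z
  simp [traj, hcount, bounceState, bounceTime]

lemma IsSolution.congr_normal {n' : E3 → E3} (h : traj Ω n = traj Ω n')
    (hf : IsSolution Ω n b f₀ f) : IsSolution Ω n' b f₀ f where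
  collision_integrable := hf.collision_integrable
  equation := hf.equation
  initial := hf.initial
  boundary := by
    have hb := hf.boundary
    unfold sharp at hb ⊢
    rwa [← h]

/-- Well-posedness in a regular domain, for arbitrary representatives of the data. -/
theorem exists_unique_solution (hΩ : IsRegularDomain Ω n)
    (hb : Integrable b (volume.prod surface)) (hb0 : ∀ᵐ p ∂(volume.prod surface), 0 ≤ b p)
    (hf₀ : AEStronglyMeasurable f₀ (volume.restrict (phase Ω)))
    (hf₀' : ∀ᵐ z ∂(volume.restrict (phase Ω)), 0 ≤ f₀ z ∧ f₀ z ≤ 1) :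
    ∃ f : ℝ × E3 × E3 → ℝ, IsSolution Ω n b f₀ f ∧ IsAdmissible Ω f ∧
      (∀ᵐ z ∂(volume.restrict (phase Ω)), ∀ T : ℝ, 0 ≤ T →
        AbsolutelyContinuousOnInterval (fun t => sharp Ω n f t z) 0 T) ∧
      ∀ g : ℝ × E3 × E3 → ℝ, IsSolution Ω n b f₀ g → IsAdmissible Ω g →
        g =ᵐ[volume.restrict (timePhase Ω)] f := by
  set k : E3 × S2 → ℝ := fun p => max (hb.aestronglyMeasurable.mk b p) 0 with hk
  have hkm : Measurable k :=
    hb.aestronglyMeasurable.stronglyMeasurable_mk.measurable.max measurable_const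
  have hbk : b =ᵐ[volume.prod surface] k := by
    filter_upwards [hb.aestronglyMeasurable.ae_eq_mk, hb0] with p hp hp0
    rw [hk]
    simp only
    rw [← hp, max_eq_left hp0]
  have hki : Integrable k (volume.prod surface) := hb.congr hbk
  have hk0 : ∀ p, 0 ≤ k p := fun p => le_max_right _ _
  set e : E3 × E3 → ℝ := fun z => clamp (hf₀.mk f₀ z) with he
  have hem : Measurable e := measurable_clamp.comp hf₀.stronglyMeasurable_mk.measurable
  have hfe : f₀ =ᵐ[volume.restrict (phase Ω)] e := by
    filter_upwards [hf₀.ae_eq_mk, hf₀'] with z hz hz'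
    rw [he]
    simp only
    rw [← hz, clamp_of_mem hz']
  obtain ⟨f, hf, hfa, hfac⟩ := exists_solution hΩ hkm hki hk0 hem fun z => clamp_mem _
  refine ⟨f, (hf.congr_kernel hbk.symm).congr_initial hfe.symm, hfa, hfac, fun g hg hga => ?_⟩
  exact ((hg.congr_kernel hbk).congr_initial hfe).unique hΩ hkm hki hk0 hga hf hfa

end Reduction

end BFD

end

theorem mainTheorem1
    (Ω : Set BFD.E3) (n : BFD.E3 → BFD.E3)
    (hΩ : Ω = univ ∨ BFD.IsRegularDomain Ω n)
    (b : BFD.E3 × BFD.S2 → ℝ)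
    (hb : Integrable b (volume.prod BFD.surface))
    (hb0 : ∀ᵐ p ∂(volume.prod BFD.surface), 0 ≤ b p)
    (f₀ : BFD.E3 × BFD.E3 → ℝ)
    (hf₀ : MemLp f₀ ⊤ (volume.restrict (BFD.phase Ω)))
    (hf₀' : ∀ᵐ z ∂(volume.restrict (BFD.phase Ω)), 0 ≤ f₀ z ∧ f₀ z ≤ 1) :
    ∃ f : ℝ × BFD.E3 × BFD.E3 → ℝ,
      BFD.IsSolution Ω n b f₀ f ∧ BFD.IsAdmissible Ω f ∧
      (∀ᵐ z ∂(volume.restrict (BFD.phase Ω)), ∀ T : ℝ, 0 ≤ T →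
        AbsolutelyContinuousOnInterval (fun t => BFD.sharp Ω n f t z) 0 T) ∧
      (∀ g : ℝ × BFD.E3 × BFD.E3 → ℝ,
        BFD.IsSolution Ω n b f₀ g → BFD.IsAdmissible Ω g →
        g =ᵐ[volume.restrict (BFD.timePhase Ω)] f) := by
  rcases hΩ with rfl | hΩ
  · obtain ⟨f, hf, hfa, hfac, hu⟩ := BFD.exists_unique_solution BFD.isRegularDomain_univ hb hb0
      hf₀.aestronglyMeasurable hf₀'
    have htraj := BFD.traj_univ (fun _ => 0) n
    refine ⟨f, hf.congr_normal htraj, hfa, ?_, fun g hg hga =>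
      hu g (hg.congr_normal htraj.symm) hga⟩
    unfold BFD.sharp at hfac ⊢
    rwa [← htraj]
  · exact BFD.exists_unique_solution hΩ hb hb0 hf₀.aestronglyMeasurable hf₀'
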